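/- Let $\tau=\frac{1+\sqrt5}{2}$, let $l_1,\dots,l_6$ be the standard basis of $\mathbb R^6$, let $D_6=\{x\in\mathbb Z^6:\sum_i x_i \text{ even}\}$, and for $c\in\mathbb R^6$ let the Delone cell centred at $c$ be the convex hull of the points of $D_6$ nearest to $c$. Put $\omega_1=l_1$, $\omega_5=\frac12(l_1+\dots+l_5-l_6)$, $\omega_6=\frac12(l_1+\dots+l_6)$. Let $E_\parallel\subset\mathbb R^6$ be the three-dimensional subspace spanned by $$(1,-1,0,0,\tau,-\tau),\quad(\tau,\tau,1,1,0,0),\quad(0,0,\tau,-\tau,1,1),$$ onto which $l_1,\dots,l_6$ project orthogonally as $(2(2+\tau))^{-1/2}$ times $(1,\tau,0),(-1,\tau,0),(0,1,\tau),(0,1,-\tau),(\tau,0,1),(-\tau,0,1)$ (the coordinates refer to the orthonormal basis of $E_\parallel$ obtained by normalizing the three spanning vectors). Lengths in $E_\parallel$ are measured in the unit $\sqrt{2/(2+\tau)}$. Let $t_1,\dots,t_6$ be the tetrahedra whose four faces are triangles with the following edge lengths: - $t_1$: $2\times(1,1,1)$, $2\times(1,1,\tau)$; - $t_2$: $1\times(1,1,1)$,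 $2\times(1,1,\tau)$, $1\times(1,\tau,\tau)$; - $t_3$: $1\times(\tau,\tau,\tau)$, $3\times(1,1,\tau)$; - $t_4$: $1\times(1,1,1)$, $3\times(1,\tau,\tau)$; - $t_5$: $1\times(\tau,\tau,\tau)$, $1\times(1,1,\tau)$, $2\times(1,\tau,\tau)$; - $t_6$: $2\times(\tau,\tau,\tau)$, $2\times(1,\tau,\tau)$. All edges of the six tiles have length $1$ or $\tau$, and the volumes of $t_1,\dots,t_6$ are $\frac1{12},\frac{\tau}{12},\frac{\tau}{12},\frac{\tau^2}{12},\frac{\tau^2}{12},\frac{\tau^3}{12}$. "A dissection $\sum_k n_kt_k$" means a family of tetrahedra with pairwise disjoint interiors, $n_k$ of them being copies of $t_k$, whose union is the given solid. (i) The Delone cell centred at $\omega_1$ is the cross polytope with the $12$ vertices $\omega_1\pm l_i$. It has exactly $240$ three-dimensional faces, all of them tetrahedra. Exactly $60$ of these have planar (degenerate) projections to $E_\parallel$; each of the other $180$ projects to a copy of $t_1,t_2,t_5$ or $t_6$, and all four types occur. The cell projects to a regular icosahedron $i(1)$ of edge length $1$, and this has a dissection $$i(1)=7t_1+6t_2+2t_5+t_6$$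 into projections of three-dimensional faces of the cell. (ii) The Delone cells centred at $\omega_5$ and $\omega_6$ are the hemicubes whose $32$ vertices are the points $\omega_5+\frac12\sum_i\varepsilon_il_i$ with $\varepsilon_i=\pm1$, $\prod_i\varepsilon_i=-1$, and $\omega_6+\frac12\sum_i\varepsilon_il_i$ with $\varepsilon_i=\pm1$, $\prod_i\varepsilon_i=1$, respectively. Each has exactly $640$ three-dimensional faces, all of them tetrahedra. Exactly $120$ of these have planar projections to $E_\parallel$; each of the other $520$ projects to a copy of one of $t_1,\dots,t_6$, and for each cell all six types occur. The cell centred at $\omega_5$ projects to a regular icosahedron $i(\tau)$ of edge length $\tau$, and the cell centred at $\omega_6$ to a regular dodecahedron $d(1)$ of edge length $1$. These have dissections $$i(\tau)=t_1+8t_2+10t_3+10t_4+16t_5+3t_6,$$ $$d(1)=3t_1+4t_2+10t_3+10t_4+4t_5+7t_6$$ into projections of three-dimensional faces of the respective cell. -/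

import Mathlib

noncomputable section

/-! ### The root lattice `D₆` and its Delone cells -/

/-- Six-dimensional Euclidean space; its standard basis is `l₁, …, l₆`. -/
abbrev V6 : Type := EuclideanSpace ℝ (Fin 6)

/-- The standard basis vectors `l₁, …, l₆`. -/
def basisVec (i : Fin 6) : V6 := EuclideanSpace.single i 1

/-- The root lattice `D₆`: integer vectors with even coordinate sum. -/
def latticeD6 : Set V6 :=
  {x | ∃ z : Fin 6 → ℤ, (∀ i, x i = (z i : ℝ)) ∧ Even (∑ i, z i)}

/-- The points of `D₆` nearest to `c`, i.e. the vertices of the Delone cell centred at `c`. -/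
def deloneVertices (c : V6) : Set V6 :=
  {x | x ∈ latticeD6 ∧ ∀ y ∈ latticeD6, dist x c ≤ dist y c}

/-- The Delone cell of `D₆` centred at `c`: the convex hull of the lattice points nearest to `c`. -/
def deloneCell (c : V6) : Set V6 := convexHull ℝ (deloneVertices c)

/-- The fundamental weight `ω₁ = l₁`. -/
def omega1 : V6 := !₂[1, 0, 0, 0, 0, 0]

/-- The fundamental weight `ω₅ = (l₁ + l₂ + l₃ + l₄ + l₅ - l₆) / 2`. -/
def omega5 : V6 := !₂[1/2, 1/2, 1/2, 1/2, 1/2, -1/2]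

/-- The fundamental weight `ω₆ = (l₁ + l₂ + l₃ + l₄ + l₅ + l₆) / 2`. -/
def omega6 : V6 := !₂[1/2, 1/2, 1/2, 1/2, 1/2, 1/2]

/-- A tetrahedron: the convex hull of four affinely independent points. -/
def IsTetrahedron {X : Type*} [NormedAddCommGroup X] [NormedSpace ℝ X] (F : Set X) : Prop :=
  ∃ v : Fin 4 → X, AffineIndependent ℝ v ∧ F = convexHull ℝ (Set.range v)

/-- The three-dimensional faces of a polytope `P` (all faces of a polytope are exposed). -/
def threeFaces (P : Set V6) : Set (Set V6) :=
  {F | IsExposed ℝ P F ∧ Module.finrank ℝ (vectorSpan ℝ F) = 3}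

/-! ### The space `E_∥` and the orthogonal projection onto it -/

/-- The three-dimensional space `E_∥`. The three spanning vectors are pairwise orthogonal and have
the same length, so in the corresponding orthonormal basis the projections of `l₁, …, l₆` are
`(1, τ, 0)`, `(-1, τ, 0)`, `(0, 1, τ)`, `(0, 1, -τ)`, `(τ, 0, 1)`, `(-τ, 0, 1)`
divided by `Real.sqrt (2 (2 + τ))`: they span the six five-fold axes of an icosahedron. -/
def Epar : Submodule ℝ V6 :=
  Submodule.span ℝ
    {!₂[1, -1, 0, 0, Real.goldenRatio, -Real.goldenRatio],
     !₂[Real.goldenRatio, Real.goldenRatio, 1, 1, 0, 0],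
     !₂[0, 0, Real.goldenRatio, -Real.goldenRatio, 1, 1]}

/-- The orthogonal projection of a subset of six-dimensional space onto `E_∥`. -/
def projPar (F : Set V6) : Set Epar := (fun x => Epar.orthogonalProjectionOnto x) '' F

/-- The overall factor arising from the projection: the length in `E_∥` that is taken as the unit
of length. -/
def unitLen : ℝ := Real.sqrt (2 / (2 + Real.goldenRatio))

/-! ### The six fundamental tiles

The tile `t_k` (`k = 1, …, 6`) has index `k - 1 : Fin 6`. -/

section Tiles

variable {X : Type*} [NormedAddCommGroup X] [InnerProductSpace ℝ X]

/-- The edge lengths of the face opposite to the vertex `v i`. -/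
def faceEdges (v : Fin 4 → X) (i : Fin 4) : Multiset ℝ :=
  {dist (v (i.succAbove 0)) (v (i.succAbove 1)),
   dist (v (i.succAbove 0)) (v (i.succAbove 2)),
   dist (v (i.succAbove 1)) (v (i.succAbove 2))}

/-- The faces of the tiles, in a scale where the edge lengths are `s` and `s * τ`: each face is
given by the multiset of its edge lengths. -/
def tileFaces (s : ℝ) : Fin 6 → Multiset (Multiset ℝ) :=
  let t : ℝ := s * Real.goldenRatio
  ![{{s, s, s}, {s, s, s}, {s, s, t}, {s, s, t}},
    {{s, s, s}, {s, s, t}, {s, s, t}, {s, t, t}},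
    {{t, t, t}, {s, s, t}, {s, s, t}, {s, s, t}},
    {{s, s, s}, {s, t, t}, {s, t, t}, {s, t, t}},
    {{t, t, t}, {s, s, t}, {s, t, t}, {s, t, t}},
    {{t, t, t}, {t, t, t}, {s, t, t}, {s, t, t}}]

/-- The volumes of the tiles (for `s = 1`). -/
def tileVolume : Fin 6 → ℝ :=
  ![1 / 12, Real.goldenRatio / 12, Real.goldenRatio / 12, Real.goldenRatio ^ 2 / 12,
    Real.goldenRatio ^ 2 / 12, Real.goldenRatio ^ 3 / 12]

/-- `v` lists the vertices of a tetrahedron whose faces are those of the tile `k`, scaled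
by `s`. -/
def IsTileVertices (s : ℝ) (k : Fin 6) (v : Fin 4 → X) : Prop :=
  AffineIndependent ℝ v ∧
    ({faceEdges v 0, faceEdges v 1, faceEdges v 2, faceEdges v 3} : Multiset (Multiset ℝ)) =
      tileFaces s k

/-- `T` is a copy of the tile `k`, scaled by `s`. -/
def IsTile (s : ℝ) (k : Fin 6) (T : Set X) : Prop :=
  ∃ v : Fin 4 → X, IsTileVertices s k v ∧ T = convexHull ℝ (Set.range v)

/-- `P` is dissected into tiles scaled by `s`, `n k` of them being copies of the tile `k`, all
tiles being taken from the collection `C`: the tiles have pairwise disjoint interiors and their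
union is `P`. -/
def IsDissected (s : ℝ) (n : Fin 6 → ℕ) (C : Set (Set X)) (P : Set X) : Prop :=
  ∃ T : (Σ k : Fin 6, Fin (n k)) → Set X,
    (∀ j, IsTile s j.1 (T j) ∧ T j ∈ C) ∧
    (Pairwise fun i j => Disjoint (interior (T i)) (interior (T j))) ∧
    (⋃ j, T j) = P

/-! ### Regular icosahedra and dodecahedra -/

/-- The twelve vertices `(0, ±1, ±τ)` (cyclically) of a regular icosahedron of edge length `2`. -/
def icosahedronVertices : Set (EuclideanSpace ℝ (Fin 3)) :=
  {x | ∃ a ∈ ({1, -1} : Set ℝ), ∃ b ∈ ({1, -1} : Set ℝ),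
    x = !₂[0, a, b * Real.goldenRatio] ∨ x = !₂[b * Real.goldenRatio, 0, a] ∨
      x = !₂[a, b * Real.goldenRatio, 0]}

/-- The twenty vertices `(±1, ±1, ±1)` and `(0, ±τ, ±1/τ)` (cyclically) of a regular dodecahedron
of edge length `2 / τ`. -/
def dodecahedronVertices : Set (EuclideanSpace ℝ (Fin 3)) :=
  {x | ∃ a ∈ ({1, -1} : Set ℝ), ∃ b ∈ ({1, -1} : Set ℝ), ∃ c ∈ ({1, -1} : Set ℝ),
    x = !₂[a, b, c] ∨
      x = !₂[0, a * Real.goldenRatio, b / Real.goldenRatio] ∨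
      x = !₂[b / Real.goldenRatio, 0, a * Real.goldenRatio] ∨
      x = !₂[a * Real.goldenRatio, b / Real.goldenRatio, 0]}

/-- `P` is a (solid) regular icosahedron of edge length `l`. -/
def IsIcosahedron (l : ℝ) (P : Set X) : Prop :=
  ∃ f : EuclideanSpace ℝ (Fin 3) →ᵃⁱ[ℝ] X,
    P = f '' convexHull ℝ ((fun x => (l / 2) • x) '' icosahedronVertices)

/-- `P` is a (solid) regular dodecahedron of edge length `l`. -/
def IsDodecahedron (l : ℝ) (P : Set X) : Prop :=
  ∃ f : EuclideanSpace ℝ (Fin 3) →ᵃⁱ[ℝ] X,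
    P = f '' convexHull ℝ
      ((fun x => (l * Real.goldenRatio / 2) • x) '' dodecahedronVertices)

end Tiles

/-- The three-dimensional volume of a subset of the Euclidean space `E_∥`: Lebesgue measure,
normalized so that the cube over an orthonormal basis has volume `1`. -/
def volPar (T : Set Epar) : ENNReal :=
  (measureSpaceOfInnerProductSpace (E := Epar)).volume T

/-- A subset of `E_∥` that is contained in a plane. -/
def IsFlat (T : Set Epar) : Prop := Module.finrank ℝ (vectorSpan ℝ T) ≤ 2

end

/-! Everything is reduced to integer vectors and exact arithmetic in ℤ[τ]. Doubling coordinates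
relative to the centre of a cell turns the vertices of the hemicubes into sign vectors, and those of
the cross polytope into vectors with a single entry ±2.

Faces. A three-dimensional face is the hull of the vertices that maximize a linear form with
coefficients `a`. On the cross polytope the maximizers are governed by the largest |a i|; on a
hemicube by the zeros of `a` or, if there are none, by the smallest |a i|. Apart from excluded
degenerate cases, these vertices are mutually at distance √2, so dimension three means exactly four
of them. This gives 15·16 = 240 faces of the cross polytope and 32·15 + 20·8 = 640 of a hemicube;
`IsFaceList` records that a list is correct and complete.

Projections. In unnormalized coordinates an edge of a face projects to a segment of squared length
16 + mτ, and on the lists m is 0 or 16, so the length is 4 or 4τ. The pattern of long edges decides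
between the six tiles and a plane trapezoid, and Gram determinants give the volumes. What remains is
finite and is evaluated.

Dissections. An explicit choice of faces is checked to project to tiles pairwise separated by
planes. The tiles lie in the projected cell, and their total volume equals an upper bound for the
volume of that solid, so they leave no gap (`iUnion_eq_of_volume_le`). The upper bounds come from
covering one octant of the icosahedron or dodecahedron by cones with apex at the centre. -/

noncomputable section

/-! ### Exact arithmetic in `ℤ[τ]` -/

/-- The real number `a + b τ` represented by the pair `(a, b)`. -/
def ev (x : ℤ × ℤ) : ℝ := x.1 + x.2 * Real.goldenRatio

/-- Multiplication in `ℤ[τ]`. -/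
def zmul (x y : ℤ × ℤ) : ℤ × ℤ :=
  (x.1 * y.1 + x.2 * y.2, x.1 * y.2 + x.2 * y.1 + x.2 * y.2)

/-- The test for `0 ≤ a + b τ`. -/
def znonneg (x : ℤ × ℤ) : Bool :=
  -- Since 2(a + bτ) = (2a + b) + b√5, the sign is found by comparing (2a + b)² with 5b².
  let p := 2 * x.1 + x.2
  if 0 ≤ x.2 then decide (0 ≤ p) || decide (p * p ≤ 5 * (x.2 * x.2))
  else decide (0 ≤ p) && decide (5 * (x.2 * x.2) ≤ p * p)

/-- Vectors with three coordinates in `ℤ[τ]`. -/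
abbrev ZVec : Type := (ℤ × ℤ) × (ℤ × ℤ) × (ℤ × ℤ)

def zadd (x y : ℤ × ℤ) : ℤ × ℤ := (x.1 + y.1, x.2 + y.2)

def zsub (x y : ℤ × ℤ) : ℤ × ℤ := (x.1 - y.1, x.2 - y.2)

def vdot (u v : ZVec) : ℤ × ℤ :=
  zadd (zmul u.1 v.1) (zadd (zmul u.2.1 v.2.1) (zmul u.2.2 v.2.2))

/-- The projection of an integer vector onto `E_∥`, in unnormalized coordinates. -/
def pt (v : Fin 6 → ℤ) : ZVec :=
  -- The entries are the inner products of `v` with the three spanning vectors of `Epar`, each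
  -- written as a pair in ℤ[τ].
  ((v 0 - v 1, v 4 - v 5), (v 2 + v 3, v 0 + v 1), (v 4 + v 5, v 2 - v 3))

/-! ### Enumeration of the three-dimensional faces -/

/-! Functions on `Fin n` given by the list of their values, in a form that evaluates quickly. -/

def mk3 {α : Type*} (a b c : α) : Fin 3 → α := fun i =>
  bif Nat.beq i.val 0 then a else bif Nat.beq i.val 1 then b else c

def mk4 {α : Type*} (a b c d : α) : Fin 4 → α := fun i =>
  bif Nat.beq i.val 0 then a else bif Nat.beq i.val 1 then b else bif Nat.beq i.val 2 then c else d

def mk6 {α : Type*} (a b c d e f : α) : Fin 6 → α := fun i =>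
  bif Nat.beq i.val 0 then a else bif Nat.beq i.val 1 then b else bif Nat.beq i.val 2 then c
  else bif Nat.beq i.val 3 then d else bif Nat.beq i.val 4 then e else f

def signVectors : List (Fin 6 → ℤ) := do
  let a ← [1, -1]
  let b ← [1, -1]
  let c ← [1, -1]
  let d ← [1, -1]
  let e ← [1, -1]
  let f ← [1, -1]
  return mk6 a b c d e f

def quads : List (Fin 4 → Fin 6) :=
  [mk4 0 1 2 3, mk4 0 1 2 4, mk4 0 1 2 5, mk4 0 1 3 4, mk4 0 1 3 5, mk4 0 1 4 5,
   mk4 0 2 3 4, mk4 0 2 3 5, mk4 0 2 4 5, mk4 0 3 4 5, mk4 1 2 3 4, mk4 1 2 3 5,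
   mk4 1 2 4 5, mk4 1 3 4 5, mk4 2 3 4 5]

def triples : List (Fin 3 → Fin 6) :=
  [mk3 0 1 2, mk3 0 1 3, mk3 0 1 4, mk3 0 1 5, mk3 0 2 3, mk3 0 2 4, mk3 0 2 5,
   mk3 0 3 4, mk3 0 3 5, mk3 0 4 5, mk3 1 2 3, mk3 1 2 4, mk3 1 2 5, mk3 1 3 4,
   mk3 1 3 5, mk3 1 4 5, mk3 2 3 4, mk3 2 3 5, mk3 2 4 5, mk3 3 4 5]

def flipAt (s : Fin 6 → ℤ) (i : Fin 6) : Fin 6 → ℤ := fun j =>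
  bif Nat.beq j.val i.val then -s j else s j

/-- The entry is 2 because coordinates are doubled throughout: `emb` halves them, which gives ± a
basis vector. -/
def crossPt (s : Fin 6 → ℤ) (i : Fin 6) : Fin 6 → ℤ := fun j =>
  bif Nat.beq j.val i.val then 2 * s j else 0

theorem flipAt_apply (s : Fin 6 → ℤ) (i j : Fin 6) :
    flipAt s i j = if j = i then -s j else s j := by
  rw [flipAt]
  by_cases h : j = i
  · simp [h]
  · have : Nat.beq j.val i.val = false :=
      Bool.eq_false_iff.2 fun e => h (Fin.ext (Nat.eq_of_beq_eq_true e))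
    simp [h, this]

theorem crossPt_apply (s : Fin 6 → ℤ) (i j : Fin 6) :
    crossPt s i j = if j = i then 2 * s j else 0 := by
  rw [crossPt]
  by_cases h : j = i
  · simp [h]
  · have : Nat.beq j.val i.val = false :=
      Bool.eq_false_iff.2 fun e => h (Fin.ext (Nat.eq_of_beq_eq_true e))
    simp [h, this]

/-- A face is given by four axes and a sign on each. Fixing the sign 1 on the two unused axes lists
each face once. -/
def crossFaces : List (Fin 4 → Fin 6 → ℤ) :=
  quads.flatMap fun q =>
    (signVectors.filter fun s => decide (∀ i, (∀ m, i ≠ q m) → s i = 1)).map fun s m =>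
      crossPt s (q m)

def signProd (s : Fin 6 → ℤ) : ℤ := s 0 * s 1 * s 2 * s 3 * s 4 * s 5

/-- There are two families. A cube vertex `s` of the wrong parity is cut off by the 5-simplex of its
six neighbours, and any four neighbours span a face. In a three-dimensional face of the cube, with
free coordinates `t`, the four vertices of the right parity span a face. Those four differ by flips
of two free coordinates, so exactly one of them has sign 1 at both `t 0` and `t 1`; it serves as
`s`. -/
def hemiFaces (p : ℤ) : List (Fin 4 → Fin 6 → ℤ) :=
  ((signVectors.filter fun s => signProd s == -p).flatMap fun s =>
    quads.map fun q m => flipAt s (q m)) ++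
  ((signVectors.filter fun s => signProd s == p).flatMap fun s =>
    (triples.filter fun t => s (t 0) == 1 && s (t 1) == 1).map fun t =>
      mk4 s (flipAt (flipAt s (t 0)) (t 1)) (flipAt (flipAt s (t 0)) (t 2))
        (flipAt (flipAt s (t 1)) (t 2)))

/-- Squared distances. -/
def distSq6 (u v : Fin 6 → ℤ) : ℤ :=
  (u 0 - v 0) ^ 2 + (u 1 - v 1) ^ 2 + (u 2 - v 2) ^ 2 + (u 3 - v 3) ^ 2 + (u 4 - v 4) ^ 2 +
    (u 5 - v 5) ^ 2

/-! ### Faces of convex hulls -/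

/-- The points of `V` at which the linear functional `l` is maximal. -/
def argmaxSet {E : Type*} (V : Set E) (l : E → ℝ) : Set E := {v | v ∈ V ∧ ∀ w ∈ V, l w ≤ l v}

/-- Split `V` into the maximizers and the points with strictly smaller value. A point of the hull
lies on a segment between the hulls of the two parts; if it is maximal, the weight of the second
part vanishes. -/
theorem convexHull_argmaxSet {E : Type*} [AddCommGroup E] [Module ℝ E] {V : Set E}
    (hV : V.Finite) (l : E →ₗ[ℝ] ℝ) :
    {x | x ∈ convexHull ℝ V ∧ ∀ y ∈ convexHull ℝ V, l y ≤ l x} =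
      convexHull ℝ (argmaxSet V l) := by
  rcases V.eq_empty_or_nonempty with rfl | hne
  · simp [argmaxSet]
  obtain ⟨v₀, hv₀, hmax⟩ := hV.exists_maximalFor l V hne
  have hmax' : ∀ w ∈ V, l w ≤ l v₀ := fun w hw =>
    (le_total (l w) (l v₀)).elim id fun h => hmax hw h
  have hle : ∀ y ∈ convexHull ℝ V, l y ≤ l v₀ := by
    intro y hy
    exact convexHull_min (s := V) (t := {y | l y ≤ l v₀}) hmax'
      (convex_halfSpace_le l.isLinear _) hy
  have hval : ∀ v ∈ argmaxSet V l, l v = l v₀ := fun v hv =>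
    le_antisymm (hmax' v hv.1) (hv.2 v₀ hv₀)
  ext x
  constructor
  · rintro ⟨hx, hxmax⟩
    have hxv : l x = l v₀ := le_antisymm (hle x hx) (hxmax v₀ (subset_convexHull ℝ V hv₀))
    have hsplit : V = argmaxSet V l ∪ {v ∈ V | l v < l v₀} := by
      ext v
      constructor
      · intro hv
        rcases (hmax' v hv).lt_or_eq with h | h
        · exact Or.inr ⟨hv, h⟩
        · exact Or.inl ⟨hv, fun w hw => (hmax' w hw).trans h.ge⟩
      · rintro (h | h)
        · exact h.1
        · exact h.1
    rcases ({v ∈ V | l v < l v₀}).eq_empty_or_nonempty with he | hn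
    · rw [he, Set.union_empty] at hsplit
      rw [← hsplit]
      exact hx
    · rw [hsplit, convexHull_union (show (argmaxSet V l).Nonempty from ⟨v₀, hv₀, hmax'⟩) hn] at hx
      obtain ⟨p, hp, q, hq, hpq⟩ := mem_convexJoin.1 hx
      have hlp : l p = l v₀ := convexHull_min (t := {y | l y = l v₀}) hval
        (convex_hyperplane l.isLinear _) hp
      have hlq : l q < l v₀ := convexHull_min (s := {v ∈ V | l v < l v₀}) (t := {y | l y < l v₀})
        (fun v hv => hv.2)
        (convex_halfSpace_lt l.isLinear _) hq
      obtain ⟨a, b, ha, hb, hab, rfl⟩ := hpq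
      have hb0 : b = 0 := by
        simp only [map_add, map_smul, smul_eq_mul, hlp] at hxv
        have ha' : a = 1 - b := by linarith
        subst ha'
        have : b * (l v₀ - l q) = 0 := by linarith
        rcases mul_eq_zero.1 this with h | h
        · exact h
        · linarith
      have ha1 : a = 1 := by linarith
      simpa [hb0, ha1] using hp
  · intro hx
    have hsub : argmaxSet V l ⊆ V := fun v hv => hv.1
    have hxv : l x = l v₀ := convexHull_min (t := {y | l y = l v₀}) hval
        (convex_hyperplane l.isLinear _) hx
    exact ⟨convexHull_mono hsub hx, fun y hy => (hle y hy).trans hxv.ge⟩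

theorem vectorSpan_convexHull {E : Type*} [AddCommGroup E] [Module ℝ E] (s : Set E) :
    vectorSpan ℝ (convexHull ℝ s) = vectorSpan ℝ s := by
  rw [← direction_affineSpan, affineSpan_convexHull, direction_affineSpan]

theorem mem_threeFaces_iff {V : Set V6} (hV : V.Finite) (F : Set V6) :
    F ∈ threeFaces (convexHull ℝ V) ↔
      ∃ l : StrongDual ℝ V6, F = convexHull ℝ (argmaxSet V l) ∧
        Module.finrank ℝ (vectorSpan ℝ (argmaxSet V l)) = 3 := by
  constructor
  · rintro ⟨hF, h3⟩
    -- The empty set is vacuously exposed; its dimension 0 rules it out.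
    have hne : F.Nonempty := by
      rcases F.eq_empty_or_nonempty with rfl | h
      · rw [vectorSpan_empty, finrank_bot] at h3
        omega
      · exact h
    obtain ⟨l, rfl⟩ := hF hne
    have h := convexHull_argmaxSet hV (l : V6 →ₗ[ℝ] ℝ)
    refine ⟨l, h, ?_⟩
    erw [h, vectorSpan_convexHull] at h3
    exact h3
  · rintro ⟨l, rfl, h3⟩
    refine ⟨fun _ => ⟨l, (convexHull_argmaxSet hV (l : V6 →ₗ[ℝ] ℝ)).symm⟩, ?_⟩
    rw [vectorSpan_convexHull]
    exact h3

/-- A face determines its set of vertices. -/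
theorem argmaxSet_eq_of_convexHull_eq {E : Type*} [AddCommGroup E] [Module ℝ E] {V : Set E}
    (hV : V.Finite) (l m : E →ₗ[ℝ] ℝ)
    (h : convexHull ℝ (argmaxSet V l) = convexHull ℝ (argmaxSet V m)) :
    argmaxSet V l = argmaxSet V m := by
  have key : ∀ l' : E →ₗ[ℝ] ℝ, argmaxSet V l' = V ∩ convexHull ℝ (argmaxSet V l') := by
    intro l'
    ext v
    constructor
    · exact fun hv => ⟨hv.1, subset_convexHull ℝ _ hv⟩
    · rintro ⟨hv, hv'⟩
      rw [← convexHull_argmaxSet hV l'] at hv'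
      exact ⟨hv, fun w hw => hv'.2 w (subset_convexHull ℝ V hw)⟩
  rw [key l, key m, h]

/-- Pairwise equidistant points are affinely independent. -/
theorem affineIndependent_of_equidistant {ι E : Type*} [Fintype ι] [NormedAddCommGroup E]
    [InnerProductSpace ℝ E] (p : ι → E) {c : ℝ} (hc : 0 < c)
    (h : ∀ i j, i ≠ j → dist (p i) (p j) ^ 2 = c) : AffineIndependent ℝ p := by
  classical
  rw [affineIndependent_iff_of_fintype]
  intro w hw hw0 
  -- For weights of sum zero, |∑ wᵢpᵢ|² = -½ ∑ wᵢwⱼ dist(pᵢ, pⱼ)². With all squared distances equal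
  -- to `c` this is (c/2) ∑ wᵢ², which vanishes only for w = 0.
  have h1 := EuclideanGeometry.inner_weightedVSub (s₁ := Finset.univ) (w₁ := w) p hw
    (s₂ := Finset.univ) (w₂ := w) p hw
  rw [hw0, inner_zero_left] at h1
  have h2 : ∑ i, ∑ j, w i * w j * (dist (p i) (p j) * dist (p i) (p j)) = - c * ∑ i, w i ^ 2 := by
    have : ∀ i j, w i * w j * (dist (p i) (p j) * dist (p i) (p j)) =
        c * (w i * w j) - if i = j then c * w i ^ 2 else 0 := by
      intro i j
      split_ifs with hij
      · subst hij; simp; ring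
      · have := h i j hij
        rw [← pow_two, this]; ring
    simp only [this, Finset.sum_sub_distrib, ← Finset.mul_sum, Finset.sum_ite_eq, Finset.mem_univ,
      if_true]
    simp only [hw, mul_zero, Finset.sum_const_zero]
    ring
  rw [h2] at h1
  have h3 : ∑ i, w i ^ 2 = 0 := by
    have : c * ∑ i, w i ^ 2 = 0 := by linarith
    exact (mul_eq_zero.1 this).resolve_left hc.ne'
  intro i
  have := (Finset.sum_eq_zero_iff_of_nonneg (fun i _ => sq_nonneg (w i))).1 h3 i (Finset.mem_univ i)
  exact pow_eq_zero_iff (two_ne_zero) |>.1 this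

/-! ### Vertices of the Delone cells -/

/-- The vertex of a cell centred at `c` with twice the relative position `v`. -/
def emb (c : V6) (v : Fin 6 → ℤ) : V6 := c + WithLp.toLp 2 fun i => (v i : ℝ) / 2

theorem dist_emb_sq (c : V6) (u v : Fin 6 → ℤ) :
    dist (emb c u) (emb c v) ^ 2 = (distSq6 u v : ℝ) / 4 := by
  rw [emb, emb, dist_add_left, EuclideanSpace.dist_sq_eq]
  simp only [Real.dist_eq, sq_abs, Fin.sum_univ_six, distSq6]
  push_cast
  ring

theorem emb_injective (c : V6) : Function.Injective (emb c) := by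
  intro u v h
  funext i
  have := congrArg (fun x : V6 => x i) h
  simp only [emb, PiLp.add_apply] at this
  have h2 : (u i : ℝ) = v i := by linarith
  exact_mod_cast h2

/-- The linear form with coefficients `a`. -/
def lin (a : Fin 6 → ℝ) (v : Fin 6 → ℤ) : ℝ := ∑ i, a i * v i

def IsSign (s : Fin 6 → ℤ) : Prop := ∀ i, s i = 1 ∨ s i = -1

theorem mem_signVectors {s : Fin 6 → ℤ} : s ∈ signVectors ↔ IsSign s := by
  constructor
  · revert s
    unfold IsSign
    decide +kernel
  · intro h
    have hs : s = mk6 (s 0) (s 1) (s 2) (s 3) (s 4) (s 5) := by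
      funext i
      fin_cases i <;> rfl
    rw [hs]
    have hm : ∀ i, s i ∈ [(1 : ℤ), -1] := fun i => by simpa using h i
    refine List.mem_flatMap.2 ⟨_, hm 0, List.mem_flatMap.2 ⟨_, hm 1, List.mem_flatMap.2 ⟨_, hm 2,
      List.mem_flatMap.2 ⟨_, hm 3, List.mem_flatMap.2 ⟨_, hm 4,
        List.mem_flatMap.2 ⟨_, hm 5, ?_⟩⟩⟩⟩⟩⟩
    exact List.mem_singleton.2 rfl

/-- The vertices of the cross polytope. -/
def crossVerts : Set (Fin 6 → ℤ) := {v | ∃ s i, IsSign s ∧ v = crossPt s i}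

/-- The vertices of the hemicube of parity `p`. -/
def hemiVerts (p : ℤ) : Set (Fin 6 → ℤ) := {s | IsSign s ∧ signProd s = p}

theorem IsSign.flipAt {s : Fin 6 → ℤ} (h : IsSign s) (i : Fin 6) : IsSign (flipAt s i) := by
  intro j
  rw [flipAt_apply]
  split_ifs
  · rcases h j with h | h <;> simp [h]
  · exact h j

theorem signProd_flipAt (s : Fin 6 → ℤ) (i : Fin 6) : signProd (flipAt s i) = -signProd s := by
  fin_cases i <;> simp [signProd, flipAt_apply]

theorem IsSign.signProd {s : Fin 6 → ℤ} (h : IsSign s) : signProd s = 1 ∨ signProd s = -1 := by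
  have := mem_signVectors.2 h
  clear h
  revert s
  decide +kernel

theorem IsSign.finite : {s | IsSign s}.Finite := by
  have : {s | IsSign s} = {s | s ∈ signVectors} := by
    ext s
    exact mem_signVectors.symm
  rw [this]
  exact List.finite_toSet _

theorem hemiVerts_finite (p : ℤ) : (hemiVerts p).Finite :=
  IsSign.finite.subset fun _ h => h.1

theorem crossVerts_finite : crossVerts.Finite := by
  refine ((IsSign.finite.prod (Set.finite_univ (α := Fin 6))).image
    fun x => crossPt x.1 x.2).subset ?_
  rintro v ⟨s, i, hs, rfl⟩
  exact ⟨(s, i), ⟨hs, trivial⟩, rfl⟩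

theorem exists_quad_of_card {I : Finset (Fin 6)} (h : I.card = 4) :
    ∃ q ∈ quads, ∀ i, i ∈ I ↔ ∃ m, i = q m := by
  revert I
  decide +kernel

theorem exists_triple_of_card {I : Finset (Fin 6)} (h : I.card = 3) :
    ∃ q ∈ triples, ∀ i, i ∈ I ↔ ∃ m, i = q m := by
  revert I
  decide +kernel

theorem injective_of_mem_quads {q : Fin 4 → Fin 6} (h : q ∈ quads) : Function.Injective q := by
  have key : quads.all (fun q => decide (q 0 < q 1 ∧ q 1 < q 2 ∧ q 2 < q 3)) = true := by
    decide +kernel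
  obtain ⟨h0, h1, h2⟩ := of_decide_eq_true (List.all_eq_true.1 key q h)
  refine StrictMono.injective (Fin.strictMono_iff_lt_succ.2 fun i => ?_)
  fin_cases i
  exacts [h0, h1, h2]

theorem injective_of_mem_triples {q : Fin 3 → Fin 6} (h : q ∈ triples) :
    Function.Injective q := by
  have key : triples.all (fun q => decide (q 0 < q 1 ∧ q 1 < q 2)) = true := by decide +kernel
  obtain ⟨h0, h1⟩ := of_decide_eq_true (List.all_eq_true.1 key q h)
  refine StrictMono.injective (Fin.strictMono_iff_lt_succ.2 fun i => ?_)
  fin_cases i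
  exacts [h0, h1]

theorem exists_sign_real (a : Fin 6 → ℝ) : ∃ s, IsSign s ∧ ∀ i, a i * s i = |a i| := by
  refine ⟨fun i => if 0 ≤ a i then 1 else -1, fun i => ?_, fun i => ?_⟩
  · dsimp only
    split_ifs <;> simp
  · dsimp only
    split_ifs with h
    · simp [abs_of_nonneg h]
    · push Not at h
      simp [abs_of_neg h]

theorem mul_sign_le {s : Fin 6 → ℤ} (h : IsSign s) (x : ℝ) (i : Fin 6) : x * s i ≤ |x| := by
  rcases h i with h | h
  · simp [h, le_abs_self]
  · simp [h, neg_le_abs]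

/-- The maximizers of a linear form with a zero coefficient over a hemicube. -/
theorem argmaxSet_hemiVerts_of_zero {p : ℤ} (hp : p = 1 ∨ p = -1) {a : Fin 6 → ℝ} {z : Fin 6}
    (hz : a z = 0) :
    argmaxSet (hemiVerts p) (lin a) = {t | t ∈ hemiVerts p ∧ ∀ i, a i * t i = |a i|} := by
  -- The sign vector of `a` may have the wrong parity; flipping the coordinate `z`, which does not
  -- affect the form, repairs it.
  obtain ⟨s, ⟨hs, hsp⟩, hsa⟩ : ∃ s, s ∈ hemiVerts p ∧ ∀ i, a i * s i = |a i| := by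
    obtain ⟨s, hs, hsa⟩ := exists_sign_real a
    by_cases h : signProd s = p
    · exact ⟨s, ⟨hs, h⟩, hsa⟩
    · refine ⟨flipAt s z, ⟨hs.flipAt z, ?_⟩, fun i => ?_⟩
      · rw [signProd_flipAt]
        rcases hs.signProd with h' | h' <;> rcases hp with rfl | rfl <;> simp_all
      · by_cases hi : i = z
        · subst hi
          simp [hz]
        · simp [flipAt_apply, hi, hsa]
  have hle : ∀ t ∈ hemiVerts p, lin a t ≤ ∑ i, |a i| := fun t ht =>
    Finset.sum_le_sum fun i _ => mul_sign_le ht.1 _ i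
  have hs' : lin a s = ∑ i, |a i| := Finset.sum_congr rfl fun i _ => hsa i
  ext t
  constructor
  · rintro ⟨ht, hmax⟩
    have : lin a t = ∑ i, |a i| := le_antisymm (hle t ht) (hs' ▸ hmax s ⟨hs, hsp⟩)
    exact ⟨ht, fun i => (Finset.sum_eq_sum_iff_of_le fun i _ => mul_sign_le ht.1 _ i).1 this i
      (Finset.mem_univ i)⟩
  · rintro ⟨ht, hta⟩
    refine ⟨ht, fun w hw => ?_⟩
    have : lin a t = ∑ i, |a i| := Finset.sum_congr rfl fun i _ => hta i
    rw [this]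
    exact hle w hw

theorem lin_flipAt {a : Fin 6 → ℝ} {s : Fin 6 → ℤ} (hsa : ∀ i, a i * s i = |a i|) (i : Fin 6) :
    lin a (flipAt s i) = ∑ j, |a j| - 2 * |a i| := by
  have : ∀ j, a j * (flipAt s i j : ℝ) = |a j| - if j = i then 2 * |a i| else 0 := by
    intro j
    simp only [flipAt_apply]
    split_ifs with h
    · subst h
      push_cast
      linarith [hsa j]
    · simp [hsa]
  simp [lin, this, Finset.sum_sub_distrib]

/-- The maximizers over a hemicube of a linear form whose maximum over the cube is attained at
a single vertex, outside of the hemicube. -/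
theorem argmaxSet_hemiVerts_of_ne {p : ℤ} {a : Fin 6 → ℝ} (ha : ∀ i, a i ≠ 0)
    {s : Fin 6 → ℤ} (hs : IsSign s) (hsp : signProd s = -p) (hp : p = 1 ∨ p = -1)
    (hsa : ∀ i, a i * s i = |a i|) :
    argmaxSet (hemiVerts p) (lin a) = {t | ∃ i, (∀ j, |a i| ≤ |a j|) ∧ t = flipAt s i} := by
  have hmem : ∀ i, flipAt s i ∈ hemiVerts p := fun i =>
    ⟨hs.flipAt i, by rw [signProd_flipAt, hsp, neg_neg]⟩
  have hdiff : ∀ t ∈ hemiVerts p, ∃ i, t i = -s i := by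
    intro t ht
    by_contra! h
    have : t = s := by
      funext i
      have h1 := h i
      rcases ht.1 i with h2 | h2 <;> rcases hs i with h3 | h3 <;> simp_all
    rw [← this, ht.2] at hsp
    rcases hp with rfl | rfl <;> norm_num at hsp
  -- A vertex of the hemicube differs from `s` at some `i` by parity, and is then dominated, term by
  -- term, by the neighbour of `s` across `i`. So only neighbours compete, and the cheapest flips
  -- win.
  have hterm : ∀ t ∈ hemiVerts p, ∀ i, t i = -s i → ∀ j, a j * t j ≤ a j * flipAt s i j := by
    intro t ht i hi j
    simp only [flipAt_apply]
    split_ifs with h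
    · subst h
      rw [hi]
    · rw [hsa]
      exact mul_sign_le ht.1 _ j
  have hle : ∀ t ∈ hemiVerts p, ∀ i, t i = -s i → lin a t ≤ lin a (flipAt s i) :=
    fun t ht i hi => Finset.sum_le_sum fun j _ => hterm t ht i hi j
  ext t
  constructor
  · rintro ⟨ht, hmax⟩
    obtain ⟨i, hi⟩ := hdiff t ht
    have heq : lin a t = lin a (flipAt s i) := le_antisymm (hle t ht i hi) (hmax _ (hmem i))
    refine ⟨i, fun j => ?_, ?_⟩
    · have := hmax _ (hmem j)
      rw [heq, lin_flipAt hsa, lin_flipAt hsa] at this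
      linarith
    · funext j
      have := (Finset.sum_eq_sum_iff_of_le fun j _ => hterm t ht i hi j).1 heq j
        (Finset.mem_univ j)
      exact_mod_cast mul_left_cancel₀ (ha j) this
  · rintro ⟨i, hi, rfl⟩
    refine ⟨hmem i, fun w hw => ?_⟩
    obtain ⟨k, hk⟩ := hdiff w hw
    refine (hle w hw k hk).trans ?_
    rw [lin_flipAt hsa, lin_flipAt hsa]
    linarith [hi k]

theorem lin_crossPt (a : Fin 6 → ℝ) (s : Fin 6 → ℤ) (i : Fin 6) :
    lin a (crossPt s i) = 2 * (a i * s i) := by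
  simp only [lin, crossPt_apply]
  rw [Finset.sum_eq_single i]
  · push_cast [if_pos rfl]
    ring
  · intro j _ hj
    simp [hj]
  · simp

/-- The maximizers of a nonzero linear form over the cross polytope. -/
theorem argmaxSet_crossVerts {a : Fin 6 → ℝ} (ha : ∃ i, a i ≠ 0) {s : Fin 6 → ℤ} (hs : IsSign s)
    (hsa : ∀ i, a i * s i = |a i|) :
    argmaxSet crossVerts (lin a) = {t | ∃ i, (∀ j, |a j| ≤ |a i|) ∧ t = crossPt s i} := by
  ext t
  constructor
  · rintro ⟨⟨t, i, ht, rfl⟩, hmax⟩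
    have h : ∀ j, |a j| ≤ a i * t i := by
      intro j
      have := hmax _ ⟨s, j, hs, rfl⟩
      rw [lin_crossPt, lin_crossPt, hsa] at this
      linarith
    have h' := mul_sign_le ht (a i) i
    refine ⟨i, fun j => (h j).trans h', ?_⟩
    have heq : a i * t i = a i * s i := (hsa i).symm ▸ le_antisymm h' (h i)
    have hai : a i ≠ 0 := by
      intro h0
      obtain ⟨j, hj⟩ := ha
      have := (h j).trans h'
      rw [h0, abs_zero] at this
      exact hj (abs_nonpos_iff.1 this)
    have hti : t i = s i := by exact_mod_cast mul_left_cancel₀ hai heq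
    funext j
    simp only [crossPt_apply]
    split_ifs with hj
    · rw [hj, hti]
    · rfl
  · rintro ⟨i, hi, rfl⟩
    refine ⟨⟨s, i, hs, rfl⟩, ?_⟩
    rintro w ⟨t, j, ht, rfl⟩
    rw [lin_crossPt, lin_crossPt, hsa]
    linarith [mul_sign_le ht (a j) j, hi j]

theorem distSq6_eq_sum (u v : Fin 6 → ℤ) : distSq6 u v = ∑ i, (u i - v i) ^ 2 := by
  rw [Fin.sum_univ_six, distSq6]

/-- All edges of the faces are of this form: the doubled coordinates change by ±2 at two places, so
the true squared length is 8/4 = 2. -/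
theorem distSq6_of_sq_sub {u v : Fin 6 → ℤ} {i j : Fin 6}
    (h : ∀ k, (u k - v k) ^ 2 = (if k = i then 4 else 0) + if k = j then 4 else 0) :
    distSq6 u v = 8 := by
  simp [distSq6_eq_sum, h, Finset.sum_add_distrib]

theorem IsSign.sq {s : Fin 6 → ℤ} (hs : IsSign s) (k : Fin 6) : s k ^ 2 = 1 := by
  rcases hs k with h | h <;> simp [h]

theorem distSq6_flipAt {s : Fin 6 → ℤ} (hs : IsSign s) {i j : Fin 6} (h : i ≠ j) :
    distSq6 (flipAt s i) (flipAt s j) = 8 := by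
  refine distSq6_of_sq_sub (i := i) (j := j) fun k => ?_
  have := hs.sq k
  simp only [flipAt_apply]
  split_ifs with h1 h2
  · exact absurd (h1.symm.trans h2) h
  all_goals linarith

theorem distSq6_crossPt {s : Fin 6 → ℤ} (hs : IsSign s) {i j : Fin 6} (h : i ≠ j) :
    distSq6 (crossPt s i) (crossPt s j) = 8 := by
  refine distSq6_of_sq_sub (i := i) (j := j) fun k => ?_
  have := hs.sq k
  simp only [crossPt_apply]
  split_ifs with h1 h2
  · exact absurd (h1.symm.trans h2) h
  all_goals linarith

theorem affineIndependent_emb {ι : Type*} [Fintype ι] (c : V6) (f : ι → Fin 6 → ℤ)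
    (h : ∀ i j, i ≠ j → distSq6 (f i) (f j) = 8) : AffineIndependent ℝ fun i => emb c (f i) := by
  refine affineIndependent_of_equidistant _ (c := 2) (by norm_num) fun i j hij => ?_
  rw [dist_emb_sq, h i j hij]
  norm_num

/-! ### Classification of the three-dimensional faces -/

/-- `L` lists the vertex sets of the three-dimensional faces of a cell with vertices `S`. -/
structure IsFaceList (S : Set (Fin 6 → ℤ)) (L : List (Fin 4 → Fin 6 → ℤ)) : Prop where
  finite : S.Finite
  exposed : ∀ q ∈ L, ∃ a, argmaxSet S (lin a) = Set.range q
  complete : ∀ c a, Module.finrank ℝ (vectorSpan ℝ (emb c '' argmaxSet S (lin a))) = 3 →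
    ∃ q ∈ L, argmaxSet S (lin a) = Set.range q
  equidistant : ∀ q ∈ L, ∀ i j, i ≠ j → distSq6 (q i) (q j) = 8

/-- Mutually equidistant points are affinely independent, so n of them span dimension n - 1. The
empty family is treated apart because of the truncated subtraction. -/
theorem finrank_family (c : V6) (g : Fin 6 → Fin 6 → ℤ)
    (hg : ∀ i j, i ≠ j → distSq6 (g i) (g j) = 8) (I : Finset (Fin 6))
    (h3 : Module.finrank ℝ (vectorSpan ℝ (emb c '' {t | ∃ i ∈ I, t = g i})) = 3) :
    I.card = 4 := by
  have hr : emb c '' {t | ∃ i ∈ I, t = g i} = Set.range fun i : I => emb c (g i) := by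
    ext x
    constructor
    · rintro ⟨_, ⟨i, hi, rfl⟩, rfl⟩
      exact ⟨⟨i, hi⟩, rfl⟩
    · rintro ⟨⟨i, hi⟩, rfl⟩
      exact ⟨_, ⟨i, hi, rfl⟩, rfl⟩
  rw [hr] at h3
  have hind := affineIndependent_emb c (fun i : I => g i)
    fun i j hij => hg i j fun h => hij (Subtype.ext h)
  rcases I.eq_empty_or_nonempty with rfl | hne
  · rw [Set.range_eq_empty, vectorSpan_empty, finrank_bot] at h3
    omega
  · have hpos := hne.card_pos
    have := hind.finrank_vectorSpan (n := I.card - 1) (by rw [Fintype.card_coe]; omega)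
    omega

theorem exists_quad_family (g : Fin 6 → Fin 6 → ℤ) {I : Finset (Fin 6)} (h : I.card = 4) :
    ∃ q ∈ quads, {t | ∃ i ∈ I, t = g i} = Set.range fun m => g (q m) := by
  obtain ⟨q, hq, hI⟩ := exists_quad_of_card h
  refine ⟨q, hq, ?_⟩
  ext t
  constructor
  · rintro ⟨i, hi, rfl⟩
    obtain ⟨m, rfl⟩ := (hI i).1 hi
    exact ⟨m, rfl⟩
  · rintro ⟨m, rfl⟩
    exact ⟨q m, (hI _).2 ⟨m, rfl⟩, rfl⟩

theorem mem_crossFaces {q' : Fin 4 → Fin 6 → ℤ} :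
    q' ∈ crossFaces ↔ ∃ q ∈ quads, ∃ s, IsSign s ∧ (∀ i, (∀ m, i ≠ q m) → s i = 1) ∧
      q' = fun m => crossPt s (q m) := by
  simp only [crossFaces, List.mem_flatMap, List.mem_map, List.mem_filter, decide_eq_true_eq,
    mem_signVectors]
  constructor
  · rintro ⟨q, hq, s, ⟨hs, h1⟩, rfl⟩
    exact ⟨q, hq, s, hs, h1, rfl⟩
  · rintro ⟨q, hq, s, hs, h1, rfl⟩
    exact ⟨q, hq, s, ⟨hs, h1⟩, rfl⟩

theorem lin_zero : lin (fun _ => 0) = fun _ => 0 := by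
  funext v
  simp [lin]

theorem isFaceList_crossFaces : IsFaceList crossVerts crossFaces where
  finite := crossVerts_finite
  exposed := by
    intro q' hq'
    obtain ⟨q, hq, s, hs, h1, rfl⟩ := mem_crossFaces.1 hq'
    classical
    -- This form has maximal |a i| exactly on the four chosen axes.
    let a : Fin 6 → ℝ := fun i => if ∃ m, i = q m then (s i : ℝ) else 0
    have haq : ∀ m, |a (q m)| = 1 := fun m => by
      have : a (q m) = s (q m) := if_pos ⟨m, rfl⟩
      rw [this]
      rcases hs (q m) with h | h <;> simp [h]
    have ha0 : ∀ i, (¬ ∃ m, i = q m) → a i = 0 := fun i hi => if_neg hi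
    refine ⟨a, ?_⟩
    rw [argmaxSet_crossVerts (s := s) ⟨q 0, fun h => by simpa [h] using haq 0⟩ hs]
    · ext t
      constructor
      · rintro ⟨i, hi, rfl⟩
        have h0 := hi (q 0)
        rw [haq] at h0
        by_cases him : ∃ m, i = q m
        · obtain ⟨m, rfl⟩ := him
          exact ⟨m, rfl⟩
        · rw [ha0 i him, abs_zero] at h0
          linarith
      · rintro ⟨m, rfl⟩
        refine ⟨q m, fun j => ?_, rfl⟩
        rw [haq]
        by_cases hj : ∃ m, j = q m
        · obtain ⟨m', rfl⟩ := hj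
          rw [haq]
        · simp [ha0 j hj]
    · intro i
      by_cases hi : ∃ m, i = q m
      · have : a i = s i := if_pos hi
        rw [this]
        rcases hs i with h | h <;> simp [h]
      · simp [ha0 i hi]
  complete := by
    intro c a h3
    obtain ⟨s, hs, hsa⟩ := exists_sign_real a
    by_cases ha : ∃ i, a i ≠ 0
    · classical
      rw [argmaxSet_crossVerts ha hs hsa] at h3 ⊢
      set I : Finset (Fin 6) := Finset.univ.filter fun i => ∀ j, |a j| ≤ |a i| with hI
      have hset : {t | ∃ i, (∀ j, |a j| ≤ |a i|) ∧ t = crossPt s i} =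
          {t | ∃ i ∈ I, t = crossPt s i} := by simp [hI]
      rw [hset] at h3 ⊢
      obtain ⟨q, hq, hqI⟩ := exists_quad_family (crossPt s)
        (finrank_family c (crossPt s) (fun i j hij => distSq6_crossPt hs hij) I h3)
      -- Signs off the four axes do not affect the vertices; they are reset to 1 to match the list.
      let s' : Fin 6 → ℤ := fun i => if ∃ m, i = q m then s i else 1
      have hs' : IsSign s' := fun i => by
        dsimp only [s']
        split_ifs
        · exact hs i
        · exact Or.inl rfl
      have hcross : ∀ m, crossPt s (q m) = crossPt s' (q m) := fun m => by
        funext j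
        simp only [crossPt_apply]
        split_ifs with h
        · have : s' j = s j := if_pos ⟨m, h⟩
          rw [this]
        · rfl
      refine ⟨fun m => crossPt s' (q m), mem_crossFaces.2 ⟨q, hq, s', hs', fun i hi => ?_, rfl⟩, ?_⟩
      -- The sign is 1 at every index outside the four axes by the choice of `s'`.
      · exact if_neg fun ⟨m, hm⟩ => hi m hm
      · simpa only [hcross] using hqI
    · exfalso
      push Not at ha
      -- Every vertex maximizes the zero form, and six of them already span dimension 5.
      have ha' : a = fun _ => 0 := funext ha
      subst ha'
      have hone : IsSign fun _ => 1 := fun _ => Or.inl rfl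
      have hind := affineIndependent_emb c (crossPt fun _ => 1)
        fun i j hij => distSq6_crossPt hone hij
      have h5 := hind.finrank_vectorSpan (n := 5) (by simp)
      have hsub : (Set.range fun i => emb c (crossPt (fun _ => 1) i)) ⊆
          emb c '' argmaxSet crossVerts (lin fun _ => 0) := by
        rintro _ ⟨i, rfl⟩
        refine ⟨_, ⟨⟨_, i, hone, rfl⟩, fun w _ => ?_⟩, rfl⟩
        rw [lin_zero]
      have := Submodule.finrank_mono (vectorSpan_mono ℝ hsub)
      omega
  equidistant := by
    intro q' hq' i j hij
    obtain ⟨q, hq, s, hs, -, rfl⟩ := mem_crossFaces.1 hq'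
    exact distSq6_crossPt hs ((injective_of_mem_quads hq).ne hij)

theorem mem_hemiFaces {p : ℤ} {q' : Fin 4 → Fin 6 → ℤ} :
    q' ∈ hemiFaces p ↔
      (∃ s, IsSign s ∧ signProd s = -p ∧ ∃ q ∈ quads, q' = fun m => flipAt s (q m)) ∨
      ∃ s, IsSign s ∧ signProd s = p ∧ ∃ t ∈ triples, s (t 0) = 1 ∧ s (t 1) = 1 ∧
        q' = mk4 s (flipAt (flipAt s (t 0)) (t 1)) (flipAt (flipAt s (t 0)) (t 2))
          (flipAt (flipAt s (t 1)) (t 2)) := by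
  simp only [hemiFaces, List.mem_append, List.mem_flatMap, List.mem_map, List.mem_filter,
    mem_signVectors, beq_iff_eq, Bool.and_eq_true]
  constructor
  · rintro (⟨s, ⟨hs, hp⟩, q, hq, rfl⟩ | ⟨s, ⟨hs, hp⟩, t, ⟨ht, h0, h1⟩, rfl⟩)
    · exact Or.inl ⟨s, hs, hp, q, hq, rfl⟩
    · exact Or.inr ⟨s, hs, hp, t, ht, h0, h1, rfl⟩
  · rintro (⟨s, hs, hp, q, hq, rfl⟩ | ⟨s, hs, hp, t, ht, h0, h1, rfl⟩)
    · exact Or.inl ⟨s, ⟨hs, hp⟩, q, hq, rfl⟩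
    · exact Or.inr ⟨s, ⟨hs, hp⟩, t, ⟨ht, h0, h1⟩, rfl⟩

theorem flipAt_apply_same (s : Fin 6 → ℤ) (i : Fin 6) : flipAt s i i = -s i := by
  rw [flipAt_apply, if_pos rfl]

theorem flipAt_apply_ne (s : Fin 6 → ℤ) {i j : Fin 6} (h : j ≠ i) : flipAt s i j = s j := by
  rw [flipAt_apply, if_neg h]

/-- The vertices of a hemicube lying in a three-dimensional face of the cube. -/
theorem setOf_agree_off_triple {p : ℤ} (hp : p = 1 ∨ p = -1) {s : Fin 6 → ℤ}
    (hs : IsSign s) (hsp : signProd s = p) {t : Fin 3 → Fin 6} (ht : Function.Injective t) :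
    {u | u ∈ hemiVerts p ∧ ∀ i, (∀ m, i ≠ t m) → u i = s i} =
      Set.range (mk4 s (flipAt (flipAt s (t 0)) (t 1)) (flipAt (flipAt s (t 0)) (t 2))
          (flipAt (flipAt s (t 1)) (t 2))) := by
  have h01 : t 0 ≠ t 1 := ht.ne (by decide)
  have h02 : t 0 ≠ t 2 := ht.ne (by decide)
  have h12 : t 1 ≠ t 2 := ht.ne (by decide)
  have hall : ∀ m, m = 0 ∨ m = 1 ∨ m = (2 : Fin 3) := by decide
  have htwo : ∀ i j, flipAt (flipAt s i) j ∈ hemiVerts p := fun i j =>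
    ⟨(hs.flipAt i).flipAt j, by rw [signProd_flipAt, signProd_flipAt, neg_neg, hsp]⟩
  ext u
  constructor
  · rintro ⟨⟨hu, hup⟩, hagree⟩
    have hext : ∀ w : Fin 6 → ℤ, (∀ i, (∀ m, i ≠ t m) → w i = s i) → u (t 0) = w (t 0) →
        u (t 1) = w (t 1) → u (t 2) = w (t 2) → u = w := by
      intro w hw e0 e1 e2
      funext i
      by_cases hi : ∃ m, i = t m
      · obtain ⟨m, rfl⟩ := hi
        rcases hall m with rfl | rfl | rfl
        · exact e0
        · exact e1
        · exact e2
      · push Not at hi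
        rw [hagree i hi, hw i hi]
    have hpm : ∀ i, u i = s i ∨ u i = -s i := fun i => by
      rcases hu i with h | h <;> rcases hs i with h' | h' <;> simp [h, h']
    have hodd : ∀ w : Fin 6 → ℤ, signProd w = -p → u ≠ w := by
      rintro w hw rfl
      rw [hup] at hw
      rcases hp with rfl | rfl <;> norm_num at hw
    have hoff : ∀ k, ∀ w : Fin 6 → ℤ, (∀ i, (∀ m, i ≠ t m) → w i = s i) →
        ∀ i, (∀ m, i ≠ t m) → flipAt w (t k) i = s i := fun k w hw i hi => by
      rw [flipAt_apply_ne _ (hi k), hw i hi]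
    have hs0 : ∀ i, (∀ m, i ≠ t m) → s i = s i := fun _ _ => rfl
    -- Relative to `s` there are eight sign patterns on the three free coordinates. The four with an
    -- odd number of flips have the wrong parity; the others are the four listed vertices.
    rcases hpm (t 0) with e0 | e0 <;> rcases hpm (t 1) with e1 | e1 <;>
      rcases hpm (t 2) with e2 | e2
    · exact ⟨0, (hext s hs0 e0 e1 e2).symm⟩
    · refine absurd (hext (flipAt s (t 2)) (hoff _ _ hs0) ?_ ?_ ?_) (hodd _ ?_) <;>
        simp [flipAt_apply_same, flipAt_apply_ne, *, signProd_flipAt]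
    · refine absurd (hext (flipAt s (t 1)) (hoff _ _ hs0) ?_ ?_ ?_) (hodd _ ?_) <;>
        simp [flipAt_apply_same, flipAt_apply_ne, *, signProd_flipAt, h12.symm]
    · refine ⟨3, (hext _ (hoff _ _ (hoff _ _ hs0)) ?_ ?_ ?_).symm⟩ <;>
        simp [flipAt_apply_same, flipAt_apply_ne, *, h12.symm]
    · refine absurd (hext (flipAt s (t 0)) (hoff _ _ hs0) ?_ ?_ ?_) (hodd _ ?_) <;>
        simp [flipAt_apply_same, flipAt_apply_ne, *, signProd_flipAt, h01.symm, h02.symm]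
    · refine ⟨2, (hext _ (hoff _ _ (hoff _ _ hs0)) ?_ ?_ ?_).symm⟩ <;>
        simp [flipAt_apply_same, flipAt_apply_ne, *, h01.symm, h02.symm]
    · refine ⟨1, (hext _ (hoff _ _ (hoff _ _ hs0)) ?_ ?_ ?_).symm⟩ <;>
        simp [flipAt_apply_same, flipAt_apply_ne, *, h01.symm, h02.symm, h12.symm]
    · refine absurd (hext (flipAt (flipAt (flipAt s (t 0)) (t 1)) (t 2))
        (hoff _ _ (hoff _ _ (hoff _ _ hs0))) ?_ ?_ ?_) (hodd _ ?_) <;>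
        simp [flipAt_apply_same, flipAt_apply_ne, *, signProd_flipAt, h01.symm, h02.symm,
          h12.symm]
  · rintro ⟨m, rfl⟩
    fin_cases m
    · exact ⟨⟨hs, hsp⟩, fun _ _ => rfl⟩
    · refine ⟨htwo _ _, fun i hi => ?_⟩
      exact (flipAt_apply_ne _ (hi 1)).trans (flipAt_apply_ne _ (hi 0))
    · refine ⟨htwo _ _, fun i hi => ?_⟩
      exact (flipAt_apply_ne _ (hi 2)).trans (flipAt_apply_ne _ (hi 0))
    · refine ⟨htwo _ _, fun i hi => ?_⟩
      exact (flipAt_apply_ne _ (hi 2)).trans (flipAt_apply_ne _ (hi 1))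

theorem distSq6_comm (u v : Fin 6 → ℤ) : distSq6 u v = distSq6 v u := by
  unfold distSq6
  ring

theorem flipAt_comm (s : Fin 6 → ℤ) (i j : Fin 6) :
    flipAt (flipAt s i) j = flipAt (flipAt s j) i := by
  funext k
  simp only [flipAt_apply]
  split_ifs <;> rfl

theorem distSq6_flipAt_flipAt {s : Fin 6 → ℤ} (hs : IsSign s) {i j : Fin 6} (h : i ≠ j) :
    distSq6 s (flipAt (flipAt s i) j) = 8 := by
  refine distSq6_of_sq_sub (i := i) (j := j) fun k => ?_
  have := hs.sq k
  simp only [flipAt_apply]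
  split_ifs with h1 h2
  · exact absurd (h2.symm.trans h1) h
  all_goals linarith

/-- The linear forms that vanish on four coordinates are not maximal on a three-dimensional set. -/
theorem four_le_finrank_of_quad (c : V6) {T : Set (Fin 6 → ℤ)} {s : Fin 6 → ℤ} (hs : IsSign s)
    {q : Fin 4 → Fin 6} (hq : Function.Injective q) (hsT : s ∈ T)
    (hT : ∀ m n, m ≠ n → flipAt (flipAt s (q m)) (q n) ∈ T) :
    4 ≤ Module.finrank ℝ (vectorSpan ℝ (emb c '' T)) := by
  have hne : ∀ m n : Fin 4, m ≠ n → q m ≠ q n := fun m n h => hq.ne h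
  -- Up to signs and a factor 2, the differences from `s` are e₀+e₁, e₀+e₂, e₁+e₂ and e₀+e₃, which
  -- are linearly independent.
  let f : Fin 5 → Fin 6 → ℤ := ![s, flipAt (flipAt s (q 0)) (q 1), flipAt (flipAt s (q 0)) (q 2),
    flipAt (flipAt s (q 1)) (q 2), flipAt (flipAt s (q 0)) (q 3)]
  have hind : AffineIndependent ℝ fun k => emb c (f k) := by
    rw [affineIndependent_iff_of_fintype]
    intro w hw hw0
    rw [Finset.univ.weightedVSub_eq_linear_combination hw] at hw0
    have hcoord : ∀ i, ∑ k, w k * (f k i : ℝ) = 0 := by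
      intro i
      have h := congrArg (fun x : V6 => x i) hw0
      simp only [PiLp.zero_apply, emb, smul_add, Finset.sum_add_distrib, ← Finset.sum_smul, hw,
        zero_smul, zero_add] at h
      simp only [WithLp.ofLp_sum, Finset.sum_apply, PiLp.smul_apply, smul_eq_mul] at h
      have h' : ∑ k, w k * (f k i : ℝ) = 2 * ∑ k, w k * ((f k i : ℝ) / 2) := by
        rw [Finset.mul_sum]
        exact Finset.sum_congr rfl fun k _ => by ring
      rw [h', h, mul_zero]
    -- Multiplying the i-th coordinate by `s i` reduces to the case in which all entries of `s` are
    -- 1.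
    have hs1 : ∀ i, (s i : ℝ) * s i = 1 := fun i => by
      rcases hs i with h | h <;> simp [h]
    have key : ∀ i, ∑ k, w k * ((f k i * s i : ℤ) : ℝ) = 0 := fun i => by
      have : ∑ k, w k * ((f k i * s i : ℤ) : ℝ) = (∑ k, w k * (f k i : ℝ)) * s i := by
        rw [Finset.sum_mul]
        exact Finset.sum_congr rfl fun k _ => by push_cast; ring
      rw [this, hcoord, zero_mul]
    have h0 := key (q 0)
    have h1 := key (q 1)
    have h2 := key (q 2)
    have h3 := key (q 3)
    simp [Fin.sum_univ_five, f, flipAt_apply, hq.eq_iff, hs1] at hw h0 h1 h2 h3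
    intro k
    fin_cases k <;> simp <;> linarith
  have h4 := hind.finrank_vectorSpan (n := 4) (by simp)
  rw [← h4]
  refine Submodule.finrank_mono (vectorSpan_mono ℝ ?_)
  rintro _ ⟨k, rfl⟩
  refine ⟨f k, ?_, rfl⟩
  fin_cases k
  · exact hsT
  · exact hT 0 1 (by decide)
  · exact hT 0 2 (by decide)
  · exact hT 1 2 (by decide)
  · exact hT 0 3 (by decide)

/-- Points that differ only in the coordinates in `Z` span a space of dimension at most `|Z|`. -/
theorem finrank_le_of_agree (c : V6) {T : Set (Fin 6 → ℤ)} (Z : Finset (Fin 6))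
    (h : ∀ u ∈ T, ∀ v ∈ T, ∀ i ∉ Z, u i = v i) :
    Module.finrank ℝ (vectorSpan ℝ (emb c '' T)) ≤ Z.card := by
  classical
  refine le_trans (Submodule.finrank_mono (t := Submodule.span ℝ (Z.image basisVec : Set V6)) ?_)
    ((finrank_span_finset_le_card _).trans Finset.card_image_le)
  rw [vectorSpan_def, Submodule.span_le]
  rintro _ ⟨_, ⟨u, hu, rfl⟩, _, ⟨v, hv, rfl⟩, rfl⟩
  have : emb c u -ᵥ emb c v = ∑ i ∈ Z, (((u i : ℝ) - v i) / 2) • basisVec i := by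
    ext j
    simp only [emb, vsub_eq_sub, add_sub_add_left_eq_sub, PiLp.sub_apply, WithLp.ofLp_sum,
      Finset.sum_apply, PiLp.smul_apply, basisVec, PiLp.single_apply, smul_eq_mul,
      mul_ite, mul_one, mul_zero, Finset.sum_ite_eq]
    split_ifs with hj
    · ring
    · rw [h u hu v hv j hj]
      ring
  change emb c u -ᵥ emb c v ∈ Submodule.span ℝ (Z.image basisVec : Set V6)
  rw [this]
  exact Submodule.sum_mem _ fun i hi => Submodule.smul_mem _ _
    (Submodule.subset_span (Finset.mem_coe.2 (Finset.mem_image_of_mem _ hi)))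

/-- Completeness depends on the zero set Z of the form. If Z is nonempty, the maximizers are the
vertices of the right parity in a |Z|-dimensional face of the cube: the dimension is at most |Z|,
and at least 4 if |Z| ≥ 4, so |Z| = 3. If Z is empty, the form has a unique maximal cube vertex `s`.
When `s` belongs to the hemicube the face is a point; otherwise it consists of the neighbours of `s`
across the coordinates with smallest |a i|, which must be four. -/
theorem isFaceList_hemiFaces {p : ℤ} (hp : p = 1 ∨ p = -1) :
    IsFaceList (hemiVerts p) (hemiFaces p) where
  finite := hemiVerts_finite p
  exposed := by
    intro q' hq'
    classical
    have hs2 : ∀ s : Fin 6 → ℤ, IsSign s → ∀ i, (s i : ℝ) * s i = 1 ∧ |(s i : ℝ)| = 1 := by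
      intro s hs i
      rcases hs i with h | h <;> simp [h]
    rcases mem_hemiFaces.1 hq' with ⟨s, hs, hsp, q, hq, rfl⟩ | ⟨s, hs, hsp, t, ht, -, -, rfl⟩
    -- The larger coefficients off `q` make the flips in `q` the cheapest ones.
    · let a : Fin 6 → ℝ := fun i => if ∃ m, i = q m then (s i : ℝ) else 2 * s i
      have haq : ∀ m, |a (q m)| = 1 := fun m => by
        have : a (q m) = s (q m) := if_pos ⟨m, rfl⟩
        rw [this, (hs2 s hs _).2]
      have ha2 : ∀ i, (¬ ∃ m, i = q m) → |a i| = 2 := fun i hi => by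
        have : a i = 2 * s i := if_neg hi
        rw [this, abs_mul, (hs2 s hs _).2]
        norm_num
      refine ⟨a, ?_⟩
      rw [argmaxSet_hemiVerts_of_ne (s := s) _ hs hsp hp]
      · ext u
        constructor
        · rintro ⟨i, hi, rfl⟩
          by_cases him : ∃ m, i = q m
          · obtain ⟨m, rfl⟩ := him
            exact ⟨m, rfl⟩
          · have := hi (q 0)
            rw [haq, ha2 i him] at this
            norm_num at this
        · rintro ⟨m, rfl⟩
          refine ⟨q m, fun j => ?_, rfl⟩
          rw [haq]
          by_cases hj : ∃ m, j = q m
          · obtain ⟨m', rfl⟩ := hj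
            rw [haq]
          · rw [ha2 j hj]
            norm_num
      · intro i
        by_cases hi : ∃ m, i = q m
        · have : a i = s i := if_pos hi
          rw [this, (hs2 s hs _).1, (hs2 s hs _).2]
        · have : a i = 2 * s i := if_neg hi
          rw [this, abs_mul, (hs2 s hs _).2, mul_assoc, (hs2 s hs _).1]
          norm_num
      · intro i h0
        by_cases hi : ∃ m, i = q m
        · obtain ⟨m, rfl⟩ := hi
          simpa [h0] using haq m
        · simpa [h0] using ha2 i hi
    -- This form is maximal exactly on the cube face with free coordinates `t`.
    · let a : Fin 6 → ℝ := fun i => if ∃ m, i = t m then 0 else (s i : ℝ)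
      have ha0 : ∀ m, a (t m) = 0 := fun m => if_pos ⟨m, rfl⟩
      have ha1 : ∀ i, (∀ m, i ≠ t m) → a i = s i := fun i hi =>
        if_neg fun ⟨m, hm⟩ => hi m hm
      refine ⟨a, ?_⟩
      rw [argmaxSet_hemiVerts_of_zero hp (ha0 0),
        ← setOf_agree_off_triple hp hs hsp (injective_of_mem_triples ht)]
      ext u
      refine and_congr_right fun hu => forall_congr' fun i => ?_
      constructor
      · intro h hi
        rw [ha1 i hi, (hs2 s hs _).2] at h
        rcases hs i with h' | h' <;> rcases hu.1 i with h'' | h'' <;> rw [h', h''] at h ⊢ <;>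
          norm_num at h
      · intro h
        by_cases hi : ∃ m, i = t m
        · obtain ⟨m, rfl⟩ := hi
          simp [ha0]
        · have hi' : ∀ m, i ≠ t m := fun m hm => hi ⟨m, hm⟩
          rw [ha1 i hi', h hi', (hs2 s hs _).1, (hs2 s hs _).2]
  complete := by
    intro c a h3
    by_cases ha : ∃ z, a z = 0
    · obtain ⟨z, hz⟩ := ha
      rw [argmaxSet_hemiVerts_of_zero hp hz] at h3 ⊢
      set T := {t | t ∈ hemiVerts p ∧ ∀ i, a i * t i = |a i|} with hT
      set Z : Finset (Fin 6) := Finset.univ.filter fun i => a i = 0 with hZ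
      have hagree : ∀ u ∈ T, ∀ v ∈ T, ∀ i ∉ Z, u i = v i := by
        intro u hu v hv i hi
        have hai : a i ≠ 0 := by simpa [hZ] using hi
        exact_mod_cast mul_left_cancel₀ hai ((hu.2 i).trans (hv.2 i).symm)
      have hle := finrank_le_of_agree c Z hagree
      have hflip : ∀ s ∈ T, ∀ i ∈ Z, ∀ j ∈ Z, flipAt (flipAt s i) j ∈ T := by
        rintro s ⟨⟨hs, hsp⟩, hsa⟩ i hi j hj
        have hi' : a i = 0 := by simpa [hZ] using hi
        have hj' : a j = 0 := by simpa [hZ] using hj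
        refine ⟨⟨(hs.flipAt i).flipAt j, by rw [signProd_flipAt, signProd_flipAt, neg_neg, hsp]⟩,
          fun k => ?_⟩
        by_cases hk : a k = 0
        · simp [hk]
        · rw [flipAt_apply_ne _ (by rintro rfl; exact hk hj'),
            flipAt_apply_ne _ (by rintro rfl; exact hk hi'), hsa]
      have hne : T.Nonempty := by
        rcases T.eq_empty_or_nonempty with h | h
        · rw [h, Set.image_empty, vectorSpan_empty, finrank_bot] at h3
          omega
        · exact h
      rcases (by omega : Z.card = 3 ∨ 4 ≤ Z.card) with hc | hc
      · obtain ⟨t, ht, htZ⟩ := exists_triple_of_card hc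
        have htm : ∀ m, t m ∈ Z := fun m => (htZ _).2 ⟨m, rfl⟩
        have hinj := injective_of_mem_triples ht
        -- Flipping `t k` together with `t 2` preserves parity. Applied for k = 0 and k = 1, this
        -- reaches the representative that `hemiFaces` uses.
        have hex : ∀ k : Fin 3, k ≠ 2 → ∀ s ∈ T, ∃ s' ∈ T, s' (t k) = 1 ∧
            ∀ m, m ≠ k → m ≠ 2 → s' (t m) = s (t m) := by
          intro k hk s hs
          rcases hs.1.1 (t k) with h | h
          · exact ⟨s, hs, h, fun _ _ _ => rfl⟩
          · refine ⟨_, hflip s hs _ (htm k) _ (htm 2), ?_, fun m hm hm2 => ?_⟩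
            · rw [flipAt_apply_ne _ (hinj.ne hk), flipAt_apply_same, h, neg_neg]
            · rw [flipAt_apply_ne _ (hinj.ne hm2), flipAt_apply_ne _ (hinj.ne hm)]
        obtain ⟨s₀, hs₀⟩ := hne
        obtain ⟨s₁, hs₁, h10, -⟩ := hex 0 (by decide) s₀ hs₀
        obtain ⟨s, hs, h21, h20⟩ := hex 1 (by decide) s₁ hs₁
        have h20' : s (t 0) = 1 := (h20 0 (by decide) (by decide)).trans h10
        refine ⟨_, mem_hemiFaces.2 (Or.inr ⟨s, hs.1.1, hs.1.2, t, ht, h20', h21, rfl⟩), ?_⟩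
        rw [← setOf_agree_off_triple hp hs.1.1 hs.1.2 hinj]
        ext u
        constructor
        · intro hu
          refine ⟨hu.1, fun i hi => hagree u hu s hs i fun hiZ => ?_⟩
          obtain ⟨m, hm⟩ := (htZ i).1 hiZ
          exact hi m hm
        · rintro ⟨hu, hus⟩
          refine ⟨hu, fun i => ?_⟩
          by_cases hi : a i = 0
          · simp [hi]
          · rw [hus i fun m hm => hi (by rw [hm]; simpa [hZ] using htm m), hs.2]
      · exfalso
        obtain ⟨I, hIZ, hI⟩ := Finset.exists_subset_card_eq hc
        obtain ⟨q, hq, hqI⟩ := exists_quad_of_card hI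
        have hqZ : ∀ m, q m ∈ Z := fun m => hIZ ((hqI _).2 ⟨m, rfl⟩)
        obtain ⟨s, hs⟩ := hne
        have := four_le_finrank_of_quad c hs.1.1 (injective_of_mem_quads hq) hs
          fun m n _ => hflip s hs _ (hqZ m) _ (hqZ n)
        omega
    · push Not at ha
      obtain ⟨s, hs, hsa⟩ := exists_sign_real a
      by_cases hsp : signProd s = p
      · exfalso
        have hsub : ∀ u ∈ argmaxSet (hemiVerts p) (lin a), u = s := by
          rintro u ⟨hu, hmax⟩
          have h1 : lin a u = lin a s := by
            refine le_antisymm (Finset.sum_le_sum fun i _ => ?_) (hmax s ⟨hs, hsp⟩)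
            rw [hsa]
            exact mul_sign_le hu.1 _ i
          funext i
          have := (Finset.sum_eq_sum_iff_of_le fun i _ => by
            rw [hsa]
            exact mul_sign_le hu.1 _ i).1 h1 i (Finset.mem_univ i)
          exact_mod_cast mul_left_cancel₀ (ha i) this
        have := finrank_le_of_agree c (T := argmaxSet (hemiVerts p) (lin a)) ∅
          fun u hu v hv i _ => by rw [hsub u hu, hsub v hv]
        rw [Finset.card_empty] at this
        omega
      · have hsp' : signProd s = -p := by
          rcases hs.signProd with h | h <;> rcases hp with rfl | rfl <;> simp_all
        rw [argmaxSet_hemiVerts_of_ne ha hs hsp' hp hsa] at h3 ⊢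
        set I : Finset (Fin 6) := Finset.univ.filter fun i => ∀ j, |a i| ≤ |a j| with hI
        have hset : {t | ∃ i, (∀ j, |a i| ≤ |a j|) ∧ t = flipAt s i} =
            {t | ∃ i ∈ I, t = flipAt s i} := by simp [hI]
        rw [hset] at h3 ⊢
        obtain ⟨q, hq, hqI⟩ := exists_quad_family (flipAt s)
          (finrank_family c (flipAt s) (fun i j hij => distSq6_flipAt hs hij) I h3)
        exact ⟨_, mem_hemiFaces.2 (Or.inl ⟨s, hs, hsp', q, hq, rfl⟩), hqI⟩
  equidistant := by
    intro q' hq' i j hij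
    rcases mem_hemiFaces.1 hq' with ⟨s, hs, -, q, hq, rfl⟩ | ⟨s, hs, -, t, ht, -, -, rfl⟩
    · exact distSq6_flipAt hs ((injective_of_mem_quads hq).ne hij)
    · have hinj := injective_of_mem_triples ht
      have h01 : t 0 ≠ t 1 := hinj.ne (by decide)
      have h02 : t 0 ≠ t 2 := hinj.ne (by decide)
      have h12 : t 1 ≠ t 2 := hinj.ne (by decide)
      have d01 := distSq6_flipAt_flipAt hs h01
      have d02 := distSq6_flipAt_flipAt hs h02
      have d12 := distSq6_flipAt_flipAt hs h12
      have e12 := distSq6_flipAt (hs.flipAt (t 0)) h12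
      have e02 := distSq6_flipAt (hs.flipAt (t 1)) h02
      have e01 := distSq6_flipAt (hs.flipAt (t 2)) h01
      rw [flipAt_comm s (t 1) (t 0)] at e02
      rw [flipAt_comm s (t 2) (t 0), flipAt_comm s (t 2) (t 1)] at e01
      have hpairs : ∀ i j : Fin 4, i < j → i = 0 ∧ j = 1 ∨ i = 0 ∧ j = 2 ∨ i = 0 ∧ j = 3 ∨
          i = 1 ∧ j = 2 ∨ i = 1 ∧ j = 3 ∨ i = 2 ∧ j = 3 := by decide
      have key : ∀ i j : Fin 4, i < j →
          distSq6 (mk4 s (flipAt (flipAt s (t 0)) (t 1)) (flipAt (flipAt s (t 0)) (t 2))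
              (flipAt (flipAt s (t 1)) (t 2)) i)
            (mk4 s (flipAt (flipAt s (t 0)) (t 1)) (flipAt (flipAt s (t 0)) (t 2))
              (flipAt (flipAt s (t 1)) (t 2)) j) = 8 := by
        intro i j hij
        rcases hpairs i j hij with ⟨rfl, rfl⟩ | ⟨rfl, rfl⟩ | ⟨rfl, rfl⟩ | ⟨rfl, rfl⟩ |
          ⟨rfl, rfl⟩ | ⟨rfl, rfl⟩
        exacts [d01, d02, d12, e12, e02, e01]
      rcases lt_or_gt_of_ne hij with h | h
      · exact key i j h
      · rw [distSq6_comm]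
        exact key j i h

/-! ### Enumerating and counting the three-dimensional faces -/

/-- The face of the cell centred at `c` with vertices `q`. -/
def tet (c : V6) (q : Fin 4 → Fin 6 → ℤ) : Set V6 := convexHull ℝ (Set.range fun m => emb c (q m))

theorem apply_emb (c : V6) (l : StrongDual ℝ V6) (v : Fin 6 → ℤ) :
    l (emb c v) = l c + lin (fun i => l (basisVec i)) v / 2 := by
  have : (WithLp.toLp 2 fun i => (v i : ℝ) / 2 : V6) = ∑ i, ((v i : ℝ) / 2) • basisVec i := by
    ext j
    simp [basisVec, Pi.single_apply]
  rw [emb, map_add, this, map_sum, lin, Finset.sum_div]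
  congr 1
  refine Finset.sum_congr rfl fun i _ => ?_
  rw [map_smul, smul_eq_mul]
  ring

theorem argmaxSet_image_emb (c : V6) (l : StrongDual ℝ V6) (S : Set (Fin 6 → ℤ)) :
    argmaxSet (emb c '' S) l = emb c '' argmaxSet S (lin fun i => l (basisVec i)) := by
  ext x
  constructor
  · rintro ⟨⟨v, hv, rfl⟩, hmax⟩
    refine ⟨v, ⟨hv, fun w hw => ?_⟩, rfl⟩
    have := hmax _ ⟨w, hw, rfl⟩
    rw [apply_emb, apply_emb] at this
    linarith
  · rintro ⟨v, ⟨hv, hmax⟩, rfl⟩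
    refine ⟨⟨v, hv, rfl⟩, ?_⟩
    rintro _ ⟨w, hw, rfl⟩
    rw [apply_emb, apply_emb]
    linarith [hmax w hw]

theorem exists_dual (a : Fin 6 → ℝ) :
    ∃ l : StrongDual ℝ V6, (fun i => l (basisVec i)) = a := by
  refine ⟨innerSL ℝ (WithLp.toLp 2 a), ?_⟩
  funext i
  simp [basisVec, EuclideanSpace.inner_single_right]

theorem affineIndependent_tet (c : V6) {q : Fin 4 → Fin 6 → ℤ}
    (hq : ∀ i j, i ≠ j → distSq6 (q i) (q j) = 8) : AffineIndependent ℝ fun m => emb c (q m) :=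
  affineIndependent_emb c q hq

namespace IsFaceList

variable {S : Set (Fin 6 → ℤ)} {L : List (Fin 4 → Fin 6 → ℤ)}

theorem exists_argmaxSet (h : IsFaceList S L) (c : V6) {q : Fin 4 → Fin 6 → ℤ} (hq : q ∈ L) :
    ∃ l : StrongDual ℝ V6, argmaxSet (emb c '' S) l = Set.range fun m => emb c (q m) := by
  obtain ⟨a, ha⟩ := h.exposed q hq
  obtain ⟨l, rfl⟩ := exists_dual a
  refine ⟨l, ?_⟩
  rw [argmaxSet_image_emb, ha, ← Set.range_comp]
  rfl

theorem mem_threeFaces_iff (h : IsFaceList S L) (c : V6) (F : Set V6) :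
    F ∈ threeFaces (convexHull ℝ (emb c '' S)) ↔ ∃ q ∈ L, F = tet c q := by
  rw [_root_.mem_threeFaces_iff (h.finite.image _)]
  constructor
  · rintro ⟨l, rfl, h3⟩
    rw [argmaxSet_image_emb] at h3 ⊢
    obtain ⟨q, hq, hqa⟩ := h.complete c _ h3
    refine ⟨q, hq, ?_⟩
    rw [hqa, ← Set.range_comp]
    rfl
  · rintro ⟨q, hq, rfl⟩
    obtain ⟨l, hl⟩ := h.exists_argmaxSet c hq
    refine ⟨l, by rw [hl]; rfl, ?_⟩
    rw [hl]
    exact (affineIndependent_tet c (h.equidistant q hq)).finrank_vectorSpan (by simp)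

theorem isTetrahedron (h : IsFaceList S L) (c : V6) {q : Fin 4 → Fin 6 → ℤ} (hq : q ∈ L) :
    IsTetrahedron (tet c q) :=
  ⟨_, affineIndependent_tet c (h.equidistant q hq), rfl⟩

theorem range_eq_of_tet_eq (h : IsFaceList S L) (c : V6) {q r : Fin 4 → Fin 6 → ℤ} (hq : q ∈ L)
    (hr : r ∈ L) (hqr : tet c q = tet c r) : Set.range q = Set.range r := by
  obtain ⟨l, hl⟩ := h.exists_argmaxSet c hq
  obtain ⟨m, hm⟩ := h.exists_argmaxSet c hr
  have := argmaxSet_eq_of_convexHull_eq (h.finite.image (emb c)) (l : V6 →ₗ[ℝ] ℝ)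
    (m : V6 →ₗ[ℝ] ℝ) (by
      change convexHull ℝ (argmaxSet _ l) = convexHull ℝ (argmaxSet _ m)
      rw [hl, hm]
      exact hqr)
  change argmaxSet _ l = argmaxSet _ m at this
  rw [hl, hm] at this
  have hc : ∀ q : Fin 4 → Fin 6 → ℤ, (Set.range fun m => emb c (q m)) = emb c '' Set.range q :=
    fun q => by rw [← Set.range_comp]; rfl
  rw [hc, hc] at this
  exact (emb_injective c).image_injective this

theorem injective (h : IsFaceList S L) {q : Fin 4 → Fin 6 → ℤ} (hq : q ∈ L) :
    Function.Injective q := by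
  intro i j hij
  by_contra hne
  have := h.equidistant q hq i j hne
  rw [hij] at this
  simp [distSq6] at this

end IsFaceList

/-- A linear functional of the barycentre, with values in a range of natural numbers. -/
def faceCode (q : Fin 4 → Fin 6 → ℤ) : ℕ :=
  let f (v : Fin 6 → ℤ) : ℤ :=
    v 0 + 5 * v 1 + 25 * v 2 + 125 * v 3 + 625 * v 4 + 3125 * v 5
  -- On the listed faces the coordinates of the sum of the four vertices lie in {-4, -2, 0, 2, 4}.
  -- Adding 4 to each (4·(1 + 5 + … + 3125) = 15624) and halving gives the digits of a number in
  -- base 5.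
  ((15624 + (f (q 0) + f (q 1) + f (q 2) + f (q 3))) / 2).toNat

theorem faceCode_eq_of_range_eq {q r : Fin 4 → Fin 6 → ℤ} (hq : Function.Injective q)
    (hr : Function.Injective r) (h : Set.range q = Set.range r) : faceCode q = faceCode r := by
  classical
  have himg : Finset.univ.image q = Finset.univ.image r := by
    apply Finset.coe_injective
    simpa using h
  have key : ∀ f : (Fin 6 → ℤ) → ℤ,
      f (q 0) + f (q 1) + f (q 2) + f (q 3) = f (r 0) + f (r 1) + f (r 2) + f (r 3) := by
    intro f
    rw [← Fin.sum_univ_four fun m => f (q m), ← Fin.sum_univ_four fun m => f (r m),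
      ← Finset.sum_image (f := f) hq.injOn, ← Finset.sum_image (f := f) hr.injOn, himg]
  unfold faceCode
  dsimp only
  rw [key fun v => v 0 + 5 * v 1 + 25 * v 2 + 125 * v 3 + 625 * v 4 + 3125 * v 5]

/-- A test for the absence of duplicates in a list that do not occur in the bit mask `acc`. -/
def nodupMask : List ℕ → ℕ → Bool
  | [], _ => true
  | n :: l, acc => !acc.testBit n && nodupMask l (acc ||| 1 <<< n)

theorem nodup_of_nodupMask {l : List ℕ} {acc : ℕ} (h : nodupMask l acc = true) :
    l.Nodup ∧ ∀ n ∈ l, acc.testBit n = false := by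
  induction l generalizing acc with
  | nil => simp
  | cons n l ih =>
    rw [nodupMask, Bool.and_eq_true, Bool.not_eq_true'] at h
    obtain ⟨h1, h2⟩ := ih h.2
    have h3 : ∀ m ∈ l, acc.testBit m = false ∧ m ≠ n := by
      intro m hm
      have := h2 m hm
      rw [Nat.testBit_or, Bool.or_eq_false_iff] at this
      refine ⟨this.1, ?_⟩
      rintro rfl
      simp [Nat.testBit_shiftLeft] at this
    refine ⟨List.nodup_cons.2 ⟨fun hn => (h3 n hn).2 rfl, h1⟩, fun m hm => ?_⟩
    rcases List.mem_cons.1 hm with rfl | hm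
    · exact h.1
    · exact (h3 m hm).1

/-- Equal tetrahedra have the same vertices, hence the same code, hence are the same entry of `L`.
So counting faces is counting list entries. -/
theorem IsFaceList.ncard_filter {S : Set (Fin 6 → ℤ)} {L : List (Fin 4 → Fin 6 → ℤ)}
    (h : IsFaceList S L) (hL : nodupMask (L.map faceCode) 0 = true) (c : V6)
    (p : Set V6 → Prop) (b : (Fin 4 → Fin 6 → ℤ) → Bool)
    (hb : ∀ q ∈ L, p (tet c q) ↔ b q = true) :
    {F | F ∈ threeFaces (convexHull ℝ (emb c '' S)) ∧ p F}.ncard = (L.filter b).length := by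
  classical
  have hnd := (nodup_of_nodupMask hL).1
  have hset : {F | F ∈ threeFaces (convexHull ℝ (emb c '' S)) ∧ p F} =
      tet c '' ((L.filter b).toFinset : Set (Fin 4 → Fin 6 → ℤ)) := by
    ext F
    simp only [Set.mem_ofPred_eq, h.mem_threeFaces_iff, Set.mem_image, List.coe_toFinset,
      List.mem_filter]
    constructor
    · rintro ⟨⟨q, hq, rfl⟩, hp⟩
      exact ⟨q, ⟨hq, (hb q hq).1 hp⟩, rfl⟩
    · rintro ⟨q, ⟨hq, hbq⟩, rfl⟩
      exact ⟨⟨q, hq, rfl⟩, (hb q hq).2 hbq⟩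
  rw [hset, Set.InjOn.ncard_image, Set.ncard_coe_finset,
    List.toFinset_card_of_nodup (hnd.of_map.filter _)]
  intro q hq r hr hqr
  have hq' : q ∈ L := (List.mem_filter.1 (List.mem_toFinset.1 hq)).1
  have hr' : r ∈ L := (List.mem_filter.1 (List.mem_toFinset.1 hr)).1
  exact List.inj_on_of_nodup_map hnd hq' hr'
    (faceCode_eq_of_range_eq (h.injective hq') (h.injective hr')
      (h.range_eq_of_tet_eq c hq' hr' hqr))

theorem IsFaceList.ncard {S : Set (Fin 6 → ℤ)} {L : List (Fin 4 → Fin 6 → ℤ)}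
    (h : IsFaceList S L) (hL : nodupMask (L.map faceCode) 0 = true) (c : V6) :
    (threeFaces (convexHull ℝ (emb c '' S))).ncard = L.length := by
  have := h.ncard_filter hL c (fun _ => True) (fun _ => true) (by simp)
  simpa using this

theorem nodupMask_crossFaces : nodupMask (crossFaces.map faceCode) 0 = true := by decide +kernel

theorem nodupMask_hemiFaces_one : nodupMask ((hemiFaces 1).map faceCode) 0 = true := by
  decide +kernel

theorem nodupMask_hemiFaces_neg_one : nodupMask ((hemiFaces (-1)).map faceCode) 0 = true := by
  decide +kernel

theorem length_crossFaces : crossFaces.length = 240 := by decide +kernel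

theorem length_hemiFaces_one : (hemiFaces 1).length = 640 := by decide +kernel

theorem length_hemiFaces_neg_one : (hemiFaces (-1)).length = 640 := by decide +kernel

/-! ### The Delone cells -/

theorem deloneVertices_eq (c : V6) {S : Set (Fin 6 → ℤ)} {r : ℝ} (hne : S.Nonempty)
    (h1 : ∀ v ∈ S, emb c v ∈ latticeD6 ∧ dist (emb c v) c ^ 2 = r)
    (h2 : ∀ y ∈ latticeD6, r ≤ dist y c ^ 2)
    (h3 : ∀ y ∈ latticeD6, dist y c ^ 2 = r → y ∈ emb c '' S) :
    deloneVertices c = emb c '' S := by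
  ext x
  constructor
  · rintro ⟨hx, hmin⟩
    obtain ⟨v, hv⟩ := hne
    refine h3 x hx (le_antisymm ?_ (h2 x hx))
    rw [← (h1 v hv).2]
    exact pow_le_pow_left₀ dist_nonneg (hmin _ (h1 v hv).1) 2
  · rintro ⟨v, hv, rfl⟩
    refine ⟨(h1 v hv).1, fun y hy => ?_⟩
    have := h2 y hy
    rw [← (h1 v hv).2] at this
    exact (pow_le_pow_iff_left₀ dist_nonneg dist_nonneg two_ne_zero).1 this

theorem one_le_sq_of_ne_zero {a : ℤ} (h : a ≠ 0) : 1 ≤ a ^ 2 := by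
  have : 0 < a ^ 2 := by positivity
  omega

theorem eq_one_or_neg_one_of_sq {a : ℤ} (h : a ^ 2 = 1) : a = 1 ∨ a = -1 :=
  mul_self_eq_one_iff.1 (by rw [← pow_two, h])

theorem emb_eq_sum (c : V6) (v : Fin 6 → ℤ) :
    emb c v = c + ∑ i, ((v i : ℝ) / 2) • basisVec i := by
  rw [emb]
  congr 1
  ext j
  simp [basisVec, Pi.single_apply]

theorem emb_crossPt (c : V6) (s : Fin 6 → ℤ) (i : Fin 6) :
    emb c (crossPt s i) = c + (s i : ℝ) • basisVec i := by
  rw [emb_eq_sum]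
  congr 1
  rw [Finset.sum_eq_single i]
  · simp [crossPt_apply]
  · intro j _ hj
    simp [crossPt_apply, hj]
  · simp

theorem emb_apply (c : V6) (v : Fin 6 → ℤ) (i : Fin 6) : emb c v i = c i + v i / 2 := rfl

/-- A lattice point at distance `1` from a point of `ℤ⁶ \ D₆` is a vertex of a cross polytope. -/
theorem deloneVertices_omega1_eq : deloneVertices omega1 = emb omega1 '' crossVerts := by
  let o : Fin 6 → ℤ := ![1, 0, 0, 0, 0, 0]
  have ho : ∀ i, omega1 i = o i := fun i => by fin_cases i <;> simp [omega1, o]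
  have hosum : ∑ i, o i = 1 := by simp [Fin.sum_univ_six, o]
  have hdist : ∀ (y : V6) (z : Fin 6 → ℤ), (∀ i, y i = z i) →
      dist y omega1 ^ 2 = ((∑ i, (z i - o i) ^ 2 : ℤ) : ℝ) := by
    intro y z hz
    rw [EuclideanSpace.dist_sq_eq]
    push_cast
    refine Finset.sum_congr rfl fun i _ => ?_
    rw [hz, ho, Real.dist_eq, sq_abs]
  -- The centre is an integer point of odd coordinate sum, so no lattice point coincides with it and
  -- the distance is at least 1.
  have hne : ∀ z : Fin 6 → ℤ, Even (∑ i, z i) → ∃ i, z i - o i ≠ 0 := by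
    intro z hz
    by_contra! h
    have : ∑ i, (z i - o i) = 0 := Finset.sum_eq_zero fun i _ => h i
    rw [Finset.sum_sub_distrib, hosum] at this
    obtain ⟨k, hk⟩ := hz
    omega
  have hone : ∀ z : Fin 6 → ℤ, Even (∑ i, z i) → 1 ≤ ∑ i, (z i - o i) ^ 2 := by
    intro z hz
    obtain ⟨i, hi⟩ := hne z hz
    calc (1 : ℤ) ≤ (z i - o i) ^ 2 := one_le_sq_of_ne_zero hi
      _ ≤ _ := Finset.single_le_sum (f := fun i => (z i - o i) ^ 2)
        (fun _ _ => sq_nonneg _) (Finset.mem_univ i)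
  refine deloneVertices_eq omega1 (r := 1) ⟨_, fun _ => 1, 0, fun _ => Or.inl rfl, rfl⟩ ?_ ?_ ?_
  · rintro _ ⟨s, i, hs, rfl⟩
    have hz : ∀ j, emb omega1 (crossPt s i) j = ((o j + if j = i then s j else 0 : ℤ) : ℝ) := by
      intro j
      rw [emb_apply, ho, crossPt_apply]
      split_ifs <;> push_cast <;> ring
    refine ⟨⟨_, hz, ?_⟩, ?_⟩
    · rw [Finset.sum_add_distrib, hosum, Finset.sum_ite_eq']
      rcases hs i with h | h <;> simp [h]
    · rw [hdist _ _ hz]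
      simp [hs.sq]
  · rintro y ⟨z, hz, heven⟩
    rw [hdist y z hz]
    exact_mod_cast hone z heven
  · rintro y ⟨z, hz, heven⟩ h
    rw [hdist y z hz] at h
    have h1 : ∑ i, (z i - o i) ^ 2 = 1 := by exact_mod_cast h
    obtain ⟨i, hi⟩ := hne z heven
    rw [← Finset.add_sum_erase _ _ (Finset.mem_univ i)] at h1
    have hpos : 1 ≤ (z i - o i) ^ 2 := one_le_sq_of_ne_zero hi
    have hnn : 0 ≤ ∑ j ∈ Finset.univ.erase i, (z j - o j) ^ 2 :=
      Finset.sum_nonneg fun _ _ => sq_nonneg _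
    have hsq : (z i - o i) ^ 2 = 1 := by omega
    have hzero : ∀ j, j ≠ i → z j - o j = 0 := by
      intro j hj
      have := (Finset.sum_eq_zero_iff_of_nonneg fun j _ => sq_nonneg (z j - o j)).1
        (show ∑ j ∈ Finset.univ.erase i, (z j - o j) ^ 2 = 0 by omega) j
        (Finset.mem_erase.2 ⟨hj, Finset.mem_univ j⟩)
      exact pow_eq_zero_iff two_ne_zero |>.1 this
    -- Only the sign at `i` enters `crossPt`, so a constant sign vector will do.
    refine ⟨_, ⟨fun _ => z i - o i, i, fun _ => eq_one_or_neg_one_of_sq hsq, rfl⟩, ?_⟩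
    ext j
    rw [emb_apply, ho, hz, crossPt_apply]
    split_ifs with h'
    · subst h'
      push_cast
      ring
    · have := hzero j h'
      rw [sub_eq_zero.1 this]
      simp

/-- The doubled offset 2z - o of an integer point has odd entries, so its squared norm is at least
6, with equality only for sign vectors. The hypothesis `hp` translates membership in `latticeD6`
into a sign product. -/
theorem deloneVertices_eq_hemi (c : V6) (p : ℤ) {o : Fin 6 → ℤ} (hc : ∀ i, c i = o i / 2)
    (ho : IsSign o) (hne : ∃ u, u ∈ hemiVerts p)
    (hp : ∀ u ∈ signVectors, Even (∑ i, (u i + o i) / 2) ↔ signProd u = p) :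
    deloneVertices c = emb c '' hemiVerts p := by
  have hdist : ∀ (y : V6) (z : Fin 6 → ℤ), (∀ i, y i = z i) →
      dist y c ^ 2 = ((∑ i, (2 * z i - o i) ^ 2 : ℤ) : ℝ) / 4 := by
    intro y z hz
    rw [EuclideanSpace.dist_sq_eq]
    push_cast
    rw [Finset.sum_div]
    refine Finset.sum_congr rfl fun i _ => ?_
    rw [hz, hc, Real.dist_eq, sq_abs]
    ring
  have hge : ∀ (z : Fin 6 → ℤ) i, 1 ≤ (2 * z i - o i) ^ 2 := by
    intro z i
    have : 2 * z i - o i ≠ 0 := by rcases ho i with h | h <;> omega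
    exact one_le_sq_of_ne_zero this
  have hone : ∑ _i : Fin 6, (1 : ℤ) = 6 := by simp
  refine deloneVertices_eq c (r := 6 / 4) hne ?_ ?_ ?_
  · rintro u ⟨hu, hup⟩
    have hz : ∀ j, emb c u j = (((u j + o j) / 2 : ℤ) : ℝ) := by
      intro j
      rw [emb_apply, hc]
      rcases hu j with h | h <;> rcases ho j with h' | h' <;> rw [h, h'] <;> norm_num
    refine ⟨⟨_, hz, (hp u (mem_signVectors.2 hu)).2 hup⟩, ?_⟩
    rw [hdist _ _ hz]
    have : ∀ i, (2 * ((u i + o i) / 2) - o i) ^ 2 = 1 := by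
      intro i
      rcases hu i with h | h <;> rcases ho i with h' | h' <;> rw [h, h'] <;> norm_num
    simp only [this, hone]
    norm_num
  · rintro y ⟨z, hz, -⟩
    rw [hdist y z hz]
    have h6 : (6 : ℤ) ≤ ∑ i, (2 * z i - o i) ^ 2 :=
      hone ▸ Finset.sum_le_sum fun i _ => hge z i
    have : (6 : ℝ) ≤ ((∑ i, (2 * z i - o i) ^ 2 : ℤ) : ℝ) := by exact_mod_cast h6
    linarith
  · rintro y ⟨z, hz, heven⟩ h
    rw [hdist y z hz] at h
    have h6 : ((∑ i, (2 * z i - o i) ^ 2 : ℤ) : ℝ) = (6 : ℤ) := by push_cast at h ⊢; linarith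
    have h6' : ∑ _i : Fin 6, (1 : ℤ) = ∑ i, (2 * z i - o i) ^ 2 := by
      rw [hone]
      exact_mod_cast h6.symm
    have hall := (Finset.sum_eq_sum_iff_of_le fun i _ => hge z i).1 h6'
    have hsign : IsSign fun i => 2 * z i - o i := fun i =>
      eq_one_or_neg_one_of_sq (hall i (Finset.mem_univ i)).symm
    refine ⟨fun i => 2 * z i - o i, ⟨hsign, (hp _ (mem_signVectors.2 hsign)).1 ?_⟩, ?_⟩
    · simpa using heven
    · ext j
      rw [emb_apply, hc, hz]
      push_cast
      ring

theorem deloneVertices_omega5_eq : deloneVertices omega5 = emb omega5 '' hemiVerts (-1) := by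
  refine deloneVertices_eq_hemi omega5 (-1) (o := ![1, 1, 1, 1, 1, -1]) ?_ ?_ ?_ ?_
  · intro i
    fin_cases i <;> simp [omega5]
  · unfold IsSign
    decide
  · exact ⟨![1, 1, 1, 1, 1, -1], by unfold IsSign; decide, by decide⟩
  · decide +kernel

theorem deloneVertices_omega6_eq : deloneVertices omega6 = emb omega6 '' hemiVerts 1 := by
  refine deloneVertices_eq_hemi omega6 1 (o := fun _ => 1) ?_ ?_ ?_ ?_
  · intro i
    fin_cases i <;> simp [omega6]
  · exact fun _ => Or.inl rfl
  · exact ⟨fun _ => 1, fun _ => Or.inl rfl, by decide⟩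
  · decide +kernel

theorem image_emb_crossVerts (c : V6) :
    emb c '' crossVerts = {x | ∃ i, x = c + basisVec i ∨ x = c - basisVec i} := by
  ext x
  constructor
  · rintro ⟨_, ⟨s, i, hs, rfl⟩, rfl⟩
    refine ⟨i, ?_⟩
    rw [emb_crossPt]
    rcases hs i with h | h
    · left
      simp [h]
    · right
      simp [h, sub_eq_add_neg]
  · rintro ⟨i, rfl | rfl⟩
    · refine ⟨_, ⟨fun _ => 1, i, fun _ => Or.inl rfl, rfl⟩, ?_⟩
      simp [emb_crossPt]
    · refine ⟨_, ⟨fun _ => -1, i, fun _ => Or.inr rfl, rfl⟩, ?_⟩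
      simp [emb_crossPt, sub_eq_add_neg]

theorem image_emb_hemiVerts (c : V6) (p : ℤˣ) :
    emb c '' hemiVerts p = {x | ∃ e : Fin 6 → ℤˣ, ∏ i, e i = p ∧
        x = c + ∑ i, (((e i : ℤ) : ℝ) / 2) • basisVec i} := by
  have hprod : ∀ e : Fin 6 → ℤˣ, signProd (fun i => (e i : ℤ)) = ((∏ i, e i : ℤˣ) : ℤ) := by
    intro e
    rw [Fin.prod_univ_six]
    push_cast
    rfl
  ext x
  constructor
  · rintro ⟨u, ⟨hu, hup⟩, rfl⟩
    have : ∀ i, ∃ e : ℤˣ, (e : ℤ) = u i := fun i => by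
      rcases hu i with h | h
      · exact ⟨1, by simp [h]⟩
      · exact ⟨-1, by simp [h]⟩
    choose e he using this
    refine ⟨e, ?_, ?_⟩
    · apply Units.ext
      rw [← hprod, ← hup]
      simp only [he]
    · rw [emb_eq_sum]
      simp only [he]
  · rintro ⟨e, hep, rfl⟩
    refine ⟨fun i => e i, ⟨fun i => ?_, by rw [hprod, hep]⟩, (emb_eq_sum c _).symm ▸ rfl⟩
    rcases Int.units_eq_one_or (e i) with h | h <;> simp [h]

/-! ### Volumes of simplices -/

open MeasureTheory in
/-- The volume of the corner simplex `{x | 0 ≤ x, ∑ x ≤ r}`. -/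
theorem volume_cornerSimplex (n : ℕ) (r : ℝ) (hr : 0 ≤ r) :
    volume {x : Fin n → ℝ | (∀ i, 0 ≤ x i) ∧ ∑ i, x i ≤ r} =
      ENNReal.ofReal (r ^ n / n.factorial) := by
  induction n generalizing r with
  | zero => simp [hr, volume_pi]
  | succ n ih =>
    have hmeas : ∀ (m : ℕ) (s : ℝ),
        MeasurableSet {x : Fin m → ℝ | (∀ i, 0 ≤ x i) ∧ ∑ i, x i ≤ s} := by
      intro m s
      refine MeasurableSet.inter ?_ (measurableSet_le
        (Finset.measurable_sum _ fun i _ => measurable_pi_apply i) measurable_const)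
      have : {x : Fin m → ℝ | ∀ i, 0 ≤ x i} = ⋂ i, {x | 0 ≤ x i} := by ext; simp
      change MeasurableSet {x : Fin m → ℝ | ∀ i, 0 ≤ x i}
      rw [this]
      exact MeasurableSet.iInter fun i => measurableSet_le measurable_const (by fun_prop)
    -- Slicing at the first coordinate x leaves the corner simplex of size r - x in one dimension
    -- less; its volume (r - x)ⁿ/n! is integrated over [0, r].
    have hmp := (volume_preserving_piFinSuccAbove (fun _ : Fin (n + 1) => ℝ) 0).symm
    rw [← hmp.measure_preimage (hmeas _ _).nullMeasurableSet, Measure.volume_eq_prod,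
      Measure.prod_apply (hmp.measurable (hmeas _ _))]
    have hslice : ∀ x : ℝ, volume (Prod.mk x ⁻¹'
        ((MeasurableEquiv.piFinSuccAbove (fun _ : Fin (n + 1) => ℝ) 0).symm ⁻¹'
          {x | (∀ i, 0 ≤ x i) ∧ ∑ i, x i ≤ r})) =
        (Set.Icc 0 r).indicator (fun x => ENNReal.ofReal ((r - x) ^ n / n.factorial)) x := by
      intro x
      have hset : Prod.mk x ⁻¹' ((MeasurableEquiv.piFinSuccAbove (fun _ : Fin (n + 1) => ℝ) 0).symm
          ⁻¹' {x | (∀ i, 0 ≤ x i) ∧ ∑ i, x i ≤ r}) =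
          {y : Fin n → ℝ | 0 ≤ x ∧ (∀ i, 0 ≤ y i) ∧ ∑ i, y i ≤ r - x} := by
        ext y
        simp [MeasurableEquiv.piFinSuccAbove_symm_apply, Fin.insertNthEquiv, Fin.forall_fin_succ,
          Fin.sum_univ_succ, and_assoc, le_sub_iff_add_le']
      rw [hset]
      by_cases hx : x ∈ Set.Icc 0 r
      · rw [Set.indicator_of_mem hx, ← ih (r - x) (by linarith [hx.2])]
        congr 1
        ext y
        simp [hx.1]
      · rw [Set.indicator_of_notMem hx]
        convert measure_empty (μ := (volume : Measure (Fin n → ℝ)))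
        ext y
        simp only [Set.mem_ofPred_eq, Set.mem_empty_iff_false, iff_false, not_and, not_le]
        intro h0 hy
        have : 0 ≤ ∑ i, y i := Finset.sum_nonneg fun i _ => hy i
        by_contra! h
        exact hx ⟨h0, by linarith⟩
    simp only [hslice]
    rw [lintegral_indicator measurableSet_Icc]
    have hcont : Continuous fun x : ℝ => (r - x) ^ n / n.factorial := by fun_prop
    rw [← ofReal_integral_eq_lintegral_ofReal hcont.integrableOn_Icc
      ((ae_restrict_iff' measurableSet_Icc).2 (Filter.Eventually.of_forall fun x hx =>
        div_nonneg (pow_nonneg (by linarith [hx.2]) n) (by positivity))),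
      integral_Icc_eq_integral_Ioc, ← intervalIntegral.integral_of_le hr]
    congr 1
    rw [intervalIntegral.integral_div,
      intervalIntegral.integral_comp_sub_left (fun x => x ^ n) r, integral_pow]
    rw [Nat.factorial_succ]
    push_cast
    field_simp
    simp

/-- Three-dimensional Euclidean space. -/
abbrev E3 : Type := EuclideanSpace ℝ (Fin 3)

/-- The determinant of three vectors. -/
def det3 (a b c : E3) : ℝ :=
  a 0 * (b 1 * c 2 - b 2 * c 1) + a 1 * (b 2 * c 0 - b 0 * c 2) + a 2 * (b 0 * c 1 - b 1 * c 0)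

/-- These are barycentric coordinates with the weight of `v 0` eliminated. -/
theorem convexHull_range_four {X : Type*} [AddCommGroup X] [Module ℝ X] (v : Fin 4 → X) :
    convexHull ℝ (Set.range v) =
      (fun x : Fin 3 → ℝ => v 0 + ∑ i, x i • (v i.succ - v 0)) ''
        {x | (∀ i, 0 ≤ x i) ∧ ∑ i, x i ≤ 1} := by
  apply Set.Subset.antisymm
  · refine convexHull_min ?_ ?_
    · rintro _ ⟨i, rfl⟩
      refine Fin.cases ?_ (fun i => ?_) i
      · exact ⟨0, by simp, by simp⟩
      · refine ⟨Pi.single i 1, ⟨fun j => ?_, by simp⟩, ?_⟩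
        · by_cases h : j = i
          · subst h
            simp
          · simp [h]
        · simp [Pi.single_apply]
    · rintro _ ⟨x, ⟨hx, hx1⟩, rfl⟩ _ ⟨y, ⟨hy, hy1⟩, rfl⟩ a b ha hb hab
      refine ⟨a • x + b • y, ⟨fun i => ?_, ?_⟩, ?_⟩
      · have := hx i
        have := hy i
        simp only [Pi.add_apply, Pi.smul_apply, smul_eq_mul]
        positivity
      · simp only [Pi.add_apply, Pi.smul_apply, smul_eq_mul, Finset.sum_add_distrib,
          ← Finset.mul_sum]
        nlinarith
      · have h0 : v 0 = a • v 0 + b • v 0 := by rw [← add_smul, hab, one_smul]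
        simp only [Pi.add_apply, Pi.smul_apply, smul_eq_mul, add_smul, Finset.sum_add_distrib,
          smul_add, Finset.smul_sum, mul_smul]
        nth_rewrite 1 [h0]
        abel
  · rintro _ ⟨x, ⟨hx, hx1⟩, rfl⟩
    have hmem := (convex_convexHull ℝ (Set.range v)).sum_mem (t := Finset.univ)
      (w := Fin.cons (1 - ∑ i, x i) x) (z := v) ?_ ?_ ?_
    · convert hmem using 1
      rw [Fin.sum_univ_succ (n := 3)]
      simp only [Fin.cons_zero, Fin.cons_succ, smul_sub, Finset.sum_sub_distrib, sub_smul,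
        one_smul, ← Finset.sum_smul]
      abel
    · intro i _
      refine Fin.cases ?_ (fun i => ?_) i
      · simpa using hx1
      · simpa using hx i
    · simp [Fin.sum_univ_succ (n := 3)]
    · exact fun i _ => subset_convexHull ℝ _ ⟨i, rfl⟩

-- The tetrahedron is an affine image of the corner simplex, of volume 1/3!, under the matrix whose
-- columns are the edge vectors at `v 0`.
open MeasureTheory in
theorem volume_convexHull_range_four (v : Fin 4 → E3) :
    volume (convexHull ℝ (Set.range v)) =
      ENNReal.ofReal (|det3 (v 1 - v 0) (v 2 - v 0) (v 3 - v 0)| / 6) := by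
  have hclosed : IsClosed (convexHull ℝ (Set.range v)) :=
    ((Set.finite_range v).isCompact_convexHull ℝ).isClosed
  rw [← (PiLp.volume_preserving_toLp (Fin 3)).measure_preimage
    hclosed.measurableSet.nullMeasurableSet]
  let A : Matrix (Fin 3) (Fin 3) ℝ := Matrix.of fun i j => (v j.succ - v 0) i
  have hset : (WithLp.toLp 2 : (Fin 3 → ℝ) → E3) ⁻¹' convexHull ℝ (Set.range v) =
      (fun y => WithLp.ofLp (v 0) + y) '' (Matrix.toLin' A ''
        {x | (∀ i, 0 ≤ x i) ∧ ∑ i, x i ≤ 1}) := by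
    rw [convexHull_range_four, Set.image_image]
    have key : ∀ x : Fin 3 → ℝ, WithLp.ofLp (v 0 + ∑ i, x i • (v i.succ - v 0)) =
        WithLp.ofLp (v 0) + Matrix.toLin' A x := by
      intro x
      funext i
      simp [A, Matrix.mulVec, dotProduct, mul_comm]
    ext y
    constructor
    · rintro ⟨x, hx, hxy⟩
      refine ⟨x, hx, ?_⟩
      change WithLp.ofLp (v 0) + Matrix.toLin' A x = y
      rw [← key]
      exact congrArg WithLp.ofLp hxy
    · rintro ⟨x, hx, rfl⟩
      refine ⟨x, hx, ?_⟩
      change _ = WithLp.toLp 2 (WithLp.ofLp (v 0) + Matrix.toLin' A x)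
      rw [← key]
  rw [hset, Set.image_add_left, measure_preimage_add, Measure.addHaar_image_linearMap,
    volume_cornerSimplex 3 1
    zero_le_one, LinearMap.det_toLin', ← ENNReal.ofReal_mul (abs_nonneg _)]
  congr 1
  have hdet : A.det = det3 (v 1 - v 0) (v 2 - v 0) (v 3 - v 0) := by
    rw [Matrix.det_fin_three]
    simp only [A, Matrix.of_apply, det3]
    change (v 1 - v 0) 0 * (v 2 - v 0) 1 * (v 3 - v 0) 2 -
      (v 1 - v 0) 0 * (v 3 - v 0) 1 * (v 2 - v 0) 2 -
      (v 2 - v 0) 0 * (v 1 - v 0) 1 * (v 3 - v 0) 2 +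
      (v 2 - v 0) 0 * (v 3 - v 0) 1 * (v 1 - v 0) 2 +
      (v 3 - v 0) 0 * (v 1 - v 0) 1 * (v 2 - v 0) 2 -
      (v 3 - v 0) 0 * (v 2 - v 0) 1 * (v 1 - v 0) 2 = _
    ring
  rw [hdet]
  norm_num [Nat.factorial]
  ring

/-! ### Arithmetic and order of ℤ[τ] inside ℝ. -/

theorem ev_zmul (x y : ℤ × ℤ) : ev (zmul x y) = ev x * ev y := by
  simp only [ev, zmul]
  push_cast
  linear_combination (-(x.2 * y.2 : ℝ)) * Real.goldenRatio_sq

theorem ev_zadd (x y : ℤ × ℤ) : ev (zadd x y) = ev x + ev y := by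
  simp only [ev, zadd]
  push_cast
  ring

theorem ev_zsub (x y : ℤ × ℤ) : ev (zsub x y) = ev x - ev y := by
  simp only [ev, zsub]
  push_cast
  ring

theorem ev_eq_zero_iff (x : ℤ × ℤ) : ev x = 0 ↔ x = (0, 0) := by
  constructor
  · intro h
    have h2 : x.2 = 0 := by
      by_contra h2
      refine Real.goldenRatio_irrational ⟨-x.1 / x.2, ?_⟩
      have : (x.2 : ℝ) ≠ 0 := by exact_mod_cast h2
      push_cast
      rw [div_eq_iff this]
      simp only [ev] at h
      linarith
    have h1 : x.1 = 0 := by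
      simp only [ev, h2, Int.cast_zero, zero_mul, add_zero] at h
      exact_mod_cast h
    exact Prod.ext h1 h2
  · rintro rfl
    simp [ev]

theorem ev_nonneg_of_znonneg {x : ℤ × ℤ} (h : znonneg x = true) : 0 ≤ ev x := by
  have h5 : Real.sqrt 5 ^ 2 = 5 := Real.sq_sqrt (by norm_num)
  have h5' : 0 ≤ Real.sqrt 5 := Real.sqrt_nonneg 5
  have hev : 2 * ev x = (2 * x.1 + x.2 : ℤ) + x.2 * Real.sqrt 5 := by
    simp only [ev, Real.goldenRatio]
    push_cast
    ring
  suffices 0 ≤ ((2 * x.1 + x.2 : ℤ) : ℝ) + x.2 * Real.sqrt 5 by linarith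
  simp only [znonneg] at h
  generalize 2 * x.1 + x.2 = p at h
  generalize x.2 = r at h
  split_ifs at h with hr
  · have hr' : (0 : ℝ) ≤ r := by exact_mod_cast hr
    rcases Bool.or_eq_true _ _ ▸ h with h | h
    · have : (0 : ℝ) ≤ p := by exact_mod_cast of_decide_eq_true h
      positivity
    · have hpr : (p : ℝ) * p ≤ 5 * (r * r) := by exact_mod_cast of_decide_eq_true h
      have := abs_le_of_sq_le_sq' (a := (p : ℝ)) (b := r * Real.sqrt 5)
        (by rw [mul_pow, h5]; nlinarith) (by positivity)
      linarith [this.1]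
  · rw [Bool.and_eq_true] at h
    have hp : (0 : ℝ) ≤ p := by exact_mod_cast of_decide_eq_true h.1
    have hpr : 5 * ((r : ℝ) * r) ≤ p * p := by exact_mod_cast of_decide_eq_true h.2
    have := abs_le_of_sq_le_sq' (a := r * Real.sqrt 5) (b := (p : ℝ))
        (by rw [mul_pow, h5]; nlinarith) hp
    linarith [this.1]

theorem ev_nonpos_of_not_znonneg {x : ℤ × ℤ} (h : znonneg x = false) : ev x ≤ 0 := by
  have h5 : Real.sqrt 5 ^ 2 = 5 := Real.sq_sqrt (by norm_num)
  have h5' : 0 ≤ Real.sqrt 5 := Real.sqrt_nonneg 5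
  have hev : 2 * ev x = (2 * x.1 + x.2 : ℤ) + x.2 * Real.sqrt 5 := by
    simp only [ev, Real.goldenRatio]
    push_cast
    ring
  suffices ((2 * x.1 + x.2 : ℤ) : ℝ) + x.2 * Real.sqrt 5 ≤ 0 by linarith
  simp only [znonneg] at h
  generalize 2 * x.1 + x.2 = p at h
  generalize x.2 = r at h
  split_ifs at h with hr
  · rw [Bool.or_eq_false_iff] at h
    have hp : (p : ℝ) < 0 := by exact_mod_cast not_le.1 (of_decide_eq_false h.1)
    have hpr : 5 * ((r : ℝ) * r) < p * p := by exact_mod_cast not_le.1 (of_decide_eq_false h.2)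
    have := abs_le_of_sq_le_sq' (a := r * Real.sqrt 5) (b := -(p : ℝ))
      (by rw [mul_pow, h5]; nlinarith) (by linarith)
    linarith [this.2]
  · have hr' : (r : ℝ) < 0 := by exact_mod_cast not_le.1 hr
    rw [Bool.and_eq_false_iff] at h
    rcases h with h | h
    · have hp : (p : ℝ) < 0 := by exact_mod_cast not_le.1 (of_decide_eq_false h)
      nlinarith
    · have hpr : (p : ℝ) * p < 5 * (r * r) := by exact_mod_cast not_le.1 (of_decide_eq_false h)
      have := abs_le_of_sq_le_sq' (a := (p : ℝ)) (b := -r * Real.sqrt 5)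
        (by rw [mul_pow, h5]; nlinarith) (by nlinarith)
      linarith [this.2]

/-! ### Tiles and their edge patterns -/

/-- The faces of a tetrahedron, each given by the kinds of its edges (`true` for long edges). -/
def patternFaces (b01 b02 b03 b12 b13 b23 : Bool) : Multiset (Multiset Bool) :=
  {{b12, b13, b23}, {b02, b03, b23}, {b01, b03, b13}, {b01, b02, b12}}

/-- The faces of the tiles in terms of long and short edges. -/
def tilePattern : Fin 6 → Multiset (Multiset Bool) :=
  ![{{false, false, false}, {false, false, false}, {false, false, true}, {false, false, true}},
    {{false, false, false}, {false, false, true}, {false, false, true}, {false, true, true}},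
    {{true, true, true}, {false, false, true}, {false, false, true}, {false, false, true}},
    {{false, false, false}, {false, true, true}, {false, true, true}, {false, true, true}},
    {{true, true, true}, {false, false, true}, {false, true, true}, {false, true, true}},
    {{true, true, true}, {true, true, true}, {false, true, true}, {false, true, true}}]

/-- The length of an edge of given kind. -/
def edgeLen (s : ℝ) (b : Bool) : ℝ := if b then s * Real.goldenRatio else s

theorem edgeLen_injective {s : ℝ} (hs : 0 < s) : Function.Injective (edgeLen s) := by
  have : s * Real.goldenRatio ≠ s := by
    have := Real.one_lt_goldenRatio
    nlinarith
  intro a b h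
  cases a <;> cases b <;> simp [edgeLen] at h ⊢
  · exact this h.symm
  · exact this h

/-- Because `edgeLen` is injective for s > 0, equalities between multisets of real lengths become
equalities between multisets of Booleans, which can be evaluated. -/
theorem tileFaces_eq_map (s : ℝ) (k : Fin 6) :
    tileFaces s k = (tilePattern k).map (Multiset.map (edgeLen s)) := by
  fin_cases k <;> simp [tileFaces, tilePattern, edgeLen, Multiset.insert_eq_cons]

theorem faces_eq_map {X : Type*} [NormedAddCommGroup X] {s : ℝ} {v : Fin 4 → X}
    {b01 b02 b03 b12 b13 b23 : Bool}
    (h01 : dist (v 0) (v 1) = edgeLen s b01) (h02 : dist (v 0) (v 2) = edgeLen s b02)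
    (h03 : dist (v 0) (v 3) = edgeLen s b03) (h12 : dist (v 1) (v 2) = edgeLen s b12)
    (h13 : dist (v 1) (v 3) = edgeLen s b13) (h23 : dist (v 2) (v 3) = edgeLen s b23) :
    ({faceEdges v 0, faceEdges v 1, faceEdges v 2, faceEdges v 3} : Multiset (Multiset ℝ)) =
      (patternFaces b01 b02 b03 b12 b13 b23).map (Multiset.map (edgeLen s)) := by
  have e0 : faceEdges v 0 = {dist (v 1) (v 2), dist (v 1) (v 3), dist (v 2) (v 3)} := rfl
  have e1 : faceEdges v 1 = {dist (v 0) (v 2), dist (v 0) (v 3), dist (v 2) (v 3)} := rfl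
  have e2 : faceEdges v 2 = {dist (v 0) (v 1), dist (v 0) (v 3), dist (v 1) (v 3)} := rfl
  have e3 : faceEdges v 3 = {dist (v 0) (v 1), dist (v 0) (v 2), dist (v 1) (v 2)} := rfl
  simp [e0, e1, e2, e3, h01, h02, h03, h12, h13, h23, patternFaces, Multiset.insert_eq_cons]

theorem edge_of_mem_tileFaces {s : ℝ} {k : Fin 6} {m : Multiset ℝ} (hm : m ∈ tileFaces s k)
    {x : ℝ} (hx : x ∈ m) : ∃ b, x = edgeLen s b := by
  rw [tileFaces_eq_map, Multiset.mem_map] at hm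
  obtain ⟨m', -, rfl⟩ := hm
  obtain ⟨b, -, rfl⟩ := Multiset.mem_map.1 hx
  exact ⟨b, rfl⟩

/-- The edges of a tile are short or long. -/
theorem IsTileVertices.exists_pattern {X : Type*} [NormedAddCommGroup X] [InnerProductSpace ℝ X]
    {s : ℝ} (hs : 0 < s) {k : Fin 6} {v : Fin 4 → X}
    (h : IsTileVertices s k v) :
    ∃ b01 b02 b03 b12 b13 b23, dist (v 0) (v 1) = edgeLen s b01 ∧ dist (v 0) (v 2) = edgeLen s b02 ∧
      dist (v 0) (v 3) = edgeLen s b03 ∧ dist (v 1) (v 2) = edgeLen s b12 ∧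
      dist (v 1) (v 3) = edgeLen s b13 ∧ dist (v 2) (v 3) = edgeLen s b23 ∧
      patternFaces b01 b02 b03 b12 b13 b23 = tilePattern k := by
  have hmem : ∀ i, faceEdges v i ∈ tileFaces s k := by
    intro i
    rw [← h.2]
    fin_cases i <;> simp
  have e0 : faceEdges v 0 = {dist (v 1) (v 2), dist (v 1) (v 3), dist (v 2) (v 3)} := rfl
  have e1 : faceEdges v 1 = {dist (v 0) (v 2), dist (v 0) (v 3), dist (v 2) (v 3)} := rfl
  have e2 : faceEdges v 2 = {dist (v 0) (v 1), dist (v 0) (v 3), dist (v 1) (v 3)} := rfl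
  obtain ⟨b12, h12⟩ := edge_of_mem_tileFaces (hmem 0) (x := dist (v 1) (v 2)) (by simp [e0])
  obtain ⟨b13, h13⟩ := edge_of_mem_tileFaces (hmem 0) (x := dist (v 1) (v 3)) (by simp [e0])
  obtain ⟨b23, h23⟩ := edge_of_mem_tileFaces (hmem 0) (x := dist (v 2) (v 3)) (by simp [e0])
  obtain ⟨b02, h02⟩ := edge_of_mem_tileFaces (hmem 1) (x := dist (v 0) (v 2)) (by simp [e1])
  obtain ⟨b03, h03⟩ := edge_of_mem_tileFaces (hmem 1) (x := dist (v 0) (v 3)) (by simp [e1])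
  obtain ⟨b01, h01⟩ := edge_of_mem_tileFaces (hmem 2) (x := dist (v 0) (v 1)) (by simp [e2])
  refine ⟨b01, b02, b03, b12, b13, b23, h01, h02, h03, h12, h13, h23, ?_⟩
  have := h.2
  rw [faces_eq_map h01 h02 h03 h12 h13 h23, tileFaces_eq_map] at this
  exact Multiset.map_injective (Multiset.map_injective (edgeLen_injective hs)) this

/-- Four times the Gram determinant of a tetrahedron with given squared edge lengths. -/
def gram4 (x01 x02 x03 x12 x13 x23 : ℤ × ℤ) : ℤ × ℤ :=
  -- By the law of cosines, `p`, `q`, `r` are twice the inner products of the edge vectors at vertex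
  -- 0.
  let p := zsub (zadd x01 x02) x12
  let q := zsub (zadd x01 x03) x13
  let r := zsub (zadd x02 x03) x23
  zsub (zadd (zmul (4, 0) (zmul x01 (zmul x02 x03))) (zmul p (zmul q r)))
    (zadd (zmul x01 (zmul r r)) (zadd (zmul x02 (zmul q q)) (zmul x03 (zmul p p))))

/-- The squared length of an edge of given kind, in units of the short edge. -/
def sqLen (b : Bool) : ℤ × ℤ := if b then (1, 1) else (1, 0)

theorem edgeLen_sq (s : ℝ) (b : Bool) : edgeLen s b ^ 2 = s ^ 2 * ev (sqLen b) := by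
  cases b <;> simp [edgeLen, sqLen, ev, mul_pow, Real.goldenRatio_sq, add_comm]

/-- Twelve times the volumes of the tiles. -/
def tileVolume12 : Fin 6 → ℤ × ℤ := ![(1, 0), (0, 1), (0, 1), (1, 1), (1, 1), (1, 2)]

theorem ev_tileVolume12 (k : Fin 6) : ev (tileVolume12 k) = 12 * tileVolume k := by
  have h2 := Real.goldenRatio_sq
  fin_cases k <;> simp [ev, tileVolume12, tileVolume]
  · ring
  · ring
  · linarith
  · linarith
  · have h3 : Real.goldenRatio ^ 3 = 1 + 2 * Real.goldenRatio := by
      linear_combination (Real.goldenRatio + 1) * h2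
    rw [h3]
    ring

/-- Twelve times the volume is 2|det|, whose square is four times the Gram determinant. That is why
the tile volumes appear as exact square roots in ℤ[τ]. -/
theorem gram4_of_pattern : ∀ (k : Fin 6) (b01 b02 b03 b12 b13 b23 : Bool),
    patternFaces b01 b02 b03 b12 b13 b23 = tilePattern k →
    gram4 (sqLen b01) (sqLen b02) (sqLen b03) (sqLen b12) (sqLen b13) (sqLen b23) =
      zmul (tileVolume12 k) (tileVolume12 k) := by
  decide +kernel

theorem dist_sq_E3 (x y : E3) :
    dist x y ^ 2 = (x 0 - y 0) ^ 2 + (x 1 - y 1) ^ 2 + (x 2 - y 2) ^ 2 := by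
  rw [EuclideanSpace.dist_sq_eq, Fin.sum_univ_three]
  simp only [Real.dist_eq, sq_abs]

theorem four_mul_det3_sq {s : ℝ} {v : Fin 4 → E3} {b01 b02 b03 b12 b13 b23 : Bool}
    (h01 : dist (v 0) (v 1) = edgeLen s b01) (h02 : dist (v 0) (v 2) = edgeLen s b02)
    (h03 : dist (v 0) (v 3) = edgeLen s b03) (h12 : dist (v 1) (v 2) = edgeLen s b12)
    (h13 : dist (v 1) (v 3) = edgeLen s b13) (h23 : dist (v 2) (v 3) = edgeLen s b23) :
    4 * det3 (v 1 - v 0) (v 2 - v 0) (v 3 - v 0) ^ 2 =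
      s ^ 6 * ev (gram4 (sqLen b01) (sqLen b02) (sqLen b03) (sqLen b12) (sqLen b13)
        (sqLen b23)) := by
  have key : ∀ {i j b}, dist (v i) (v j) = edgeLen s b →
      s ^ 2 * ev (sqLen b) = (v i 0 - v j 0) ^ 2 + (v i 1 - v j 1) ^ 2 + (v i 2 - v j 2) ^ 2 := by
    intro i j b h
    rw [← edgeLen_sq, ← h, dist_sq_E3]
  -- The Gram determinant is a cubic form in the squared lengths, so s⁶ can be distributed as s²
  -- onto each of them.
  have e : ∀ x01 x02 x03 x12 x13 x23 : ℝ, s ^ 6 * (4 * (x01 * (x02 * x03)) +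
      (x01 + x02 - x12) * ((x01 + x03 - x13) * (x02 + x03 - x23)) -
      (x01 * ((x02 + x03 - x23) * (x02 + x03 - x23)) +
        (x02 * ((x01 + x03 - x13) * (x01 + x03 - x13)) +
          x03 * ((x01 + x02 - x12) * (x01 + x02 - x12))))) =
      (4 * ((s ^ 2 * x01) * ((s ^ 2 * x02) * (s ^ 2 * x03))) +
      (s ^ 2 * x01 + s ^ 2 * x02 - s ^ 2 * x12) * ((s ^ 2 * x01 + s ^ 2 * x03 - s ^ 2 * x13) *
        (s ^ 2 * x02 + s ^ 2 * x03 - s ^ 2 * x23)) -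
      (s ^ 2 * x01 * ((s ^ 2 * x02 + s ^ 2 * x03 - s ^ 2 * x23) *
        (s ^ 2 * x02 + s ^ 2 * x03 - s ^ 2 * x23)) +
        (s ^ 2 * x02 * ((s ^ 2 * x01 + s ^ 2 * x03 - s ^ 2 * x13) *
          (s ^ 2 * x01 + s ^ 2 * x03 - s ^ 2 * x13)) +
          s ^ 2 * x03 * ((s ^ 2 * x01 + s ^ 2 * x02 - s ^ 2 * x12) *
            (s ^ 2 * x01 + s ^ 2 * x02 - s ^ 2 * x12))))) := by
    intros
    ring
  simp only [gram4, ev_zsub, ev_zadd, ev_zmul]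
  have h4 : ev (4, 0) = 4 := by simp [ev]
  rw [h4, e, key h01, key h02, key h03, key h12, key h13, key h23]
  simp only [det3, PiLp.sub_apply]
  ring

theorem abs_det3_of_isTileVertices {s : ℝ} (hs : 0 < s) {k : Fin 6} {v : Fin 4 → E3}
    (h : IsTileVertices s k v) :
    |det3 (v 1 - v 0) (v 2 - v 0) (v 3 - v 0)| / 6 = s ^ 3 * tileVolume k := by
  obtain ⟨b01, b02, b03, b12, b13, b23, h01, h02, h03, h12, h13, h23, hb⟩ := h.exists_pattern hs
  have hdet := four_mul_det3_sq h01 h02 h03 h12 h13 h23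
  rw [gram4_of_pattern k _ _ _ _ _ _ hb, ev_zmul, ev_tileVolume12] at hdet
  have hpos : 0 ≤ tileVolume k := by
    have := Real.goldenRatio_pos
    fin_cases k <;> simp [tileVolume] <;> positivity
  have : |det3 (v 1 - v 0) (v 2 - v 0) (v 3 - v 0)| = 6 * (s ^ 3 * tileVolume k) := by
    rw [← abs_of_nonneg (show 0 ≤ 6 * (s ^ 3 * tileVolume k) by positivity)]
    refine (sq_eq_sq_iff_abs_eq_abs _ _).1 ?_
    linarith
  rw [this]
  ring

/-! ### Coordinates in `E_∥` -/

/-- The orthogonal vectors spanning `E_∥`. -/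
def parVec : Fin 3 → V6 :=
  ![!₂[1, -1, 0, 0, Real.goldenRatio, -Real.goldenRatio],
    !₂[Real.goldenRatio, Real.goldenRatio, 1, 1, 0, 0],
    !₂[0, 0, Real.goldenRatio, -Real.goldenRatio, 1, 1]]

theorem Epar_eq_span : Epar = Submodule.span ℝ (Set.range parVec) := by
  rw [Epar, parVec]
  congr 1
  simp only [Matrix.range_cons, Matrix.range_empty, Set.union_empty, Set.singleton_union]

theorem unitLen_pos : 0 < unitLen := by
  have := Real.goldenRatio_pos
  exact Real.sqrt_pos.2 (by positivity)

theorem unitLen_sq : unitLen ^ 2 * (2 + Real.goldenRatio) = 2 := by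
  have := Real.goldenRatio_pos
  rw [unitLen, Real.sq_sqrt (by positivity)]
  field_simp

theorem inner_V6 (x y : V6) : inner ℝ x y =
    x 0 * y 0 + x 1 * y 1 + x 2 * y 2 + x 3 * y 3 + x 4 * y 4 + x 5 * y 5 := by
  simp only [PiLp.inner_apply, Fin.sum_univ_six, RCLike.inner_apply, conj_trivial]
  ring

theorem inner_parVec (x : V6) : (fun j => inner ℝ (parVec j) x) =
    ![x 0 - x 1 + Real.goldenRatio * (x 4 - x 5), x 2 + x 3 + Real.goldenRatio * (x 0 + x 1),
      x 4 + x 5 + Real.goldenRatio * (x 2 - x 3)] := by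
  funext j
  fin_cases j <;> simp [inner_V6, parVec] <;> ring

/-- The spanning vectors have squared length 2 + 2τ² = 2(2 + τ), and `unitLen` ^ 2 = 2/(2 + τ). -/
theorem orthonormal_parVec : Orthonormal ℝ fun j => (unitLen / 2) • parVec j := by
  have h2 := Real.goldenRatio_sq
  have hu := unitLen_sq
  rw [orthonormal_iff_ite]
  intro i j
  rw [inner_smul_left, inner_smul_right, conj_trivial]
  have h : inner ℝ (parVec i) (parVec j) = if i = j then 2 * (2 + Real.goldenRatio) else 0 := by
    rw [inner_V6]
    fin_cases i <;> fin_cases j <;> simp [parVec] <;> nlinarith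
  rw [h]
  split_ifs
  · linarith
  · simp

theorem smul_parVec_mem (j : Fin 3) : (unitLen / 2) • parVec j ∈ Epar := by
  rw [Epar_eq_span]
  exact Submodule.smul_mem _ _ (Submodule.subset_span ⟨j, rfl⟩)

theorem linearIndependent_parVec : LinearIndependent ℝ parVec := by
  have h := orthonormal_parVec.linearIndependent
  have hu : unitLen / 2 ≠ 0 := by have := unitLen_pos; positivity
  exact (LinearIndependent.units_smul_iff parVec (fun _ => Units.mk0 _ hu)).1 h

theorem finrank_Epar : Module.finrank ℝ Epar = 3 := by
  rw [Epar_eq_span, finrank_span_eq_card linearIndependent_parVec, Fintype.card_fin]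

theorem orthonormal_Epar :
    Orthonormal ℝ fun j => (⟨(unitLen / 2) • parVec j, smul_parVec_mem j⟩ : Epar) :=
  (Epar.subtypeₗᵢ.orthonormal_comp_iff).1 orthonormal_parVec

/-- The orthonormal basis of `E_∥` in which coordinates are taken. -/
def parBasis : OrthonormalBasis (Fin 3) ℝ Epar :=
  OrthonormalBasis.mk orthonormal_Epar
    (orthonormal_Epar.linearIndependent.span_eq_top_of_card_eq_finrank'
      (by rw [finrank_Epar, Fintype.card_fin])).ge

/-- The vector of `ℝ³` with given coordinates in `ℤ[τ]`. -/
def evv (u : ZVec) : E3 := !₂[ev u.1, ev u.2.1, ev u.2.2]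

/-- The similarity from `ℝ³` to `E_∥` that takes the origin to the projection of `c`, and the
vectors `evv (pt v)` to the projections of `emb c v`. -/
def psi (c : V6) : E3 →ᵃ[ℝ] Epar :=
  -- One factor `unitLen / 2` normalizes the basis of `Epar`; the remaining 1/2 undoes the doubling
  -- of coordinates.
  ((unitLen / 4) • (parBasis.repr.symm.toLinearEquiv : E3 →ₗ[ℝ] Epar)).toAffineMap +
    AffineMap.const ℝ E3 (Epar.orthogonalProjectionOnto c)

theorem psi_apply (c : V6) (y : E3) :
    psi c y = (unitLen / 4) • parBasis.repr.symm y + Epar.orthogonalProjectionOnto c := rfl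

theorem psi_evv_pt (c : V6) (v : Fin 6 → ℤ) :
    psi c (evv (pt v)) = Epar.orthogonalProjectionOnto (emb c v) := by
  rw [psi_apply, emb, map_add, add_comm, add_right_inj]
  apply parBasis.repr.injective
  rw [map_smul, LinearIsometryEquiv.apply_symm_apply]
  ext j
  rw [OrthonormalBasis.repr_apply_apply, PiLp.smul_apply]
  have hb : parBasis j = (⟨(unitLen / 2) • parVec j, smul_parVec_mem j⟩ : Epar) := by
    simp [parBasis]
  rw [hb, Submodule.inner_orthogonalProjectionOnto_eq_of_mem_left, inner_smul_left, conj_trivial,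
    congrFun (inner_parVec _) j]
  fin_cases j <;> simp [evv, ev, pt] <;> ring

theorem projPar_convexHull_image (c : V6) (S : Set (Fin 6 → ℤ)) :
    projPar (convexHull ℝ (emb c '' S)) = psi c '' convexHull ℝ ((fun v => evv (pt v)) '' S) := by
  rw [projPar, AffineMap.image_convexHull, Set.image_image]
  simp only [psi_evv_pt]
  rw [← Set.image_image (fun x => Epar.orthogonalProjectionOnto x) (emb c)]
  exact LinearMap.image_convexHull
    (Epar.orthogonalProjectionOnto : V6 →ₗ[ℝ] Epar) _

/-- The projection of the face with vertices `q`, in unnormalized coordinates. -/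
def ptet (q : Fin 4 → Fin 6 → ℤ) : Set E3 := convexHull ℝ (Set.range fun m => evv (pt (q m)))

theorem projPar_tet (c : V6) (q : Fin 4 → Fin 6 → ℤ) : projPar (tet c q) = psi c '' ptet q := by
  have h1 : (Set.range fun m => emb c (q m)) = emb c '' Set.range q := by
    rw [← Set.range_comp]
    rfl
  have h2 : (Set.range fun m => evv (pt (q m))) = (fun v => evv (pt v)) '' Set.range q := by
    rw [← Set.range_comp]
    rfl
  rw [tet, ptet, h1, h2, projPar_convexHull_image]

theorem dist_psi (c : V6) (x y : E3) : dist (psi c x) (psi c y) = unitLen / 4 * dist x y := by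
  have := unitLen_pos
  rw [psi_apply, psi_apply, dist_add_right, dist_eq_norm, ← smul_sub, norm_smul, ← map_sub,
    LinearIsometryEquiv.norm_map, Real.norm_of_nonneg (by positivity), dist_eq_norm]

theorem psi_injective (c : V6) : Function.Injective (psi c) := by
  intro x y h
  have h1 := dist_psi c x y
  have := unitLen_pos
  rw [h, dist_self] at h1
  rcases mul_eq_zero.1 h1.symm with h2 | h2
  · linarith
  · exact dist_eq_zero.1 h2

/-- `psi c` as a homeomorphism. -/
def psiHomeo (c : V6) : E3 ≃ₜ Epar :=
  (parBasis.repr.symm.toHomeomorph.trans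
    (Homeomorph.smulOfNeZero (unitLen / 4) (by have := unitLen_pos; positivity))).trans
    (Homeomorph.addRight (Epar.orthogonalProjectionOnto c))

theorem interior_image_psi (c : V6) (A : Set E3) :
    interior (psi c '' A) = psi c '' interior A :=
  ((psiHomeo c).image_interior A).symm

theorem finrank_vectorSpan_image_psi (c : V6) (A : Set E3) :
    Module.finrank ℝ (vectorSpan ℝ (psi c '' A)) = Module.finrank ℝ (vectorSpan ℝ A) := by
  rw [← AffineMap.map_vectorSpan]
  exact (Submodule.equivMapOfInjective _ ((psi c).linear_injective_iff.2 (psi_injective c))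
    _).finrank_eq.symm

theorem volPar_convexHull_of_isTileVertices {s : ℝ} (hs : 0 < s) {k : Fin 6} {v : Fin 4 → Epar}
    (h : IsTileVertices s k v) :
    volPar (convexHull ℝ (Set.range v)) = ENNReal.ofReal (s ^ 3 * tileVolume k) := by
  have hv : IsTileVertices s k fun i => parBasis.repr (v i) := by
    refine ⟨?_, ?_⟩
    · exact h.1.map' parBasis.repr.toLinearIsometry.toAffineIsometry.toAffineMap
        parBasis.repr.injective
    · have := h.2
      simp only [faceEdges, LinearIsometryEquiv.dist_map] at this ⊢
      exact this
  rw [← abs_det3_of_isTileVertices hs hv, ← volume_convexHull_range_four fun i =>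
    parBasis.repr (v i)]
  have himg : convexHull ℝ (Set.range fun i => parBasis.repr (v i)) =
      parBasis.repr.symm ⁻¹' convexHull ℝ (Set.range v) := by
    rw [← LinearIsometryEquiv.image_eq_preimage_symm]
    have := LinearMap.image_convexHull (parBasis.repr.toLinearEquiv : Epar →ₗ[ℝ] E3) (Set.range v)
    rw [← Set.range_comp] at this
    exact this.symm
  rw [himg, volPar]
  refine (parBasis.measurePreserving_repr_symm.measure_preimage ?_).symm
  exact (((Set.finite_range v).isCompact_convexHull ℝ).isClosed).measurableSet.nullMeasurableSet

theorem dist_of_isTileVertices {s : ℝ} (hs : 0 < s) {k : Fin 6} {v : Fin 4 → Epar}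
    (h : IsTileVertices s k v) (i j : Fin 4) (hij : i ≠ j) :
    dist (v i) (v j) = s ∨ dist (v i) (v j) = s * Real.goldenRatio := by
  obtain ⟨b01, b02, b03, b12, b13, b23, h01, h02, h03, h12, h13, h23, -⟩ := h.exists_pattern hs
  have key : ∀ b, edgeLen s b = s ∨ edgeLen s b = s * Real.goldenRatio := by
    intro b
    cases b
    · exact Or.inl rfl
    · exact Or.inr rfl
  have hlt : ∀ i j : Fin 4, i < j →
      dist (v i) (v j) = s ∨ dist (v i) (v j) = s * Real.goldenRatio := by
    have hpairs : ∀ i j : Fin 4, i < j → i = 0 ∧ j = 1 ∨ i = 0 ∧ j = 2 ∨ i = 0 ∧ j = 3 ∨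
        i = 1 ∧ j = 2 ∨ i = 1 ∧ j = 3 ∨ i = 2 ∧ j = 3 := by decide
    intro i j hij
    rcases hpairs i j hij with ⟨rfl, rfl⟩ | ⟨rfl, rfl⟩ | ⟨rfl, rfl⟩ | ⟨rfl, rfl⟩ |
      ⟨rfl, rfl⟩ | ⟨rfl, rfl⟩
    exacts [h01 ▸ key _, h02 ▸ key _, h03 ▸ key _, h12 ▸ key _, h13 ▸ key _, h23 ▸ key _]
  rcases lt_or_gt_of_ne hij with h | h
  · exact hlt i j h
  · rw [dist_comm]
    exact hlt j i h

/-! ### Classification of the projected faces -/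

theorem evv_zero (u : ZVec) : evv u 0 = ev u.1 := rfl
theorem evv_one (u : ZVec) : evv u 1 = ev u.2.1 := rfl
theorem evv_two (u : ZVec) : evv u 2 = ev u.2.2 := rfl

theorem ev_vdot (u v : ZVec) :
    ev (vdot u v) = evv u 0 * evv v 0 + evv u 1 * evv v 1 + evv u 2 * evv v 2 := by
  simp only [vdot, ev_zadd, ev_zmul, evv_zero, evv_one, evv_two]
  ring

/-- Four points of space are affinely independent if and only if they span a nonzero volume. -/
theorem affineIndependent_iff_det3_ne_zero (v : Fin 4 → E3) :
    AffineIndependent ℝ v ↔ det3 (v 1 - v 0) (v 2 - v 0) (v 3 - v 0) ≠ 0 := by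
  rw [affineIndependent_iff_linearIndependent_vsub ℝ v 0,
    ← linearIndependent_equiv (finSuccAboveEquiv (0 : Fin 4))]
  let A : Matrix (Fin 3) (Fin 3) ℝ := Matrix.of fun i => WithLp.ofLp (v i.succ - v 0)
  have h1 : LinearIndependent ℝ A.row ↔ A.det ≠ 0 := by
    rw [Matrix.linearIndependent_rows_iff_isUnit, Matrix.isUnit_iff_isUnit_det, isUnit_iff_ne_zero]
  have h2 : A.det = det3 (v 1 - v 0) (v 2 - v 0) (v 3 - v 0) := by
    rw [Matrix.det_fin_three]
    simp only [A, Matrix.of_apply, det3]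
    change (v 1 - v 0) 0 * (v 2 - v 0) 1 * (v 3 - v 0) 2 -
      (v 1 - v 0) 0 * (v 2 - v 0) 2 * (v 3 - v 0) 1 -
      (v 1 - v 0) 1 * (v 2 - v 0) 0 * (v 3 - v 0) 2 +
      (v 1 - v 0) 1 * (v 2 - v 0) 2 * (v 3 - v 0) 0 +
      (v 1 - v 0) 2 * (v 2 - v 0) 0 * (v 3 - v 0) 1 -
      (v 1 - v 0) 2 * (v 2 - v 0) 1 * (v 3 - v 0) 0 = _
    ring
  rw [← h2, ← h1]
  let e : E3 ≃ₗ[ℝ] (Fin 3 → ℝ) := WithLp.linearEquiv 2 ℝ (Fin 3 → ℝ)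
  exact (LinearMap.linearIndependent_iff (e : E3 →ₗ[ℝ] (Fin 3 → ℝ)) e.ker).symm

/-- The coefficient of `τ` in the squared length of a projected edge. -/
def edgeInt (u v : Fin 6 → ℤ) : ℤ :=
  let x := (u 4 - v 4) - (u 5 - v 5)
  let y := (u 0 - v 0) + (u 1 - v 1)
  let z := (u 2 - v 2) - (u 3 - v 3)
  x * (x + 2 * ((u 0 - v 0) - (u 1 - v 1))) + y * (y + 2 * ((u 2 - v 2) + (u 3 - v 3))) +
    z * (z + 2 * ((u 4 - v 4) + (u 5 - v 5)))

/-- With τ² = τ + 1, a coordinate a + bτ contributes a² + b² to the part free of τ. The six integers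
involved are the entries of u - v rotated in pairs, x ± y, which doubles the squared norm. -/
theorem dist_sq_evv_pt (u v : Fin 6 → ℤ) :
    dist (evv (pt u)) (evv (pt v)) ^ 2 = 2 * distSq6 u v + edgeInt u v * Real.goldenRatio := by
  have h2 := Real.goldenRatio_sq
  rw [dist_sq_E3]
  simp only [evv_zero, evv_one, evv_two, ev, pt, distSq6, edgeInt]
  push_cast
  linear_combination (((u 4 - v 4 : ℝ) - (u 5 - v 5)) ^ 2 + ((u 0 - v 0 : ℝ) + (u 1 - v 1)) ^ 2 +
    ((u 2 - v 2 : ℝ) - (u 3 - v 3)) ^ 2) * h2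

/-- The squared length is 16 or 16 + 16τ = 16τ². -/
theorem dist_evv_pt {u v : Fin 6 → ℤ} (h : distSq6 u v = 8) {b : Bool}
    (hb : edgeInt u v = if b then 16 else 0) : dist (evv (pt u)) (evv (pt v)) = edgeLen 4 b := by
  have hpos := Real.goldenRatio_pos
  have hsq : dist (evv (pt u)) (evv (pt v)) ^ 2 = edgeLen 4 b ^ 2 := by
    rw [dist_sq_evv_pt, edgeLen_sq, h, hb]
    cases b
    · norm_num [ev, sqLen]
    · norm_num [ev, sqLen]
      ring
  have h0 : 0 ≤ edgeLen 4 b := by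
    cases b <;> simp [edgeLen]
    positivity
  exact (pow_left_inj₀ dist_nonneg h0 two_ne_zero).1 hsq

/-- The kind of tile with given edges; the value `6` stands for a plane quadrangle, and `7` for
a pattern that does not occur. -/
def patternKind (b01 b02 b03 b12 b13 b23 : Bool) : ℕ :=
  let f0 := b12.toNat + b13.toNat + b23.toNat
  let f1 := b02.toNat + b03.toNat + b23.toNat
  let f2 := b01.toNat + b03.toNat + b13.toNat
  let f3 := b01.toNat + b02.toNat + b12.toNat
  -- The numbers `f0`, …, `f3` count the long edges of the faces, so their sum is twice the number
  -- of long edges. The product tells how these are placed: three long edges form a triangle (3), a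
  -- star (0) or a path (4).
  match f0 + f1 + f2 + f3, f0 * f1 * f2 * f3 with
  | 2, _ => 0
  | 4, 0 => 1
  | 6, 3 => 2
  | 6, 0 => 3
  | 6, 4 => 6
  | 8, 12 => 4
  | 10, _ => 5
  | _, _ => 7

theorem pattern_of_patternKind : ∀ (k : Fin 6) (b01 b02 b03 b12 b13 b23 : Bool),
    patternKind b01 b02 b03 b12 b13 b23 = k →
      patternFaces b01 b02 b03 b12 b13 b23 = tilePattern k := by
  decide +kernel

/-- Three long edges forming a path are the distances between four vertices of a regular pentagon: a
plane trapezoid. -/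
theorem gram4_of_patternKind : ∀ b01 b02 b03 b12 b13 b23 : Bool,
    patternKind b01 b02 b03 b12 b13 b23 = 6 →
    gram4 (sqLen b01) (sqLen b02) (sqLen b03) (sqLen b12) (sqLen b13) (sqLen b23) = (0, 0) := by
  decide +kernel

/-- The kind of a projected edge: `0` for short, `1` for long edges. -/
def edgeKind (u v : Fin 6 → ℤ) : Option Bool :=
  match edgeInt u v with
  | 0 => some false
  | 16 => some true
  | _ => none

/-- The kind of tile to which a face projects, with the conventions of `patternKind`. -/
def faceKind (q : Fin 4 → Fin 6 → ℤ) : ℕ :=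
  match edgeKind (q 0) (q 1), edgeKind (q 0) (q 2), edgeKind (q 0) (q 3), edgeKind (q 1) (q 2),
    edgeKind (q 1) (q 3), edgeKind (q 2) (q 3) with
  | some b01, some b02, some b03, some b12, some b13, some b23 =>
    patternKind b01 b02 b03 b12 b13 b23
  | _, _, _, _, _, _ => 7

theorem edgeInt_of_edgeKind {u v : Fin 6 → ℤ} {b : Bool} (h : edgeKind u v = some b) :
    edgeInt u v = if b then 16 else 0 := by
  unfold edgeKind at h
  split at h
  · obtain rfl := Option.some_injective _ h
    assumption
  · obtain rfl := Option.some_injective _ h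
    assumption
  · cases h

/-- The lengths of the edges of a projected face of known kind. -/
theorem dist_of_faceKind {q : Fin 4 → Fin 6 → ℤ} {k : ℕ} (hk : k ≠ 7)
    (hq : ∀ i j, i ≠ j → distSq6 (q i) (q j) = 8) (h : faceKind q = k) :
    ∃ b01 b02 b03 b12 b13 b23 : Bool, patternKind b01 b02 b03 b12 b13 b23 = k ∧
      dist (evv (pt (q 0))) (evv (pt (q 1))) = edgeLen 4 b01 ∧
      dist (evv (pt (q 0))) (evv (pt (q 2))) = edgeLen 4 b02 ∧
      dist (evv (pt (q 0))) (evv (pt (q 3))) = edgeLen 4 b03 ∧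
      dist (evv (pt (q 1))) (evv (pt (q 2))) = edgeLen 4 b12 ∧
      dist (evv (pt (q 1))) (evv (pt (q 3))) = edgeLen 4 b13 ∧
      dist (evv (pt (q 2))) (evv (pt (q 3))) = edgeLen 4 b23 := by
  have key : ∀ i j b, i ≠ j → edgeKind (q i) (q j) = some b →
      dist (evv (pt (q i))) (evv (pt (q j))) = edgeLen 4 b := fun i j b hij hb =>
    dist_evv_pt (hq i j hij) (edgeInt_of_edgeKind hb)
  unfold faceKind at h
  split at h
  next b01 b02 b03 b12 b13 b23 h01 h02 h03 h12 h13 h23 =>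
    exact ⟨b01, b02, b03, b12, b13, b23, h, key _ _ _ (by decide) h01, key _ _ _ (by decide) h02,
      key _ _ _ (by decide) h03, key _ _ _ (by decide) h12, key _ _ _ (by decide) h13,
      key _ _ _ (by decide) h23⟩
  · exact absurd h.symm hk

theorem tileVolume_pos (k : Fin 6) : 0 < tileVolume k := by
  have := Real.goldenRatio_pos
  fin_cases k <;> simp [tileVolume] <;> positivity

theorem isTileVertices_of_faceKind {q : Fin 4 → Fin 6 → ℤ} {k : Fin 6}
    (hq : ∀ i j, i ≠ j → distSq6 (q i) (q j) = 8) (h : faceKind q = k) :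
    IsTileVertices 4 k fun m => evv (pt (q m)) := by
  obtain ⟨b01, b02, b03, b12, b13, b23, hk, h01, h02, h03, h12, h13, h23⟩ :=
    dist_of_faceKind (by omega) hq h
  have hp := pattern_of_patternKind k _ _ _ _ _ _ hk
  refine ⟨?_, ?_⟩
  · rw [affineIndependent_iff_det3_ne_zero]
    have hdet := four_mul_det3_sq (v := fun m => evv (pt (q m))) h01 h02 h03 h12 h13 h23
    rw [gram4_of_pattern k _ _ _ _ _ _ hp, ev_zmul, ev_tileVolume12] at hdet
    have hpos := tileVolume_pos k
    intro h0
    rw [h0] at hdet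
    have : 0 < (4 : ℝ) ^ 6 * (12 * tileVolume k * (12 * tileVolume k)) := by positivity
    linarith
  · rw [faces_eq_map (v := fun m => evv (pt (q m))) h01 h02 h03 h12 h13 h23, hp,
      tileFaces_eq_map]

theorem isFlat_projPar_tet_iff_not_affineIndependent (c : V6) (q : Fin 4 → Fin 6 → ℤ) :
    IsFlat (projPar (tet c q)) ↔ ¬ AffineIndependent ℝ fun m => evv (pt (q m)) := by
  rw [IsFlat, projPar_tet, finrank_vectorSpan_image_psi, ptet, vectorSpan_convexHull,
    affineIndependent_iff_not_finrank_vectorSpan_le ℝ _ (n := 2) (by simp), not_not]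

theorem isFlat_projPar_tet_iff (c : V6) {q : Fin 4 → Fin 6 → ℤ}
    (hq : ∀ i j, i ≠ j → distSq6 (q i) (q j) = 8) (h : faceKind q ≤ 6) :
    IsFlat (projPar (tet c q)) ↔ faceKind q = 6 := by
  rw [isFlat_projPar_tet_iff_not_affineIndependent]
  constructor
  · intro hn
    by_contra h6
    exact hn (isTileVertices_of_faceKind (k := ⟨faceKind q, by omega⟩) hq rfl).1
  · intro h6
    obtain ⟨b01, b02, b03, b12, b13, b23, hk, h01, h02, h03, h12, h13, h23⟩ :=
      dist_of_faceKind (by omega) hq h6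
    have hdet := four_mul_det3_sq (v := fun m => evv (pt (q m))) h01 h02 h03 h12 h13 h23
    rw [gram4_of_patternKind _ _ _ _ _ _ hk] at hdet
    rw [affineIndependent_iff_det3_ne_zero, not_not]
    simpa [ev] using hdet

/-- Tiles of edge lengths `4` and `4 τ` are taken by `psi` to tiles. -/
theorem IsTileVertices.psi (c : V6) {r : ℝ} {k : Fin 6} {v : Fin 4 → E3}
    (h : IsTileVertices r k v) : IsTileVertices (unitLen / 4 * r) k fun m => psi c (v m) := by
  have hu : 0 < unitLen / 4 := by have := unitLen_pos; positivity
  refine ⟨h.1.map' (_root_.psi c) (psi_injective c), ?_⟩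
  have h2 := congrArg (Multiset.map (Multiset.map fun x => unitLen / 4 * x)) h.2
  have h3 : (tileFaces r k).map (Multiset.map fun x => unitLen / 4 * x) =
      tileFaces (unitLen / 4 * r) k := by
    fin_cases k <;> simp [tileFaces, Multiset.insert_eq_cons, mul_assoc]
  rw [h3] at h2
  rw [← h2]
  simp [faceEdges, dist_psi, Multiset.insert_eq_cons]

theorem isTile_projPar_tet (c : V6) {q : Fin 4 → Fin 6 → ℤ} {k : Fin 6}
    (hq : ∀ i j, i ≠ j → distSq6 (q i) (q j) = 8) (h : faceKind q = k) :
    IsTile unitLen k (projPar (tet c q)) := by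
  have := (isTileVertices_of_faceKind hq h).psi c
  rw [div_mul_cancel₀ _ (by norm_num : (4 : ℝ) ≠ 0)] at this
  refine ⟨_, this, ?_⟩
  rw [projPar_tet, ptet, AffineMap.image_convexHull, ← Set.range_comp]
  rfl

/-! ### The projections of all faces of a cell -/

/-- The faces given by `L` project to plane figures, exactly `n` times, and to tiles of all
kinds in `ks`. -/
def checkKinds (L : List (Fin 4 → Fin 6 → ℤ)) (ks : List ℕ) (n : ℕ) : Prop :=
  (L.map faceKind).all (fun m => (6 :: ks).any (Nat.beq m)) = true ∧
    (L.map faceKind).countP (Nat.beq 6) = n ∧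
    ks.all (fun k => (L.map faceKind).any (Nat.beq k)) = true

instance (L : List (Fin 4 → Fin 6 → ℤ)) (ks : List ℕ) (n : ℕ) : Decidable (checkKinds L ks n) :=
  inferInstanceAs (Decidable (_ ∧ _ ∧ _))

theorem checkKinds_crossFaces : checkKinds crossFaces [0, 1, 4, 5] 60 := by decide +kernel

theorem checkKinds_hemiFaces_one : checkKinds (hemiFaces 1) [0, 1, 2, 3, 4, 5] 120 := by
  decide +kernel

theorem checkKinds_hemiFaces_neg_one : checkKinds (hemiFaces (-1)) [0, 1, 2, 3, 4, 5] 120 := by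
  decide +kernel

theorem IsFaceList.projections {S : Set (Fin 6 → ℤ)} {L : List (Fin 4 → Fin 6 → ℤ)}
    (h : IsFaceList S L) (hL : nodupMask (L.map faceCode) 0 = true) (c : V6) (ks : List (Fin 6))
    (n : ℕ) (hc : checkKinds L (ks.map Fin.val) n) :
    (∀ F ∈ threeFaces (convexHull ℝ (emb c '' S)), IsFlat (projPar F) ∨
      ∃ k ∈ ks, IsTile unitLen k (projPar F)) ∧
    (∀ k ∈ ks, ∃ F ∈ threeFaces (convexHull ℝ (emb c '' S)), IsTile unitLen k (projPar F)) ∧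
    {F | F ∈ threeFaces (convexHull ℝ (emb c '' S)) ∧ IsFlat (projPar F)}.ncard = n := by
  obtain ⟨h1, h2, h3⟩ := hc
  simp only [List.all_map, List.all_eq_true, Function.comp_apply, List.any_eq_true,
    List.mem_cons, Nat.beq_eq, exists_eq_or_imp, List.mem_map, exists_exists_and_eq_and] at h1
  simp only [List.all_map, List.all_eq_true, Function.comp_apply, List.any_map, List.any_eq_true,
    Nat.beq_eq] at h3
  have hflat : ∀ q ∈ L, IsFlat (projPar (tet c q)) ↔ faceKind q = 6 := fun q hq =>
    isFlat_projPar_tet_iff c (h.equidistant q hq) (by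
      rcases h1 q hq with h | ⟨k, -, h⟩ <;> omega)
  refine ⟨fun F hF => ?_, fun k hk => ?_, ?_⟩
  · obtain ⟨q, hq, rfl⟩ := (h.mem_threeFaces_iff c F).1 hF
    rcases h1 q hq with h6 | ⟨k, hk, hqk⟩
    · exact Or.inl ((hflat q hq).2 h6)
    · exact Or.inr ⟨k, hk, isTile_projPar_tet c (h.equidistant q hq) hqk⟩
  · obtain ⟨q, hq, hqk⟩ := h3 k hk
    exact ⟨_, (h.mem_threeFaces_iff c _).2 ⟨q, hq, rfl⟩,
      isTile_projPar_tet c (h.equidistant q hq) hqk.symm⟩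
  · rw [h.ncard_filter hL c (fun F => IsFlat (projPar F)) (fun q => Nat.beq 6 (faceKind q))
      fun q hq => by rw [hflat q hq, Nat.beq_eq, eq_comm], ← h2, List.countP_map,
      List.countP_eq_length_filter]
    rfl

/-! ### Dissections -/

open MeasureTheory in
/-- Convex bodies with disjoint interiors that are contained in a convex body and have at least its
volume, cover it. -/
theorem iUnion_eq_of_volume_le {ι : Type*} [Fintype ι] {T : ι → Set E3} {P : Set E3}
    (hP : Convex ℝ P) (hPc : IsCompact P) (hT : ∀ i, Convex ℝ (T i)) (hTc : ∀ i, IsCompact (T i))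
    (hsub : ∀ i, T i ⊆ P) (hdisj : Pairwise fun i j => Disjoint (interior (T i)) (interior (T j)))
    (hvol : volume P ≤ ∑ i, volume (T i)) (hpos : ∑ i, volume (T i) ≠ 0) : ⋃ i, T i = P := by
  have hclosed : IsClosed (⋃ i, T i) := isClosed_iUnion_of_finite fun i => (hTc i).isClosed
  have hU : ⋃ i, T i ⊆ P := Set.iUnion_subset hsub
  refine hU.antisymm ?_
  -- Boundaries of convex sets are null sets, so disjoint interiors suffice for additivity.
  have hvU : volume (⋃ i, T i) = ∑ i, volume (T i) := by
    rw [measure_iUnion₀ (fun i j hij => ?_) fun i =>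
      (hTc i).isClosed.measurableSet.nullMeasurableSet, tsum_fintype]
    exact AEDisjoint.congr (hdisj hij).aedisjoint
      (interior_ae_eq_of_null_frontier ((hT i).addHaar_frontier volume)).symm
      (interior_ae_eq_of_null_frontier ((hT j).addHaar_frontier volume)).symm
  have hdiff : volume (P \ ⋃ i, T i) = 0 := by
    rw [measure_sdiff hU hclosed.measurableSet.nullMeasurableSet
      (ne_top_of_le_ne_top hPc.measure_lt_top.ne (measure_mono hU)), hvU]
    exact tsub_eq_zero_of_le hvol
  -- Otherwise `P` would be contained in its null boundary, against `hpos`.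
  have hne : (interior P).Nonempty := by
    by_contra h
    rw [Set.not_nonempty_iff_eq_empty] at h
    have h0 : volume P = 0 := by
      refine measure_mono_null (fun x hx => ?_) (hP.addHaar_frontier volume)
      rw [frontier, h, Set.sdiff_empty]
      exact subset_closure hx
    exact hpos (hvU ▸ measure_mono_null hU h0)
  -- An uncovered part of the interior would be open and of measure zero. A convex set with interior
  -- points lies in the closure of its interior, so the closed union contains all of `P`.
  have hint : interior P \ ⋃ i, T i = ∅ :=
    ((isOpen_interior.sdiff hclosed).measure_eq_zero_iff volume).1
      (measure_mono_null (Set.sdiff_subset_sdiff_left interior_subset) hdiff)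
  calc P ⊆ closure P := subset_closure
    _ = closure (interior P) := (hP.closure_interior_eq_closure_of_nonempty_interior hne).symm
    _ ⊆ ⋃ i, T i := hclosed.closure_subset_iff.2 (Set.sdiff_eq_empty.1 hint)

/-- Normal vectors of planes that separate tiles. -/
def normals : List ZVec :=
  -- These are the six five-fold axes and then the ten three-fold axes of the icosahedron. The edges
  -- of the tiles are parallel to two-fold axes, so the golden triangles are perpendicular to
  -- five-fold axes and the equilateral ones to three-fold axes.
  [((1, 0), (0, 1), (0, 0)), ((-1, 0), (0, 1), (0, 0)), ((0, 0), (1, 0), (0, 1)),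
   ((0, 0), (1, 0), (0, -1)), ((0, 1), (0, 0), (1, 0)), ((0, 1), (0, 0), (-1, 0)),
   ((1, 0), (1, 0), (1, 0)), ((1, 0), (1, 0), (-1, 0)), ((1, 0), (-1, 0), (1, 0)),
   ((-1, 0), (1, 0), (1, 0)), ((0, 0), (1, 1), (1, 0)), ((0, 0), (1, 1), (-1, 0)),
   ((1, 0), (0, 0), (1, 1)), ((-1, 0), (0, 0), (1, 1)), ((1, 1), (1, 0), (0, 0)),
   ((1, 1), (-1, 0), (0, 0))]

theorem evv_ne_zero_of_mem_normals {n : ZVec} (hn : n ∈ normals) : evv n ≠ 0 := by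
  have : n ≠ ((0, 0), (0, 0), (0, 0)) := by
    rintro rfl
    revert hn
    decide
  intro h
  have h0 : ∀ j, evv n j = 0 := fun j => by rw [h]; rfl
  have e0 := (ev_eq_zero_iff _).1 (h0 0)
  have e1 := (ev_eq_zero_iff _).1 (h0 1)
  have e2 := (ev_eq_zero_iff _).1 (h0 2)
  exact this (Prod.ext e0 (Prod.ext e1 e2))

def zmax (x y : ℤ × ℤ) : ℤ × ℤ := bif znonneg (zsub x y) then x else y

def zmin (x y : ℤ × ℤ) : ℤ × ℤ := bif znonneg (zsub x y) then y else x

theorem ev_zmax (x y : ℤ × ℤ) : ev (zmax x y) = max (ev x) (ev y) := by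
  rw [zmax]
  rcases h : znonneg (zsub x y)
  · have := ev_nonpos_of_not_znonneg h
    rw [ev_zsub] at this
    rw [cond_false, max_eq_right (by linarith)]
  · have := ev_nonneg_of_znonneg h
    rw [ev_zsub] at this
    rw [cond_true, max_eq_left (by linarith)]

theorem ev_zmin (x y : ℤ × ℤ) : ev (zmin x y) = min (ev x) (ev y) := by
  rw [zmin]
  rcases h : znonneg (zsub x y)
  · have := ev_nonpos_of_not_znonneg h
    rw [ev_zsub] at this
    rw [cond_false, min_eq_left (by linarith)]
  · have := ev_nonneg_of_znonneg h
    rw [ev_zsub] at this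
    rw [cond_true, min_eq_right (by linarith)]

/-- The maximum of the direction `n` on the projection of the face `q`. -/
def upper (n : ZVec) (q : Fin 4 → Fin 6 → ℤ) : ℤ × ℤ :=
  zmax (zmax (vdot n (pt (q 0))) (vdot n (pt (q 1))))
    (zmax (vdot n (pt (q 2))) (vdot n (pt (q 3))))

/-- The minimum of the direction `n` on the projection of the face `q`. -/
def lower (n : ZVec) (q : Fin 4 → Fin 6 → ℤ) : ℤ × ℤ :=
  zmin (zmin (vdot n (pt (q 0))) (vdot n (pt (q 1))))
    (zmin (vdot n (pt (q 2))) (vdot n (pt (q 3))))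

theorem ev_vdot_le_upper (n : ZVec) (q : Fin 4 → Fin 6 → ℤ) (i : Fin 4) :
    ev (vdot n (pt (q i))) ≤ ev (upper n q) := by
  simp only [upper, ev_zmax]
  fin_cases i <;> simp

theorem lower_le_ev_vdot (n : ZVec) (q : Fin 4 → Fin 6 → ℤ) (i : Fin 4) :
    ev (lower n q) ≤ ev (vdot n (pt (q i))) := by
  simp only [lower, ev_zmin]
  fin_cases i <;> simp

/-- The face `q` projects below the face `r`, in the direction of `n`. -/
def below (n : ZVec) (q r : Fin 4 → Fin 6 → ℤ) : Bool := znonneg (zsub (lower n r) (upper n q))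

/-- The projections of two faces are separated by a plane. -/
def separated (q r : Fin 4 → Fin 6 → ℤ) : Bool :=
  normals.any fun n => below n q r || below n r q

theorem inner_evv (n u : ZVec) : inner ℝ (evv n) (evv u) = ev (vdot n u) := by
  rw [ev_vdot, PiLp.inner_apply, Fin.sum_univ_three]
  simp only [RCLike.inner_apply, conj_trivial]
  ring

theorem inner_le_of_below {n : ZVec} {q r : Fin 4 → Fin 6 → ℤ} (h : below n q r = true) :
    ∀ x ∈ ptet q, ∀ y ∈ ptet r, inner ℝ (evv n) x ≤ inner ℝ (evv n) y := by
  have hl : IsLinearMap ℝ fun x : E3 => inner ℝ (evv n) x :=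
    ⟨fun x y => inner_add_right _ _ _, fun a x => real_inner_smul_right _ _ _⟩
  intro x hx y hy
  refine convexHull_min ?_ (convex_halfSpace_ge hl _) hy
  rintro _ ⟨j, rfl⟩
  refine convexHull_min ?_ (convex_halfSpace_le hl _) hx
  rintro _ ⟨i, rfl⟩
  have h1 := ev_nonneg_of_znonneg h
  have h2 := ev_vdot_le_upper n q i
  have h3 := lower_le_ev_vdot n r j
  rw [ev_zsub] at h1
  change inner ℝ (evv n) (evv _) ≤ inner ℝ (evv n) (evv _)
  rw [inner_evv, inner_evv]
  linarith

/-- The functional is constant on the common interior, but a nonzero functional is an open map, and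
a single real number is not an open set. -/
theorem disjoint_interior_of_inner_le {n : E3} (hn : n ≠ 0) {A B : Set E3}
    (h : ∀ x ∈ A, ∀ y ∈ B, inner ℝ n x ≤ inner ℝ n y) : Disjoint (interior A) (interior B) := by
  rw [Set.disjoint_iff_inter_eq_empty, ← Set.not_nonempty_iff_eq_empty]
  rintro ⟨x, hx⟩
  have hf : innerSL ℝ n ≠ 0 := fun h0 => hn (by
    have := congrArg (fun f => f n) h0
    simpa using this)
  have hopen := (innerSL ℝ n).isOpenMap_of_ne_zero hf _ (isOpen_interior (s := A).inter
    (isOpen_interior (s := B)))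
  have himg : innerSL ℝ n '' (interior A ∩ interior B) = {inner ℝ n x} := by
    refine Set.eq_singleton_iff_unique_mem.2 ⟨⟨x, hx, rfl⟩, ?_⟩
    rintro _ ⟨y, hy, rfl⟩
    exact le_antisymm (h y (interior_subset hy.1) x (interior_subset hx.2))
      (h x (interior_subset hx.1) y (interior_subset hy.2))
  rw [himg] at hopen
  exact not_isOpen_singleton _ hopen

theorem disjoint_interior_of_separated {q r : Fin 4 → Fin 6 → ℤ} (h : separated q r = true) :
    Disjoint (interior (ptet q)) (interior (ptet r)) := by
  obtain ⟨n, hn, h⟩ := List.any_eq_true.1 h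
  have h0 := evv_ne_zero_of_mem_normals hn
  rcases Bool.or_eq_true _ _ ▸ h with h | h
  · exact disjoint_interior_of_inner_le h0 (inner_le_of_below h)
  · exact (disjoint_interior_of_inner_le h0 (inner_le_of_below h)).symm

/-- A check that the faces `F` project to `n k` tiles of the kind `k`, with disjoint interiors. -/
def checkDissection (F : List (Fin 4 → Fin 6 → ℤ)) (n : Fin 6 → ℕ) : Prop :=
  F.Pairwise (fun q r => separated q r = true) ∧
    ∀ k : Fin 6, (F.filter fun q => Nat.beq k.val (faceKind q)).length = n k

instance (F : List (Fin 4 → Fin 6 → ℤ)) (n : Fin 6 → ℕ) : Decidable (checkDissection F n) :=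
  inferInstanceAs (Decidable (_ ∧ _))

-- An upper bound `hvol` for the volume of the solid suffices: disjointness comes from the
-- separating planes, containment from the vertices, and then covering from
-- `iUnion_eq_of_volume_le`.
open MeasureTheory in
theorem IsFaceList.isDissected {S : Set (Fin 6 → ℤ)} {L : List (Fin 4 → Fin 6 → ℤ)}
    (h : IsFaceList S L) (c : V6) (l : List ℕ) {n : Fin 6 → ℕ}
    (hF : checkDissection (l.filterMap fun i => L[i]?) n) (hn : n 0 ≠ 0)
    (hvol : volume (convexHull ℝ ((fun v => evv (pt v)) '' S)) ≤
      ENNReal.ofReal (∑ k, n k * (4 ^ 3 * tileVolume k))) :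
    IsDissected unitLen n (projPar '' threeFaces (convexHull ℝ (emb c '' S)))
      (projPar (convexHull ℝ (emb c '' S))) := by
  -- A position out of range would silently disappear here, but the counts in `hF` fix how many
  -- tiles of each kind remain.
  set F := l.filterMap fun i => L[i]? with hFdef
  obtain ⟨hsep, hcount⟩ := hF
  have hFL : ∀ q ∈ F, q ∈ L := fun q hq => by
    obtain ⟨i, -, hi⟩ := List.mem_filterMap.1 hq
    exact List.mem_of_getElem? hi
  let G (k : Fin 6) := F.filter fun q => Nat.beq k.val (faceKind q)
  have hG : ∀ k, (G k).length = n k := hcount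
  let q (j : Σ k : Fin 6, Fin (n k)) := (G j.1).get (j.2.cast (hG j.1).symm)
  have hqG : ∀ j, q j ∈ G j.1 := fun j => List.get_mem _ _
  have hqF : ∀ j, q j ∈ F := fun j => (List.mem_filter.1 (hqG j)).1
  have hqk : ∀ j, faceKind (q j) = j.1.val := fun j =>
    (Nat.eq_of_beq_eq_true (List.mem_filter.1 (hqG j)).2).symm
  have hqe : ∀ j i i', i ≠ i' → distSq6 (q j i) (q j i') = 8 := fun j =>
    h.equidistant _ (hFL _ (hqF j))
  have hR : F.Pairwise fun a b => Disjoint (interior (ptet a)) (interior (ptet b)) :=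
    hsep.imp disjoint_interior_of_separated
  have hdisj : Pairwise fun i j => Disjoint (interior (ptet (q i))) (interior (ptet (q j))) := by
    rintro ⟨k, i⟩ ⟨k', i'⟩ hij
    by_cases hk : k = k'
    · subst hk
      have hi : i ≠ i' := fun e => hij (by rw [e])
      have hp := List.pairwise_iff_get.1 (hR.filter fun q => Nat.beq k.val (faceKind q))
      rcases lt_or_gt_of_ne hi with hlt | hlt
      · exact hp (i.cast (hG k).symm) (i'.cast (hG k).symm) hlt
      · exact (hp (i'.cast (hG k).symm) (i.cast (hG k).symm) hlt).symm
    · have : Std.Symm fun a b : Fin 4 → Fin 6 → ℤ =>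
          Disjoint (interior (ptet a)) (interior (ptet b)) := ⟨fun _ _ h => h.symm⟩
      refine hR.forall (hqF _) (hqF _) fun e => hk (Fin.ext ?_)
      rw [← hqk ⟨k, i⟩, ← hqk ⟨k', i'⟩, e]
  have htile : ∀ j, IsTileVertices 4 j.1 fun m => evv (pt (q j m)) := fun j =>
    isTileVertices_of_faceKind (hqe j) (hqk j)
  have hv : ∀ j, volume (ptet (q j)) = ENNReal.ofReal (4 ^ 3 * tileVolume j.1) := fun j => by
    rw [ptet, volume_convexHull_range_four,
      abs_det3_of_isTileVertices (by norm_num) (htile j)]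
  have hnn : ∀ k, 0 ≤ 4 ^ 3 * tileVolume k := fun k => by
    have := tileVolume_pos k
    positivity
  have hsum : ∑ j, volume (ptet (q j)) = ENNReal.ofReal (∑ k, n k * (4 ^ 3 * tileVolume k)) := by
    rw [ENNReal.ofReal_sum_of_nonneg fun k _ => mul_nonneg (Nat.cast_nonneg _) (hnn k),
      Fintype.sum_sigma]
    refine Finset.sum_congr rfl fun k _ => ?_
    simp only [hv, Finset.sum_const, Finset.card_univ, Fintype.card_fin, nsmul_eq_mul]
    rw [ENNReal.ofReal_mul (Nat.cast_nonneg _), ENNReal.ofReal_natCast]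
  have hrange : ∀ j, ∀ m, q j m ∈ S := fun j m => by
    obtain ⟨a, ha⟩ := h.exposed _ (hFL _ (hqF j))
    have : q j m ∈ argmaxSet S (lin a) := ha ▸ Set.mem_range_self m
    exact this.1
  have hunion : ⋃ j, ptet (q j) = convexHull ℝ ((fun v => evv (pt v)) '' S) := by
    refine iUnion_eq_of_volume_le (convex_convexHull ℝ _)
      ((h.finite.image _).isCompact_convexHull ℝ) (fun _ => convex_convexHull ℝ _)
      (fun _ => (Set.finite_range _).isCompact_convexHull ℝ)
      (fun j => convexHull_mono ?_) hdisj (hsum ▸ hvol) ?_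
    · rintro _ ⟨m, rfl⟩
      exact ⟨_, hrange j m, rfl⟩
    · intro h0
      have := (Finset.sum_eq_zero_iff.1 h0) ⟨0, ⟨0, Nat.pos_of_ne_zero hn⟩⟩ (Finset.mem_univ _)
      rw [hv, ENNReal.ofReal_eq_zero] at this
      have := tileVolume_pos 0
      linarith
  refine ⟨fun j => projPar (tet c (q j)), fun j => ⟨isTile_projPar_tet c (hqe j) (hqk j), ?_⟩,
    fun i j hij => ?_, ?_⟩
  · exact ⟨_, (h.mem_threeFaces_iff c _).2 ⟨_, hFL _ (hqF j), rfl⟩, rfl⟩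
  · change Disjoint (interior (projPar _)) (interior (projPar _))
    rw [projPar_tet, projPar_tet, interior_image_psi, interior_image_psi]
    exact (Set.disjoint_image_iff (psi_injective c)).2 (hdisj hij)
  · rw [projPar_convexHull_image, ← hunion, Set.image_iUnion]
    simp only [projPar_tet]

/-- Positions of the tiles of the icosahedron of edge length `1` in `crossFaces`. -/
def tilesOmega1 : List ℕ := [0, 47, 54, 57, 68, 69, 70, 76, 78, 85, 90, 98, 109, 114, 125, 176]

/-- Positions of the tiles of the icosahedron of edge length `τ` in `hemiFaces (-1)`. -/
def tilesOmega5 : List ℕ :=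
  [8, 9, 23, 25, 43, 46, 51, 70, 79, 88, 100, 151, 154, 157, 192, 194, 200, 204, 216, 227, 229,
   233, 255, 271, 319, 397, 404, 464, 490, 493, 505, 506, 524, 525, 546, 548, 564, 565, 575, 591,
   593, 596, 598, 622, 623, 630, 632, 639]

/-- Positions of the tiles of the dodecahedron of edge length `1` in `hemiFaces 1`. -/
def tilesOmega6 : List ℕ :=
  [16, 41, 62, 68, 88, 90, 97, 199, 212, 228, 230, 243, 375, 381, 393, 420, 472, 473, 480, 481,
   482, 487, 497, 498, 524, 526, 546, 550, 553, 557, 561, 586, 587, 597, 598, 599, 610, 613]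

theorem checkDissection_omega1 :
    checkDissection (tilesOmega1.filterMap fun i => crossFaces[i]?) ![7, 6, 0, 0, 2, 1] := by
  decide +kernel

theorem checkDissection_omega5 :
    checkDissection (tilesOmega5.filterMap fun i => (hemiFaces (-1))[i]?)
      ![1, 8, 10, 10, 16, 3] := by
  decide +kernel

theorem checkDissection_omega6 :
    checkDissection (tilesOmega6.filterMap fun i => (hemiFaces 1)[i]?) ![3, 4, 10, 10, 4, 7] := by
  decide +kernel

/-! ### The volumes of the icosahedron and of the dodecahedron -/

/-- The tetrahedron with a vertex at the origin. -/
def cone3 (u v w : E3) : Set E3 := convexHull ℝ (Set.range ![0, u, v, w])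

theorem mem_cone3 {u v w x : E3} {a b c : ℝ} (ha : 0 ≤ a) (hb : 0 ≤ b) (hc : 0 ≤ c)
    (habc : a + b + c ≤ 1) (hx : ∀ i, x i = a * u i + b * v i + c * w i) : x ∈ cone3 u v w := by
  have hx' : x =
      ∑ i, (![1 - (a + b + c), a, b, c] : Fin 4 → ℝ) i • (![0, u, v, w] : Fin 4 → E3) i := by
    ext j
    simp [Fin.sum_univ_four, hx]
  rw [hx']
  refine (convex_convexHull ℝ _).sum_mem (fun i _ => ?_) ?_ fun i _ =>
    subset_convexHull ℝ _ (Set.mem_range_self i)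
  · fin_cases i
    · simpa using habc
    · exact ha
    · exact hb
    · exact hc
  · simp only [Fin.sum_univ_four, Matrix.cons_val]
    ring

open MeasureTheory in
theorem volume_cone3 (u v w : E3) :
    volume (cone3 u v w) = ENNReal.ofReal (|det3 u v w| / 6) := by
  rw [cone3, volume_convexHull_range_four]
  simp

/-- The vector of the absolute values of the coordinates. -/
def abs3 (x : E3) : E3 := !₂[|x 0|, |x 1|, |x 2|]

-- The eight images of `Q` under sign changes of the coordinates cover `P` and have equal volume.
open MeasureTheory in
theorem volume_le_of_abs3_mem {P Q : Set E3} (h : ∀ x ∈ P, abs3 x ∈ Q) :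
    volume P ≤ 8 * volume Q := by
  let e (σ : Fin 3 → Bool) : E3 ≃ₗᵢ[ℝ] E3 :=
    LinearIsometryEquiv.piLpCongrRight 2 fun i =>
      if σ i then LinearIsometryEquiv.neg ℝ else LinearIsometryEquiv.refl ℝ ℝ
  have hsub : P ⊆ ⋃ σ, e σ ⁻¹' Q := by
    intro x hx
    refine Set.mem_iUnion.2 ⟨fun i => decide (x i < 0), ?_⟩
    have : e (fun i => decide (x i < 0)) x = abs3 x := by
      ext i
      have : e (fun i => decide (x i < 0)) x i = |x i| := by
        change (if decide (x i < 0) then LinearIsometryEquiv.neg ℝ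
          else LinearIsometryEquiv.refl ℝ ℝ) (x i) = |x i|
        by_cases hi : x i < 0
        · simp [hi, abs_of_neg hi]
        · simp [hi, abs_of_nonneg (not_lt.1 hi)]
      rw [this]
      fin_cases i <;> rfl
    rw [Set.mem_preimage, this]
    exact h x hx
  calc volume P ≤ ∑ σ, volume (e σ ⁻¹' Q) :=
        (measure_mono hsub).trans (measure_iUnion_fintype_le _ _)
    _ = ∑ _σ : Fin 3 → Bool, volume Q := Finset.sum_congr rfl fun σ _ =>
        (e σ).measurePreserving.measure_preimage_equiv (f := (e σ).toMeasurableEquiv) Q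
    _ = 8 * volume Q := by simp

theorem convex_weighted_abs {p q r : ℝ} (hp : 0 ≤ p) (hq : 0 ≤ q) (hr : 0 ≤ r) (d : ℝ) :
    Convex ℝ {x : E3 | p * |x 0| + q * |x 1| + r * |x 2| ≤ d} := by
  have hc : ∀ i, ConvexOn ℝ Set.univ fun x : E3 => |x i| := fun i => by
    have := (convexOn_univ_norm (E := ℝ)).comp_linearMap
      (EuclideanSpace.proj i : E3 →L[ℝ] ℝ).toLinearMap
    exact this
  have := (((hc 0).smul hp).add ((hc 1).smul hq)).add ((hc 2).smul hr)
  simpa using this.convex_le d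


/-- The hypotheses `h1` to `h4` are facet inequalities. The octant of the icosahedron is the union
of the cones over one whole facet and over three facets halved by a coordinate plane; (0, 0, τ) and
its cyclic images are midpoints of edges. -/
theorem icosahedron_octant {x : E3} (h0 : ∀ i, 0 ≤ x i)
    (h1 : x 0 + x 1 + x 2 ≤ Real.goldenRatio + 1)
    (h2 : x 0 + (Real.goldenRatio + 1) * x 2 ≤ 2 * Real.goldenRatio + 1)
    (h3 : x 1 + (Real.goldenRatio + 1) * x 0 ≤ 2 * Real.goldenRatio + 1)
    (h4 : x 2 + (Real.goldenRatio + 1) * x 1 ≤ 2 * Real.goldenRatio + 1) :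
    x ∈ cone3 !₂[0, 1, Real.goldenRatio] !₂[Real.goldenRatio, 0, 1] !₂[1, Real.goldenRatio, 0] ∪
      (cone3 !₂[0, 1, Real.goldenRatio] !₂[Real.goldenRatio, 0, 1] !₂[0, 0, Real.goldenRatio] ∪
      (cone3 !₂[Real.goldenRatio, 0, 1] !₂[1, Real.goldenRatio, 0] !₂[Real.goldenRatio, 0, 0] ∪
      cone3 !₂[1, Real.goldenRatio, 0] !₂[0, 1, Real.goldenRatio] !₂[0, Real.goldenRatio, 0])) := by
  have ht := Real.goldenRatio_sq
  have ht1 := Real.one_lt_goldenRatio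
  have ht2 := Real.goldenRatio_lt_two
  generalize Real.goldenRatio = t at *
  have h00 := h0 0
  have h01 := h0 1
  have h02 := h0 2
  have ht3 : 0 ≤ 2 * t - 3 := by nlinarith
  have ht4 : 0 ≤ t - 1 := by linarith
  have ht5 : 0 ≤ 2 - t := by linarith
  by_cases c1 : t * x 1 + (t - 1) * x 0 ≤ x 2
  · refine Or.inr (Or.inl (mem_cone3 h01 (mul_nonneg ht4 h00)
      (mul_nonneg ht4 (sub_nonneg.2 c1)) ?_ fun i => ?_))
    -- Here 2τ - 3 = τ⁻³ is the reciprocal of the bound 2τ + 1 = τ³ in the facet inequality.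
    · linear_combination (2 * t - 3) * h2 + (-x 1 - x 0 - 2 * x 2 + 4) * ht
    · fin_cases i <;> simp <;> grind
  by_cases c2 : t * x 2 + (t - 1) * x 1 ≤ x 0
  · refine Or.inr (Or.inr (Or.inl (mem_cone3 h02 (mul_nonneg ht4 h01)
      (mul_nonneg ht4 (sub_nonneg.2 c2)) ?_ fun i => ?_)))
    · linear_combination (2 * t - 3) * h3 + (-x 2 - x 1 - 2 * x 0 + 4) * ht
    · fin_cases i <;> simp <;> grind
  by_cases c3 : t * x 0 + (t - 1) * x 2 ≤ x 1
  · refine Or.inr (Or.inr (Or.inr (mem_cone3 h00 (mul_nonneg ht4 h02)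
      (mul_nonneg ht4 (sub_nonneg.2 c3)) ?_ fun i => ?_)))
    · linear_combination (2 * t - 3) * h4 + (-x 0 - x 2 - 2 * x 1 + 4) * ht
    · fin_cases i <;> simp <;> grind
  push Not at c1 c2 c3
  -- The coordinates in the central cone come from solving the linear system, with (t - 1)/2 =
  -- 1/(2τ). They are positive exactly because the other three cases fail.
  refine Or.inl (mem_cone3 (a := (t - 1) / 2 * (t * x 2 + (t - 1) * x 1 - x 0))
    (b := (t - 1) / 2 * (t * x 0 + (t - 1) * x 2 - x 1))
    (c := (t - 1) / 2 * (t * x 1 + (t - 1) * x 0 - x 2)) ?_ ?_ ?_ ?_ fun i => ?_)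
  · exact mul_nonneg (by linarith) (by linarith)
  · exact mul_nonneg (by linarith) (by linarith)
  · exact mul_nonneg (by linarith) (by linarith)
  · linear_combination (2 - t) * h1 + (x 0 + x 1 + x 2 - 1) * ht
  · fin_cases i <;> simp <;> grind

/-- This concerns the pentagon with normal (1, τ, 0), in the region where its functional is the
largest of three. The plane z = 0 halves the pentagon; the half is a quadrilateral, cut into two
triangles by the diagonal from the edge midpoint (0, τ, 0) to (1, 1, 1), that is, by x = z. -/
theorem dodecahedron_facet {x y z : ℝ} (hx : 0 ≤ x) (hy : 0 ≤ y) (hz : 0 ≤ z)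
    (h : x + Real.goldenRatio * y ≤ Real.goldenRatio + 1)
    (h1 : y + Real.goldenRatio * z ≤ x + Real.goldenRatio * y)
    (h2 : z + Real.goldenRatio * x ≤ x + Real.goldenRatio * y) :
    (∃ a b c : ℝ, 0 ≤ a ∧ 0 ≤ b ∧ 0 ≤ c ∧ a + b + c ≤ 1 ∧ x = c ∧
      y = a * Real.goldenRatio + b * Real.goldenRatio + c ∧ z = b * (Real.goldenRatio - 1) + c) ∨
    ∃ a b c : ℝ, 0 ≤ a ∧ 0 ≤ b ∧ 0 ≤ c ∧ a + b + c ≤ 1 ∧ x = b + c * Real.goldenRatio ∧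
      y = a * Real.goldenRatio + b + c * (Real.goldenRatio - 1) ∧ z = b := by
  have ht := Real.goldenRatio_sq
  have ht1 := Real.one_lt_goldenRatio
  have ht2 := Real.goldenRatio_lt_two
  generalize Real.goldenRatio = t at *
  have ht4 : 0 ≤ t - 1 := by linarith
  have ht5 : 0 ≤ 2 - t := by linarith
  rcases le_total x z with hxz | hxz
  · refine Or.inl ⟨(t - 1) * ((y - x) - (t + 1) * (z - x)), t * (z - x), x, mul_nonneg ht4 ?_,
      mul_nonneg (by linarith) (by linarith), hx, ?_, rfl, ?_, ?_⟩
    · nlinarith [mul_nonneg (by linarith : 0 ≤ t) (sub_nonneg.2 h1)]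
    · nlinarith [mul_nonneg ht5 (sub_nonneg.2 h)]
    · grind
    · grind
  · refine Or.inr ⟨(t - 1) * ((y - z) - (2 - t) * (x - z)), z, (t - 1) * (x - z), mul_nonneg ht4 ?_,
      hz, mul_nonneg (by linarith) (by linarith), ?_, ?_, ?_, rfl⟩
    · nlinarith [mul_nonneg ht4 (sub_nonneg.2 h2)]
    · nlinarith [mul_nonneg ht5 (sub_nonneg.2 h)]
    · grind
    · grind

theorem dodecahedron_octant {x : E3} (h0 : ∀ i, 0 ≤ x i)
    (h1 : x 0 + Real.goldenRatio * x 1 ≤ Real.goldenRatio + 1)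
    (h2 : x 1 + Real.goldenRatio * x 2 ≤ Real.goldenRatio + 1)
    (h3 : x 2 + Real.goldenRatio * x 0 ≤ Real.goldenRatio + 1) :
    x ∈ (cone3 !₂[0, Real.goldenRatio, 0] !₂[0, Real.goldenRatio, Real.goldenRatio - 1]
          !₂[1, 1, 1] ∪
        cone3 !₂[0, Real.goldenRatio, 0] !₂[1, 1, 1]
          !₂[Real.goldenRatio, Real.goldenRatio - 1, 0]) ∪
      ((cone3 !₂[0, 0, Real.goldenRatio] !₂[Real.goldenRatio - 1, 0, Real.goldenRatio]
          !₂[1, 1, 1] ∪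
        cone3 !₂[0, 0, Real.goldenRatio] !₂[1, 1, 1]
          !₂[0, Real.goldenRatio, Real.goldenRatio - 1]) ∪
      (cone3 !₂[Real.goldenRatio, 0, 0] !₂[Real.goldenRatio, Real.goldenRatio - 1, 0]
          !₂[1, 1, 1] ∪
        cone3 !₂[Real.goldenRatio, 0, 0] !₂[1, 1, 1]
          !₂[Real.goldenRatio - 1, 0, Real.goldenRatio])) := by
  have key : ∀ {u v w : ℝ}, (v ≤ u ∧ w ≤ u) ∨ (u ≤ v ∧ w ≤ v) ∨ (u ≤ w ∧ v ≤ w) := by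
    intro u v w
    grind
  rcases key (u := x 0 + Real.goldenRatio * x 1) (v := x 1 + Real.goldenRatio * x 2)
    (w := x 2 + Real.goldenRatio * x 0) with ⟨g1, g2⟩ | ⟨g1, g2⟩ | ⟨g1, g2⟩
  · refine Or.inl ?_
    rcases dodecahedron_facet (h0 0) (h0 1) (h0 2) h1 g1 g2 with
      ⟨a, b, c, ha, hb, hc, habc, e0, e1, e2⟩ | ⟨a, b, c, ha, hb, hc, habc, e0, e1, e2⟩
    · exact Or.inl (mem_cone3 ha hb hc habc fun i => by fin_cases i <;> simpa)
    · exact Or.inr (mem_cone3 ha hb hc habc fun i => by fin_cases i <;> simpa)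
  · refine Or.inr (Or.inl ?_)
    rcases dodecahedron_facet (h0 1) (h0 2) (h0 0) h2 g2 g1 with
      ⟨a, b, c, ha, hb, hc, habc, e0, e1, e2⟩ | ⟨a, b, c, ha, hb, hc, habc, e0, e1, e2⟩
    · exact Or.inl (mem_cone3 ha hb hc habc fun i => by fin_cases i <;> simpa)
    · exact Or.inr (mem_cone3 ha hb hc habc fun i => by fin_cases i <;> simpa)
  · refine Or.inr (Or.inr ?_)
    rcases dodecahedron_facet (h0 2) (h0 0) (h0 1) h3 g1 g2 with
      ⟨a, b, c, ha, hb, hc, habc, e0, e1, e2⟩ | ⟨a, b, c, ha, hb, hc, habc, e0, e1, e2⟩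
    · exact Or.inl (mem_cone3 ha hb hc habc fun i => by fin_cases i <;> simpa)
    · exact Or.inr (mem_cone3 ha hb hc habc fun i => by fin_cases i <;> simpa)


open MeasureTheory in
theorem volume_union_cone3_le {u v w : E3} {Q : Set E3} {a b : ℝ} (ha : |det3 u v w| / 6 ≤ a)
    (hb : 0 ≤ b) (hQ : volume Q ≤ ENNReal.ofReal b) :
    volume (cone3 u v w ∪ Q) ≤ ENNReal.ofReal (a + b) := by
  have h0 : 0 ≤ |det3 u v w| / 6 := by positivity
  rw [ENNReal.ofReal_add (h0.trans ha) hb]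
  refine (measure_union_le _ _).trans (add_le_add ?_ hQ)
  rw [volume_cone3]
  exact ENNReal.ofReal_le_ofReal ha

open MeasureTheory in
theorem volume_cone3_le {u v w : E3} {a : ℝ} (ha : |det3 u v w| / 6 ≤ a) :
    volume (cone3 u v w) ≤ ENNReal.ofReal a := by
  rw [volume_cone3]
  exact ENNReal.ofReal_le_ofReal ha

theorem abs_of_mem_signs {a : ℝ} (h : a ∈ ({1, -1} : Set ℝ)) : |a| = 1 := by
  rcases h with rfl | rfl <;> simp

-- The cones in one octant have total volume (2τ² + 3τ²)/6. That the cones fill the octant exactly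
-- need not be shown, since only an upper bound is used.
open MeasureTheory in
theorem volume_icosahedron_le : volume (convexHull ℝ icosahedronVertices) ≤
    ENNReal.ofReal (20 * (Real.goldenRatio + 1) / 3) := by
  have ht := Real.goldenRatio_sq
  have ht1 := Real.one_lt_goldenRatio
  have ht2 := Real.goldenRatio_lt_two
  -- A bound on a weighted sum of absolute values is a convex condition, so it needs checking at the
  -- vertices only, where signs play no role.
  have hfacet : ∀ {p q r : ℝ}, 0 ≤ p → 0 ≤ q → 0 ≤ r → ∀ d, q + r * Real.goldenRatio ≤ d →
      p * Real.goldenRatio + r ≤ d → p + q * Real.goldenRatio ≤ d →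
      ∀ x ∈ convexHull ℝ icosahedronVertices, p * |x 0| + q * |x 1| + r * |x 2| ≤ d := by
    intro p q r hp hq hr d e1 e2 e3 x hx
    refine convexHull_min ?_ (convex_weighted_abs hp hq hr d) hx
    rintro _ ⟨a, ha, b, hb, rfl | rfl | rfl⟩ <;>
      simpa [abs_mul, abs_of_mem_signs ha, abs_of_mem_signs hb,
        abs_of_pos Real.goldenRatio_pos]
  refine (volume_le_of_abs3_mem fun x hx => icosahedron_octant (fun i => ?_) ?_ ?_ ?_ ?_).trans ?_
  · fin_cases i <;> simp [abs3]
  · simpa [abs3] using hfacet zero_le_one zero_le_one zero_le_one _ (by linarith) (by linarith)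
      (by linarith) x hx
  · simpa [abs3] using hfacet zero_le_one le_rfl (by linarith : 0 ≤ Real.goldenRatio + 1)
      (2 * Real.goldenRatio + 1) (by nlinarith) (by linarith) (by linarith) x hx
  · simpa [abs3, add_comm] using hfacet (by linarith : 0 ≤ Real.goldenRatio + 1) zero_le_one le_rfl
      (2 * Real.goldenRatio + 1) (by linarith) (by nlinarith) (by linarith) x hx
  · simpa [abs3, add_comm] using hfacet le_rfl (by linarith : 0 ≤ Real.goldenRatio + 1) zero_le_one
      (2 * Real.goldenRatio + 1) (by linarith) (by linarith) (by nlinarith) x hx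
  · have hQ := volume_union_cone3_le (u := !₂[0, 1, Real.goldenRatio])
      (v := !₂[Real.goldenRatio, 0, 1]) (w := !₂[1, Real.goldenRatio, 0])
      (a := (2 * Real.goldenRatio + 2) / 6) ?_ ?_
      (volume_union_cone3_le (u := !₂[0, 1, Real.goldenRatio])
      (v := !₂[Real.goldenRatio, 0, 1]) (w := !₂[0, 0, Real.goldenRatio])
      (a := (Real.goldenRatio + 1) / 6) ?_ ?_
      (volume_union_cone3_le (u := !₂[Real.goldenRatio, 0, 1])
      (v := !₂[1, Real.goldenRatio, 0]) (w := !₂[Real.goldenRatio, 0, 0])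
      (a := (Real.goldenRatio + 1) / 6) ?_ ?_
      (volume_cone3_le (u := !₂[1, Real.goldenRatio, 0])
      (v := !₂[0, 1, Real.goldenRatio]) (w := !₂[0, Real.goldenRatio, 0])
      (a := (Real.goldenRatio + 1) / 6) ?_)))
    · refine (mul_le_mul_right hQ 8).trans_eq ?_
      rw [show (8 : ENNReal) = ENNReal.ofReal 8 by simp, ← ENNReal.ofReal_mul (by norm_num)]
      congr 1
      ring
    all_goals first | positivity | skip
    all_goals
      refine (div_le_div_iff_of_pos_right (by norm_num)).2 (abs_le.2 ⟨?_, ?_⟩) <;>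
      simp [det3] <;> nlinarith

-- Each octant is covered by three half pentagon cones, each consisting of two tetrahedra of volumes
-- 1/6 and (τ + 1)/6, which gives 24(τ + 2)/6.
open MeasureTheory in
theorem volume_dodecahedron_le : volume (convexHull ℝ dodecahedronVertices) ≤
    ENNReal.ofReal (4 * (Real.goldenRatio + 2)) := by
  have ht := Real.goldenRatio_sq
  have ht1 := Real.one_lt_goldenRatio
  have ht2 := Real.goldenRatio_lt_two
  have hfacet : ∀ {p q r : ℝ}, 0 ≤ p → 0 ≤ q → 0 ≤ r → ∀ d, p + q + r ≤ d →
      q * Real.goldenRatio + r * (Real.goldenRatio - 1) ≤ d →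
      p * (Real.goldenRatio - 1) + r * Real.goldenRatio ≤ d →
      p * Real.goldenRatio + q * (Real.goldenRatio - 1) ≤ d →
      ∀ x ∈ convexHull ℝ dodecahedronVertices, p * |x 0| + q * |x 1| + r * |x 2| ≤ d := by
    intro p q r hp hq hr d e1 e2 e3 e4 x hx
    have hinv : Real.goldenRatio⁻¹ = Real.goldenRatio - 1 := inv_eq_of_mul_eq_one_right (by
      linear_combination ht)
    refine convexHull_min ?_ (convex_weighted_abs hp hq hr d) hx
    rintro _ ⟨a, ha, b, hb, c, hc, rfl | rfl | rfl | rfl⟩ <;>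
      simpa [abs_mul, abs_of_mem_signs ha, abs_of_mem_signs hb, abs_of_mem_signs hc,
        abs_of_pos Real.goldenRatio_pos, abs_div, one_div, hinv]
  refine (volume_le_of_abs3_mem fun x hx => dodecahedron_octant (fun i => ?_) ?_ ?_ ?_).trans ?_
  · fin_cases i <;> simp [abs3]
  · simpa [abs3] using hfacet zero_le_one (by linarith : 0 ≤ Real.goldenRatio) le_rfl
      (Real.goldenRatio + 1) (by linarith) (by nlinarith) (by linarith) (by nlinarith) x hx
  · simpa [abs3] using hfacet le_rfl zero_le_one (by linarith : 0 ≤ Real.goldenRatio)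
      (Real.goldenRatio + 1) (by linarith) (by nlinarith) (by nlinarith) (by linarith) x hx
  · simpa [abs3, add_comm] using hfacet (by linarith : 0 ≤ Real.goldenRatio) le_rfl zero_le_one
      (Real.goldenRatio + 1) (by linarith) (by linarith) (by nlinarith) (by nlinarith) x hx
  · have h1 : ∀ {u v w : E3}, |det3 u v w| ≤ 1 → |det3 u v w| / 6 ≤ 1 / 6 := fun h =>
      (div_le_div_iff_of_pos_right (by norm_num)).2 h
    have h2 : ∀ {u v w : E3}, |det3 u v w| ≤ Real.goldenRatio + 1 →
        |det3 u v w| / 6 ≤ (Real.goldenRatio + 1) / 6 := fun h =>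
      (div_le_div_iff_of_pos_right (by norm_num)).2 h
    have hpair : ∀ {u v w u' v' w' : E3}, |det3 u v w| ≤ 1 →
        |det3 u' v' w'| ≤ Real.goldenRatio + 1 → volume (cone3 u v w ∪ cone3 u' v' w') ≤
          ENNReal.ofReal (1 / 6 + (Real.goldenRatio + 1) / 6) := fun h h' =>
      volume_union_cone3_le (h1 h) (by positivity) (volume_cone3_le (h2 h'))
    have hQ : ∀ {A B C : Set E3} {r : ℝ}, 0 ≤ r → volume A ≤ ENNReal.ofReal r →
        volume B ≤ ENNReal.ofReal r → volume C ≤ ENNReal.ofReal r →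
        8 * volume (A ∪ (B ∪ C)) ≤ ENNReal.ofReal (24 * r) := by
      intro A B C r hr hA hB hC
      have h3 : volume (A ∪ (B ∪ C)) ≤ ENNReal.ofReal (r + (r + r)) := by
        rw [ENNReal.ofReal_add hr (by linarith), ENNReal.ofReal_add hr hr]
        exact (measure_union_le _ _).trans
          (add_le_add hA ((measure_union_le _ _).trans (add_le_add hB hC)))
      refine (mul_le_mul_right h3 8).trans_eq ?_
      rw [show (8 : ENNReal) = ENNReal.ofReal 8 by simp, ← ENNReal.ofReal_mul (by norm_num)]
      congr 1
      ring
    refine (hQ (by positivity) (hpair ?_ ?_) (hpair ?_ ?_) (hpair ?_ ?_)).trans_eq ?_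
    case refine_7 =>
      congr 1
      ring
    all_goals
      refine abs_le.2 ⟨?_, ?_⟩ <;> simp [det3] <;> nlinarith

/-! ### The projections of the cells -/

/-- The vertices of an icosahedron, scaled by `r`. -/
def icoPoints (r : ℤ × ℤ) : List ZVec :=
  [1, -1].flatMap fun a => [1, -1].flatMap fun b =>
    [(zmul r (0, 0), zmul r (a, 0), zmul r (0, b)), (zmul r (0, b), zmul r (0, 0), zmul r (a, 0)),
      (zmul r (a, 0), zmul r (0, b), zmul r (0, 0))]

/-- The vertices of a dodecahedron, scaled by `r`. -/
def dodecPoints (r : ℤ × ℤ) : List ZVec :=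
  [1, -1].flatMap fun a => [1, -1].flatMap fun b => [1, -1].flatMap fun c =>
    -- The pair `(-b, b)` stands for b(τ - 1) = b/τ.
    [(zmul r (a, 0), zmul r (b, 0), zmul r (c, 0)), (zmul r (0, 0), zmul r (0, a), zmul r (-b, b)),
      (zmul r (-b, b), zmul r (0, 0), zmul r (0, a)),
      (zmul r (0, a), zmul r (-b, b), zmul r (0, 0))]

theorem inv_goldenRatio_eq : Real.goldenRatio⁻¹ = Real.goldenRatio - 1 :=
  inv_eq_of_mul_eq_one_right (by linear_combination Real.goldenRatio_sq)

theorem evv_mk_zmul (r x y z : ℤ × ℤ) :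
    evv (zmul r x, zmul r y, zmul r z) = ev r • !₂[ev x, ev y, ev z] := by
  ext j
  fin_cases j <;> simp [evv, ev_zmul]

theorem mem_realSigns {a : ℝ} (ha : a ∈ ({1, -1} : Set ℝ)) :
    ∃ b : ℤ, (b = 1 ∨ b = -1) ∧ a = b := by
  rcases ha with rfl | rfl
  · exact ⟨1, Or.inl rfl, by simp⟩
  · exact ⟨-1, Or.inr rfl, by simp⟩

theorem intCast_mem_realSigns {a : ℤ} (ha : a = 1 ∨ a = -1) : (a : ℝ) ∈ ({1, -1} : Set ℝ) := by
  rcases ha with rfl | rfl <;> simp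

theorem evv_image_icoPoints (r : ℤ × ℤ) :
    evv '' {z | z ∈ icoPoints r} = (fun x => ev r • x) '' icosahedronVertices := by
  ext x
  simp only [icoPoints, Set.mem_image, Set.mem_ofPred_eq, List.mem_flatMap, List.mem_cons,
    List.not_mem_nil, or_false, icosahedronVertices]
  constructor
  · rintro ⟨z, ⟨a, ha, b, hb, hz⟩, rfl⟩
    have ha' := intCast_mem_realSigns ha
    have hb' := intCast_mem_realSigns hb
    rcases hz with rfl | rfl | rfl <;> rw [evv_mk_zmul]
    · exact ⟨_, ⟨a, ha', b, hb', Or.inl rfl⟩, by simp [ev]⟩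
    · exact ⟨_, ⟨a, ha', b, hb', Or.inr (Or.inl rfl)⟩, by simp [ev]⟩
    · exact ⟨_, ⟨a, ha', b, hb', Or.inr (Or.inr rfl)⟩, by simp [ev]⟩
  · rintro ⟨_, ⟨a, ha, b, hb, hx⟩, rfl⟩
    obtain ⟨a, ha', rfl⟩ := mem_realSigns ha
    obtain ⟨b, hb', rfl⟩ := mem_realSigns hb
    rcases hx with rfl | rfl | rfl
    · exact ⟨_, ⟨a, ha', b, hb', Or.inl rfl⟩, by rw [evv_mk_zmul]; simp [ev]⟩
    · exact ⟨_, ⟨a, ha', b, hb', Or.inr (Or.inl rfl)⟩, by rw [evv_mk_zmul]; simp [ev]⟩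
    · exact ⟨_, ⟨a, ha', b, hb', Or.inr (Or.inr rfl)⟩, by rw [evv_mk_zmul]; simp [ev]⟩

theorem div_goldenRatio (b : ℝ) : b / Real.goldenRatio = -b + b * Real.goldenRatio := by
  rw [div_eq_mul_inv, inv_goldenRatio_eq]
  ring

theorem evv_image_dodecPoints (r : ℤ × ℤ) :
    evv '' {z | z ∈ dodecPoints r} = (fun x => ev r • x) '' dodecahedronVertices := by
  ext x
  simp only [dodecPoints, Set.mem_image, Set.mem_ofPred_eq, List.mem_flatMap, List.mem_cons,
    List.not_mem_nil, or_false, dodecahedronVertices, div_goldenRatio]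
  constructor
  · rintro ⟨z, ⟨a, ha, b, hb, c, hc, hz⟩, rfl⟩
    have ha' := intCast_mem_realSigns ha
    have hb' := intCast_mem_realSigns hb
    have hc' := intCast_mem_realSigns hc
    rcases hz with rfl | rfl | rfl | rfl <;> rw [evv_mk_zmul]
    · exact ⟨_, ⟨a, ha', b, hb', c, hc', Or.inl rfl⟩, by simp [ev]⟩
    · exact ⟨_, ⟨a, ha', b, hb', c, hc', Or.inr (Or.inl rfl)⟩, by simp [ev]⟩
    · exact ⟨_, ⟨a, ha', b, hb', c, hc', Or.inr (Or.inr (Or.inl rfl))⟩, by simp [ev]⟩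
    · exact ⟨_, ⟨a, ha', b, hb', c, hc', Or.inr (Or.inr (Or.inr rfl))⟩, by simp [ev]⟩
  · rintro ⟨_, ⟨a, ha, b, hb, c, hc, hx⟩, rfl⟩
    obtain ⟨a, ha', rfl⟩ := mem_realSigns ha
    obtain ⟨b, hb', rfl⟩ := mem_realSigns hb
    obtain ⟨c, hc', rfl⟩ := mem_realSigns hc
    rcases hx with rfl | rfl | rfl | rfl
    · exact ⟨_, ⟨a, ha', b, hb', c, hc', Or.inl rfl⟩, by rw [evv_mk_zmul]; simp [ev]⟩
    · exact ⟨_, ⟨a, ha', b, hb', c, hc', Or.inr (Or.inl rfl)⟩, by rw [evv_mk_zmul]; simp [ev]⟩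
    · exact ⟨_, ⟨a, ha', b, hb', c, hc', Or.inr (Or.inr (Or.inl rfl))⟩, by
        rw [evv_mk_zmul]; simp [ev]⟩
    · exact ⟨_, ⟨a, ha', b, hb', c, hc', Or.inr (Or.inr (Or.inr rfl))⟩, by
        rw [evv_mk_zmul]; simp [ev]⟩

/-- The isometry of `ℝ³` with `E_∥` that takes the origin to the projection of `c`. -/
def parIsometry (c : V6) : E3 →ᵃⁱ[ℝ] Epar :=
  (AffineIsometryEquiv.constVAdd ℝ Epar (Epar.orthogonalProjectionOnto c)).toAffineIsometry.comp
    parBasis.repr.symm.toLinearIsometry.toAffineIsometry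

theorem psi_smul_eq_parIsometry (c : V6) {l r : ℝ} (h : l = unitLen / 4 * r) (x : E3) :
    psi c (r • x) = parIsometry c (l • x) := by
  change _ = Epar.orthogonalProjectionOnto c +ᵥ parBasis.repr.symm (l • x)
  rw [psi_apply, map_smul, map_smul, smul_smul, ← h, vadd_eq_add, add_comm]

theorem projPar_eq_parIsometry_image (c : V6) {S : Set (Fin 6 → ℤ)} {W : Set E3} {l r : ℝ}
    (hS : convexHull ℝ ((fun v => evv (pt v)) '' S) = convexHull ℝ ((fun x => r • x) '' W))
    (h : l = unitLen / 4 * r) : projPar (convexHull ℝ (emb c '' S)) =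
      parIsometry c '' convexHull ℝ ((fun x => l • x) '' W) := by
  rw [projPar_convexHull_image, hS, AffineMap.image_convexHull, Set.image_image]
  simp only [psi_smul_eq_parIsometry c h]
  have := AffineMap.image_convexHull (parIsometry c).toAffineMap ((fun x => l • x) '' W)
  rw [Set.image_image] at this
  exact this.symm

open MeasureTheory in
theorem volume_convexHull_smul_image {r : ℝ} (hr : 0 ≤ r) {W : Set E3} {d : ℝ}
    (h : volume (convexHull ℝ W) ≤ ENNReal.ofReal d) :
    volume (convexHull ℝ ((fun x => r • x) '' W)) ≤ ENNReal.ofReal (r ^ 3 * d) := by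
  rw [Set.image_smul, convexHull_smul, Measure.addHaar_smul, finrank_euclideanSpace_fin,
    abs_of_nonneg (by positivity), ENNReal.ofReal_mul (by positivity)]
  gcongr

/-! ### The projected vertices: outer solids, and inner shells contained in them. -/

theorem pt_crossVerts : (∀ s ∈ signVectors, ∀ i, pt (crossPt s i) ∈ icoPoints (2, 0)) ∧
    ∀ z ∈ icoPoints (2, 0), ∃ s ∈ signVectors, ∃ i, pt (crossPt s i) = z := by decide +kernel

/-- The projected vertices form an icosahedron and a smaller dodecahedron, which turns out to lie
inside it. -/
theorem pt_hemiVerts_neg_one : (∀ s ∈ signVectors, signProd s = -1 →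
      pt s ∈ icoPoints (0, 2) ∨ pt s ∈ dodecPoints (2, 0)) ∧
    ∀ z ∈ icoPoints (0, 2), ∃ s ∈ signVectors, signProd s = -1 ∧ pt s = z := by decide +kernel

/-- For the other parity the roles are exchanged: the dodecahedron is the outer solid, and the inner
icosahedron has scale 2τ - 2 = 2/τ. -/
theorem pt_hemiVerts_one : (∀ s ∈ signVectors, signProd s = 1 →
      pt s ∈ dodecPoints (0, 2) ∨ pt s ∈ icoPoints (-2, 2)) ∧
    ∀ z ∈ dodecPoints (0, 2), ∃ s ∈ signVectors, signProd s = 1 ∧ pt s = z := by decide +kernel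

theorem cone3_subset {C : Set E3} (hC : Convex ℝ C) (h0 : (0 : E3) ∈ C) {u v w : E3} (hu : u ∈ C)
    (hv : v ∈ C) (hw : w ∈ C) : cone3 u v w ⊆ C := by
  refine convexHull_min ?_ hC
  rintro _ ⟨i, rfl⟩
  fin_cases i
  exacts [h0, hu, hv, hw]

theorem zero_mem_of_neg_mem {C : Set E3} (hC : Convex ℝ C) {u : E3} (hu : u ∈ C) (hu' : -u ∈ C) :
    (0 : E3) ∈ C := by
  have := hC hu hu' (a := 1 / 2) (b := 1 / 2) (by norm_num) (by norm_num) (by norm_num)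
  simpa using this


theorem zero_mem_icosahedron : (0 : E3) ∈ convexHull ℝ icosahedronVertices := by
  have h : ∀ a ∈ ({1, -1} : Set ℝ), !₂[0, a, a * Real.goldenRatio] ∈ icosahedronVertices :=
    fun a ha => ⟨a, ha, a, ha, Or.inl rfl⟩
  refine zero_mem_of_neg_mem (convex_convexHull ℝ _)
    (subset_convexHull ℝ _ (h 1 (by simp))) (subset_convexHull ℝ _ ?_)
  convert h (-1) (by simp) using 1
  ext j
  fin_cases j <;> simp

theorem zero_mem_dodecahedron : (0 : E3) ∈ convexHull ℝ dodecahedronVertices := by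
  have h : ∀ a ∈ ({1, -1} : Set ℝ), !₂[a, a, a] ∈ dodecahedronVertices :=
    fun a ha => ⟨a, ha, a, ha, a, ha, Or.inl rfl⟩
  refine zero_mem_of_neg_mem (convex_convexHull ℝ _)
    (subset_convexHull ℝ _ (h 1 (by simp))) (subset_convexHull ℝ _ ?_)
  convert h (-1) (by simp) using 1
  ext j
  fin_cases j <;> simp

theorem two_mul_goldenRatio_sub_three_nonneg : 0 ≤ 2 * Real.goldenRatio - 3 := by
  nlinarith [Real.goldenRatio_sq, Real.one_lt_goldenRatio]

/-- A small dodecahedron in an icosahedron. -/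
theorem dodecahedronVertices_subset {x : E3} (hx : x ∈ dodecahedronVertices) :
    (Real.goldenRatio - 1) • x ∈ convexHull ℝ icosahedronVertices := by
  have hs := two_mul_goldenRatio_sub_three_nonneg
  have ht := Real.goldenRatio_sq
  have ht2 : Real.goldenRatio ≤ 5 / 3 := by nlinarith [Real.goldenRatio_pos]
  -- A vertex of the dodecahedron lies on the axis through the centre of an icosahedron facet,
  -- whence three equal weights. They are τ⁻³ < 1/3; the rest of the weight goes to the origin.
  have key : ∀ {u v w y : E3}, u ∈ icosahedronVertices → v ∈ icosahedronVertices →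
      w ∈ icosahedronVertices → (∀ i, y i = (2 * Real.goldenRatio - 3) * u i +
        (2 * Real.goldenRatio - 3) * v i + (2 * Real.goldenRatio - 3) * w i) →
      y ∈ convexHull ℝ icosahedronVertices := fun hu hv hw hy =>
    cone3_subset (convex_convexHull ℝ _) zero_mem_icosahedron (subset_convexHull ℝ _ hu)
      (subset_convexHull ℝ _ hv) (subset_convexHull ℝ _ hw)
      (mem_cone3 hs hs hs (by linarith) hy)
  have h1 : (1 : ℝ) ∈ ({1, -1} : Set ℝ) := by simp
  have h1' : (-1 : ℝ) ∈ ({1, -1} : Set ℝ) := by simp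
  simp only [dodecahedronVertices, div_goldenRatio] at hx
  obtain ⟨a, ha, b, hb, c, hc, rfl | rfl | rfl | rfl⟩ := hx
  · refine key ⟨b, hb, c, hc, Or.inl rfl⟩ ⟨c, hc, a, ha, Or.inr (Or.inl rfl)⟩
      ⟨a, ha, b, hb, Or.inr (Or.inr rfl)⟩ fun i => ?_
    fin_cases i <;> simp <;> grind
  · refine key ⟨a, ha, b, hb, Or.inl rfl⟩ ⟨1, h1, a, ha, Or.inr (Or.inr rfl)⟩
      ⟨-1, h1', a, ha, Or.inr (Or.inr rfl)⟩ fun i => ?_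
    fin_cases i <;> simp <;> grind
  · refine key ⟨a, ha, b, hb, Or.inr (Or.inl rfl)⟩ ⟨1, h1, a, ha, Or.inl rfl⟩
      ⟨-1, h1', a, ha, Or.inl rfl⟩ fun i => ?_
    fin_cases i <;> simp <;> grind
  · refine key ⟨a, ha, b, hb, Or.inr (Or.inr rfl)⟩ ⟨1, h1, a, ha, Or.inr (Or.inl rfl)⟩
      ⟨-1, h1', a, ha, Or.inr (Or.inl rfl)⟩ fun i => ?_
    fin_cases i <;> simp <;> grind


/-- A small icosahedron in a dodecahedron. -/
theorem icosahedronVertices_subset {x : E3} (hx : x ∈ icosahedronVertices) :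
    (2 - Real.goldenRatio) • x ∈ convexHull ℝ dodecahedronVertices := by
  have hs := two_mul_goldenRatio_sub_three_nonneg
  have ht := Real.goldenRatio_sq
  have ht2 : 0 ≤ 5 - 3 * Real.goldenRatio := by nlinarith [Real.goldenRatio_pos]
  -- A vertex of the icosahedron lies on the axis of a pentagon. The weights belong to one corner of
  -- that pentagon and the two ends of the opposite edge.
  have key : ∀ {u v w y : E3}, u ∈ dodecahedronVertices → v ∈ dodecahedronVertices →
      w ∈ dodecahedronVertices → (∀ i, y i = (2 * Real.goldenRatio - 3) * u i +
        (5 - 3 * Real.goldenRatio) * v i + (5 - 3 * Real.goldenRatio) * w i) →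
      y ∈ convexHull ℝ dodecahedronVertices := fun hu hv hw hy =>
    cone3_subset (convex_convexHull ℝ _) zero_mem_dodecahedron (subset_convexHull ℝ _ hu)
      (subset_convexHull ℝ _ hv) (subset_convexHull ℝ _ hw)
      (mem_cone3 hs ht2 ht2 (by linarith) hy)
  have h1 : (1 : ℝ) ∈ ({1, -1} : Set ℝ) := by simp
  have h1' : (-1 : ℝ) ∈ ({1, -1} : Set ℝ) := by simp
  obtain ⟨a, ha, b, hb, rfl | rfl | rfl⟩ := hx
  · refine key ⟨a, ha, b, hb, 1, h1, Or.inr (Or.inl rfl)⟩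
      ⟨b, hb, 1, h1, 1, h1, Or.inr (Or.inr (Or.inl rfl))⟩
      ⟨b, hb, -1, h1', 1, h1, Or.inr (Or.inr (Or.inl rfl))⟩ fun i => ?_
    fin_cases i <;> simp [div_goldenRatio] <;> grind
  · refine key ⟨a, ha, b, hb, 1, h1, Or.inr (Or.inr (Or.inl rfl))⟩
      ⟨b, hb, 1, h1, 1, h1, Or.inr (Or.inr (Or.inr rfl))⟩
      ⟨b, hb, -1, h1', 1, h1, Or.inr (Or.inr (Or.inr rfl))⟩ fun i => ?_
    fin_cases i <;> simp [div_goldenRatio] <;> grind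
  · refine key ⟨a, ha, b, hb, 1, h1, Or.inr (Or.inr (Or.inr rfl))⟩
      ⟨b, hb, 1, h1, 1, h1, Or.inr (Or.inl rfl)⟩
      ⟨b, hb, -1, h1', 1, h1, Or.inr (Or.inl rfl)⟩ fun i => ?_
    fin_cases i <;> simp [div_goldenRatio] <;> grind

theorem smul_mem_convexHull_smul {W : Set E3} {r s t : ℝ} {x : E3} (h : s • x ∈ convexHull ℝ W)
    (hr : r = t * s) : r • x ∈ convexHull ℝ ((fun y => t • y) '' W) := by
  rw [Set.image_smul, convexHull_smul, hr, ← smul_smul]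
  exact Set.smul_mem_smul_set h

/-- A family of points is described by its extreme points `A`. -/
theorem convexHull_evv_image_eq {S : Set (Fin 6 → ℤ)} {A : List ZVec} {W : Set E3} {r : ℝ}
    (hA : evv '' {z | z ∈ A} = (fun x => r • x) '' W) (h1 : ∀ z ∈ A, ∃ v ∈ S, pt v = z)
    (h2 : ∀ v ∈ S, pt v ∈ A ∨ evv (pt v) ∈ convexHull ℝ ((fun x => r • x) '' W)) :
    convexHull ℝ ((fun v => evv (pt v)) '' S) = convexHull ℝ ((fun x => r • x) '' W) := by
  refine (convexHull_min ?_ (convex_convexHull ℝ _)).antisymm (convexHull_mono ?_)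
  · rintro _ ⟨v, hv, rfl⟩
    rcases h2 v hv with h | h
    · exact subset_convexHull ℝ _ (hA ▸ ⟨_, h, rfl⟩)
    · exact h
  · rw [← hA]
    rintro _ ⟨z, hz, rfl⟩
    obtain ⟨v, hv, rfl⟩ := h1 z hz
    exact ⟨v, hv, rfl⟩

theorem convexHull_crossVerts : convexHull ℝ ((fun v => evv (pt v)) '' crossVerts) =
    convexHull ℝ ((fun x => (2 : ℝ) • x) '' icosahedronVertices) := by
  refine convexHull_evv_image_eq (A := icoPoints (2, 0)) ?_ (fun z hz => ?_) fun v hv => Or.inl ?_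
  · rw [evv_image_icoPoints]
    norm_num [ev]
  · obtain ⟨s, hs, i, h⟩ := pt_crossVerts.2 z hz
    exact ⟨_, ⟨s, i, mem_signVectors.1 hs, rfl⟩, h⟩
  · obtain ⟨s, i, hs, rfl⟩ := hv
    exact pt_crossVerts.1 s (mem_signVectors.2 hs) i

theorem convexHull_hemiVerts_neg_one :
    convexHull ℝ ((fun v => evv (pt v)) '' hemiVerts (-1)) =
      convexHull ℝ ((fun x => (2 * Real.goldenRatio) • x) '' icosahedronVertices) := by
  refine convexHull_evv_image_eq (A := icoPoints (0, 2)) ?_ (fun z hz => ?_) fun v hv => ?_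
  · rw [evv_image_icoPoints]
    simp [ev]
  · obtain ⟨s, hs, h⟩ := pt_hemiVerts_neg_one.2 z hz
    exact ⟨s, ⟨mem_signVectors.1 hs, h.1⟩, h.2⟩
  · refine (pt_hemiVerts_neg_one.1 v (mem_signVectors.2 hv.1) hv.2).imp_right fun h => ?_
    obtain ⟨x, hx, he⟩ := (evv_image_dodecPoints (2, 0)).subset ⟨_, h, rfl⟩
    rw [← he]
    refine smul_mem_convexHull_smul (dodecahedronVertices_subset hx) ?_
    simp only [ev]
    push_cast
    linear_combination (-2) * Real.goldenRatio_sq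

theorem convexHull_hemiVerts_one :
    convexHull ℝ ((fun v => evv (pt v)) '' hemiVerts 1) =
      convexHull ℝ ((fun x => (2 * Real.goldenRatio) • x) '' dodecahedronVertices) := by
  refine convexHull_evv_image_eq (A := dodecPoints (0, 2)) ?_ (fun z hz => ?_) fun v hv => ?_
  · rw [evv_image_dodecPoints]
    simp [ev]
  · obtain ⟨s, hs, h⟩ := pt_hemiVerts_one.2 z hz
    exact ⟨s, ⟨mem_signVectors.1 hs, h.1⟩, h.2⟩
  · refine (pt_hemiVerts_one.1 v (mem_signVectors.2 hv.1) hv.2).imp_right fun h => ?_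
    obtain ⟨x, hx, he⟩ := (evv_image_icoPoints (-2, 2)).subset ⟨_, h, rfl⟩
    rw [← he]
    refine smul_mem_convexHull_smul (icosahedronVertices_subset hx) ?_
    simp only [ev]
    push_cast
    linear_combination 2 * Real.goldenRatio_sq

theorem isIcosahedron_projPar (c : V6) {S : Set (Fin 6 → ℤ)} {l r : ℝ}
    (hS : convexHull ℝ ((fun v => evv (pt v)) '' S) =
      convexHull ℝ ((fun x => r • x) '' icosahedronVertices))
    (h : l / 2 = unitLen / 4 * r) : IsIcosahedron l (projPar (convexHull ℝ (emb c '' S))) :=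
  ⟨parIsometry c, projPar_eq_parIsometry_image c hS h⟩

/-- The tile volumes, for short edges 4, add up exactly to the upper bound for the scaled solid;
this equality is what makes the tiles fill it. -/
theorem sum_tiles_omega1 :
    ∑ k, ((![7, 6, 0, 0, 2, 1] : Fin 6 → ℕ) k : ℝ) * (4 ^ 3 * tileVolume k) =
      2 ^ 3 * (20 * (Real.goldenRatio + 1) / 3) := by
  have h := Real.goldenRatio_sq
  simp [Fin.sum_univ_six, tileVolume]
  grind

theorem sum_tiles_omega5 :
    ∑ k, ((![1, 8, 10, 10, 16, 3] : Fin 6 → ℕ) k : ℝ) * (4 ^ 3 * tileVolume k) =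
      (2 * Real.goldenRatio) ^ 3 * (20 * (Real.goldenRatio + 1) / 3) := by
  have h := Real.goldenRatio_sq
  simp [Fin.sum_univ_six, tileVolume]
  grind

theorem sum_tiles_omega6 :
    ∑ k, ((![3, 4, 10, 10, 4, 7] : Fin 6 → ℕ) k : ℝ) * (4 ^ 3 * tileVolume k) =
      (2 * Real.goldenRatio) ^ 3 * (4 * (Real.goldenRatio + 2)) := by
  have h := Real.goldenRatio_sq
  simp [Fin.sum_univ_six, tileVolume]
  grind

/-! ### Assembling the statements about the three cells. -/

theorem deloneCell_omega1_eq : deloneCell omega1 = convexHull ℝ (emb omega1 '' crossVerts) := by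
  rw [deloneCell, deloneVertices_omega1_eq]

theorem deloneCell_omega5_eq :
    deloneCell omega5 = convexHull ℝ (emb omega5 '' hemiVerts (-1)) := by
  rw [deloneCell, deloneVertices_omega5_eq]

theorem deloneCell_omega6_eq : deloneCell omega6 = convexHull ℝ (emb omega6 '' hemiVerts 1) := by
  rw [deloneCell, deloneVertices_omega6_eq]

theorem IsFaceList.isTetrahedron_of_mem {S : Set (Fin 6 → ℤ)} {L : List (Fin 4 → Fin 6 → ℤ)}
    (h : IsFaceList S L) (c : V6) :
    ∀ F ∈ threeFaces (convexHull ℝ (emb c '' S)), IsTetrahedron F := fun F hF => by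
  obtain ⟨q, hq, rfl⟩ := (h.mem_threeFaces_iff c F).1 hF
  exact h.isTetrahedron c hq

theorem hemicube_faces {p : ℤ} (hp : p = 1 ∨ p = -1) (c : V6)
    (hL : nodupMask ((hemiFaces p).map faceCode) 0 = true) (hlen : (hemiFaces p).length = 640)
    (hk : checkKinds (hemiFaces p) [0, 1, 2, 3, 4, 5] 120) :
    (threeFaces (convexHull ℝ (emb c '' hemiVerts p))).ncard = 640 ∧
    (∀ F ∈ threeFaces (convexHull ℝ (emb c '' hemiVerts p)), IsTetrahedron F) ∧
    (∀ F ∈ threeFaces (convexHull ℝ (emb c '' hemiVerts p)), IsFlat (projPar F) ∨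
      ∃ k : Fin 6, IsTile unitLen k (projPar F)) ∧
    (∀ k : Fin 6, ∃ F ∈ threeFaces (convexHull ℝ (emb c '' hemiVerts p)),
      IsTile unitLen k (projPar F)) ∧
    {F | F ∈ threeFaces (convexHull ℝ (emb c '' hemiVerts p)) ∧ IsFlat (projPar F)}.ncard =
      120 := by
  have h := isFaceList_hemiFaces hp
  obtain ⟨h1, h2, h3⟩ := h.projections hL c [0, 1, 2, 3, 4, 5] 120 hk
  refine ⟨(h.ncard hL c).trans hlen, h.isTetrahedron_of_mem c, fun F hF => ?_, fun k => ?_, h3⟩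
  · exact (h1 F hF).imp_right fun ⟨k, _, hk⟩ => ⟨k, hk⟩
  · exact h2 k (by fin_cases k <;> simp)

end

theorem mainTheorem4 :
    Module.finrank ℝ Epar = 3 ∧
    -- The six tiles: edge lengths and volumes
    (∀ (s : ℝ), 0 < s → ∀ (k : Fin 6) (v : Fin 4 → Epar), IsTileVertices s k v →
      (∀ i j, i ≠ j → dist (v i) (v j) = s ∨ dist (v i) (v j) = s * Real.goldenRatio) ∧
      volPar (convexHull ℝ (Set.range v)) =
        ENNReal.ofReal (s ^ 3 * tileVolume k)) ∧
    -- The Delone cell of `ω₁` is a cross polytope; its 240 three-dimensional faces are tetrahedra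
    (deloneVertices omega1 = {x | ∃ i, x = omega1 + basisVec i ∨ x = omega1 - basisVec i} ∧
      (threeFaces (deloneCell omega1)).ncard = 240 ∧
      ∀ F ∈ threeFaces (deloneCell omega1), IsTetrahedron F) ∧
    -- Their projections are the tiles `t₁`, `t₂`, `t₅`, `t₆`, except for 60 flat ones
    ((∀ F ∈ threeFaces (deloneCell omega1), IsFlat (projPar F) ∨
        ∃ k ∈ ({0, 1, 4, 5} : Set (Fin 6)), IsTile unitLen k (projPar F)) ∧
      (∀ k ∈ ({0, 1, 4, 5} : Set (Fin 6)), ∃ F ∈ threeFaces (deloneCell omega1),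
        IsTile unitLen k (projPar F)) ∧
      {F | F ∈ threeFaces (deloneCell omega1) ∧ IsFlat (projPar F)}.ncard = 60) ∧
    -- The icosahedron `i(1)`
    (IsIcosahedron unitLen (projPar (deloneCell omega1)) ∧
      IsDissected unitLen ![7, 6, 0, 0, 2, 1] (projPar '' threeFaces (deloneCell omega1))
        (projPar (deloneCell omega1))) ∧
    -- The Delone cells of `ω₅` and `ω₆` are hemicubes; their 640 three-dimensional faces are
    -- tetrahedra
    (deloneVertices omega5 = {x | ∃ e : Fin 6 → ℤˣ, ∏ i, e i = -1 ∧
        x = omega5 + ∑ i, (((e i : ℤ) : ℝ) / 2) • basisVec i} ∧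
      deloneVertices omega6 = {x | ∃ e : Fin 6 → ℤˣ, ∏ i, e i = 1 ∧
        x = omega6 + ∑ i, (((e i : ℤ) : ℝ) / 2) • basisVec i}) ∧
    (∀ w ∈ ({omega5, omega6} : Set V6),
      (threeFaces (deloneCell w)).ncard = 640 ∧
      (∀ F ∈ threeFaces (deloneCell w), IsTetrahedron F) ∧
      -- Their projections are the six tiles, except for 120 flat ones
      (∀ F ∈ threeFaces (deloneCell w), IsFlat (projPar F) ∨
        ∃ k : Fin 6, IsTile unitLen k (projPar F)) ∧
      (∀ k : Fin 6, ∃ F ∈ threeFaces (deloneCell w), IsTile unitLen k (projPar F)) ∧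
      {F | F ∈ threeFaces (deloneCell w) ∧ IsFlat (projPar F)}.ncard = 120) ∧
    -- The icosahedron `i(τ)`
    (IsIcosahedron (unitLen * Real.goldenRatio) (projPar (deloneCell omega5)) ∧
      IsDissected unitLen ![1, 8, 10, 10, 16, 3] (projPar '' threeFaces (deloneCell omega5))
        (projPar (deloneCell omega5))) ∧
    -- The dodecahedron `d(1)`
    (IsDodecahedron unitLen (projPar (deloneCell omega6)) ∧
      IsDissected unitLen ![3, 4, 10, 10, 4, 7] (projPar '' threeFaces (deloneCell omega6))
        (projPar (deloneCell omega6))) := by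
  refine ⟨finrank_Epar, fun s hs k v hv => ⟨fun i j hij => dist_of_isTileVertices hs hv i j hij,
    volPar_convexHull_of_isTileVertices hs hv⟩, ?_⟩
  rw [deloneCell_omega1_eq, deloneCell_omega5_eq, deloneCell_omega6_eq]
  have h1 := isFaceList_crossFaces
  obtain ⟨p1, p2, p3⟩ := h1.projections nodupMask_crossFaces omega1 [0, 1, 4, 5] 60
    checkKinds_crossFaces
  have hks : ∀ k : Fin 6, k ∈ ({0, 1, 4, 5} : Set (Fin 6)) ↔ k ∈ [0, 1, 4, 5] := fun k => by simp
  refine ⟨⟨deloneVertices_omega1_eq.trans (image_emb_crossVerts _),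
    (h1.ncard nodupMask_crossFaces _).trans length_crossFaces, h1.isTetrahedron_of_mem _⟩,
    ⟨?_, ?_, p3⟩, ⟨?_, ?_⟩, ⟨deloneVertices_omega5_eq.trans (image_emb_hemiVerts _ (-1)),
      deloneVertices_omega6_eq.trans (image_emb_hemiVerts _ 1)⟩, ?_, ⟨?_, ?_⟩, ?_, ?_⟩
  · simpa only [hks] using p1
  · simpa only [hks] using p2
  · exact isIcosahedron_projPar _ convexHull_crossVerts (by ring)
  · refine h1.isDissected _ tilesOmega1 checkDissection_omega1 (by simp) ?_
    rw [convexHull_crossVerts, sum_tiles_omega1]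
    exact volume_convexHull_smul_image (by norm_num) volume_icosahedron_le
  · rintro w (rfl | rfl)
    · rw [deloneCell_omega5_eq]
      exact hemicube_faces (Or.inr rfl) _ nodupMask_hemiFaces_neg_one length_hemiFaces_neg_one
        checkKinds_hemiFaces_neg_one
    · rw [deloneCell_omega6_eq]
      exact hemicube_faces (Or.inl rfl) _ nodupMask_hemiFaces_one length_hemiFaces_one
        checkKinds_hemiFaces_one
  · exact isIcosahedron_projPar _ convexHull_hemiVerts_neg_one (by ring)
  · refine (isFaceList_hemiFaces (Or.inr rfl)).isDissected _ tilesOmega5 checkDissection_omega5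
      (by simp) ?_
    rw [convexHull_hemiVerts_neg_one, sum_tiles_omega5]
    exact volume_convexHull_smul_image (by positivity) volume_icosahedron_le
  · exact ⟨parIsometry omega6, projPar_eq_parIsometry_image omega6 convexHull_hemiVerts_one
      (by ring)⟩
  · refine (isFaceList_hemiFaces (Or.inl rfl)).isDissected _ tilesOmega6 checkDissection_omega6
      (by simp) ?_
    rw [convexHull_hemiVerts_one, sum_tiles_omega6]
    exact volume_convexHull_smul_image (by positivity) volume_dodecahedron_le
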